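/- Let $m,n$ be integers with $1\le n\le m$, let $\mathbb F$ be a field, and let $\mathcal U_{n,m}$ be a generic central arrangement, i.e. an arrangement of $m$ hyperplanes $H_1,\dots,H_m$ through the origin in $\mathbb F^n$ such that for each $k\le n$ the intersection of any $k$ of the $H_i$ has codimension $k$. Definitions. For a hyperplane arrangement $\mathcal A$ let $\mathcal L(\mathcal A)$ be the poset of nonempty intersections of hyperplanes of $\mathcal A$, ordered by reverse inclusion, with bottom element $\hat 0$ (the ambient space), and let $\widetilde{\mathcal L}(\mathcal A)=\mathcal L(\mathcal A)\setminus\{\hat 0\}$. Put $\mathcal A_x=\{H\in\mathcal A: x\subseteq H\}$ (so $\mathcal A_\varnothing=\mathcal A$), $\mathcal A^x=\{x\cap H: H\in\mathcal A\setminus\mathcal A_x,\ x\cap H\neq\varnothing\}$ (an arrangement in $x$), $\mathcal A^x_y=(\mathcal A^x)_y$ and $\pi_{\mathcal A}(Y)=\sum_{x\in\mathcal L(\mathcal A)}\mu(\hat 0,x)(-Y)^{\mathrm{rk}(x)}$. For a (possibly empty) chain $F=(x_1<\dots<x_\ell)$ in $\widetilde{\mathcal L}(\mathcal A)$ put $\pi_F(Y)=\prod_{k=0}^{\ell}\pi_{\mathcal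 A^{x_k}_{x_{k+1}}}(Y)$, where $x_0=\hat 0$ and $x_{\ell+1}=\varnothing$. With indeterminates $\mathbf T=(T_x)_{x\in\widetilde{\mathcal L}(\mathcal A)}$, the flag Hilbert–Poincaré series is $$\mathsf{fHP}_{\mathcal A}(Y,\mathbf T)=\sum_F \pi_F(Y)\prod_{x\in F}\frac{T_x}{1-T_x}\in\mathbb Q(\mathbf T)[Y],$$ summed over all chains $F$ in $\widetilde{\mathcal L}(\mathcal A)$. Suppose that $\mathcal A$ is an arrangement over a field of characteristic zero. Represent $\mathcal L(\mathcal A)$ as the intersection poset of an arrangement in $K^d$, $K$ a number field, whose hyperplanes are the zero sets of affine linear polynomials $L_H$ over the ring of integers $\mathcal O_K$. For a compact discrete valuation ring $\mathfrak o$ that is an $\mathcal O_K$-algebra, with residue field of cardinality $q$ and absolute value $|\cdot|=q^{-v(\cdot)}$, let $$\zeta_{\mathcal A(\mathfrak o)}(\mathbf s)=\int_{\mathfrak o^d}\prod_{x\in\widetilde{\mathcal L}(\mathcal A)}\Big(\max_{H\supseteq x}|L_H(X)|\Big)^{s_x}\,|\mathrm dX|,$$ with respect to the Haar measure of total mass $1$.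 For $f\ge 1$ let $\mathfrak o^{(f)}$ be the unramified extension of $\mathfrak o$ of degree $f$. The multivariate topological zeta function $\zeta^{\mathrm{top}}_{\mathcal A}(\mathbf s)\in\mathbb Q(\mathbf s)$ is the limit of $\zeta_{\mathcal A(\mathfrak o^{(f)})}(\mathbf s)$ as $f\to 0$, for all $\mathfrak o$ whose residue characteristic avoids a finite set of primes. This means: there is a rational function $W(Y,\mathbf T)$ over $\mathbb Q$ with $\zeta_{\mathcal A(\mathfrak o^{(f)})}(\mathbf s)=W(-q^{-f},(q^{-fs_x})_x)$ for all $f\ge 1$, and $\zeta^{\mathrm{top}}_{\mathcal A}(\mathbf s)$ is the constant term of $W(-Q^{-1},(Q^{-s_x})_x)$ expanded as a power series in $Q-1$ over $\mathbb Q(\mathbf s)$, where $Q^a=\sum_{k\ge 0}\binom ak(Q-1)^k$. For a finite set $I$ let $\widetilde{\mathrm{WO}}(I)$ be the set of all (possibly empty) chains of nonempty subsets of $I$, and let $$\mathcal I^{\mathrm{WO}}_{I}(\mathbf T)=\sum_{F\in\widetilde{\mathrm{WO}}(I)}\prod_{J\in F}\frac{T_J}{1-T_J}$$ be the weak order zeta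 function. For $\mathcal A=\mathcal U_{n,m}$ and $\varnothing\ne I\subseteq[m]$ with $|I|\le n-1$ write $T_I$ and $s_I$ for the variables of the intersection $\bigcap_{i\in I}H_i$, and $T_{\hat 1}$ and $s_{\hat 1}$ for those of $\hat 1=\bigcap_{i=1}^mH_i$. Claim. Firstly, $$\mathsf{fHP}_{\mathcal U_{n,m}}(Y,\mathbf T)=\frac{1+Y}{1-T_{\hat 1}}\sum_{k=0}^{n-1}\binom{m-1}{k}Y^k+\sum_{\ell=1}^{n-1}\sum_{k=0}^{n-\ell-1}\frac{(1+Y)^{\ell+1}}{1-T_{\hat 1}}\binom{m-\ell-1}{k}Y^k\sum_{\substack{I\subseteq[m]\\ |I|=\ell}}T_I\,\mathcal I^{\mathrm{WO}}_{I}\big((T_J)_{\varnothing\ne J\subseteq I}\big).$$ Secondly, if $\mathbb F$ has characteristic zero, then, with $Q(\mathbf s)=n+s_{\hat 1}+\sum_{J\subseteq[m],\,1\le|J|\le n-1}s_J$, $$\zeta^{\mathrm{top}}_{\mathcal U_{n,m}}(\mathbf s)\cdot Q(\mathbf s)=\sum_{k=0}^{n-1}(-1)^k\binom{m-1}{k}+\sum_{\ell=1}^{n-1}\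 \sum_{\substack{I\subseteq[m]\\|I|=\ell}}\ \sum_{\substack{F\in\widetilde{\mathrm{WO}}(I)\\|F|=\ell}}\frac{\sum_{k=0}^{n-\ell-1}(-1)^k\binom{m-\ell-1}{k}}{\prod_{J\in F}\big(|J|+\sum_{\varnothing\ne M\subseteq J}s_M\big)}.$$ -/

import Mathlib

noncomputable section

/-- A hyperplane arrangement: a finite set of affine hyperplanes in a (nonempty) affine space
`ambient`.  The ambient space is allowed to be any affine subspace of `V`, so that restrictions of
arrangements to their flats are again arrangements. -/
structure HyperplaneArrangement (F V : Type*) [Field F] [AddCommGroup V] [Module F V] where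
  ambient : AffineSubspace F V
  hyperplanes : Finset (AffineSubspace F V)
  ambient_nonempty : (ambient : Set V).Nonempty
  nonempty : ∀ H ∈ hyperplanes, (H : Set V).Nonempty
  le_ambient : ∀ H ∈ hyperplanes, H ≤ ambient
  covBy : ∀ H ∈ hyperplanes, H.direction ⋖ ambient.direction

namespace HyperplaneArrangement

variable {F V : Type*} [Field F] [AddCommGroup V] [Module F V]

/-- The intersection poset `L(A)`: all nonempty intersections of hyperplanes of `A` (the empty
intersection being the ambient space), ordered by reverse inclusion. -/
def Flat (A : HyperplaneArrangement F V) : Type _ :=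
  {x : (AffineSubspace F V)ᵒᵈ // ((OrderDual.ofDual x : AffineSubspace F V) : Set V).Nonempty ∧
    ∃ B ⊆ A.hyperplanes, A.ambient ⊓ B.inf id = OrderDual.ofDual x}

instance (A : HyperplaneArrangement F V) : PartialOrder A.Flat :=
  inferInstanceAs (PartialOrder {_x : (AffineSubspace F V)ᵒᵈ // _})

/-- The affine subspace underlying a flat. -/
def Flat.space {A : HyperplaneArrangement F V} (x : A.Flat) : AffineSubspace F V :=
  OrderDual.ofDual x.1

instance (A : HyperplaneArrangement F V) : OrderBot A.Flat where
  bot := ⟨OrderDual.toDual A.ambient, A.ambient_nonempty, ∅, by simp, by simp⟩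
  bot_le := by
    rintro ⟨x, hx, B, hB, h⟩
    change OrderDual.ofDual x ≤ A.ambient
    rw [← h]
    exact inf_le_left

instance (A : HyperplaneArrangement F V) : Finite A.Flat := by
  refine Set.Finite.to_subtype (s := {x : (AffineSubspace F V)ᵒᵈ | _ ∧ _}) ?_
  refine ((A.hyperplanes.powerset.finite_toSet).image
    fun B => OrderDual.toDual (A.ambient ⊓ B.inf id)).subset ?_
  rintro x ⟨-, B, hB, h⟩
  exact ⟨B, by simpa using hB, congrArg OrderDual.toDual h⟩

instance (A : HyperplaneArrangement F V) : Fintype A.Flat := Fintype.ofFinite _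

open Classical in
instance (A : HyperplaneArrangement F V) : LocallyFiniteOrder A.Flat :=
  Fintype.toLocallyFiniteOrder

/-- The set of flats different from the bottom element. -/
abbrev PosFlat (A : HyperplaneArrangement F V) : Type _ := {x : A.Flat // x ≠ ⊥}

instance (A : HyperplaneArrangement F V) : Fintype A.PosFlat := Fintype.ofFinite _

open Classical in
/-- The subarrangement `A_y = {H ∈ A | y ⊆ H}`; in particular `A_∅ = A`. -/
def sub (A : HyperplaneArrangement F V) (y : AffineSubspace F V) : HyperplaneArrangement F V where
  ambient := A.ambient
  hyperplanes := A.hyperplanes.filter fun H => y ≤ H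
  ambient_nonempty := A.ambient_nonempty
  nonempty H hH := A.nonempty H (Finset.mem_filter.1 hH).1
  le_ambient H hH := A.le_ambient H (Finset.mem_filter.1 hH).1
  covBy H hH := A.covBy H (Finset.mem_filter.1 hH).1

open Classical in
/-- The restriction `A^x = {x ∩ H | H ∈ A \ A_x, x ∩ H ≠ ∅}`, an arrangement in the space `x`. -/
def restrict (A : HyperplaneArrangement F V) (x : A.Flat) : HyperplaneArrangement F V where
  ambient := x.space
  hyperplanes := (A.hyperplanes.filter fun H =>
    ¬ x.space ≤ H ∧ ((x.space ⊓ H : AffineSubspace F V) : Set V).Nonempty).image (x.space ⊓ ·)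
  ambient_nonempty := x.2.1
  nonempty := by
    intro H hH
    obtain ⟨H, hH', rfl⟩ := Finset.mem_image.1 hH
    exact (Finset.mem_filter.1 hH').2.2
  le_ambient := by
    intro H hH
    obtain ⟨H, hH, rfl⟩ := Finset.mem_image.1 hH
    exact inf_le_left
  covBy := by
    intro H hH
    obtain ⟨H, hH', rfl⟩ := Finset.mem_image.1 hH
    obtain ⟨hA, hle, p, hp⟩ := Finset.mem_filter.1 hH'
    have hp : p ∈ x.space ∧ p ∈ H := hp
    rw [AffineSubspace.direction_inf_of_mem hp.1 hp.2]
    have hcov := A.covBy H hA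
    have hxW : x.space.direction ≤ A.ambient.direction :=
      AffineSubspace.direction_le (show x.space ≤ A.ambient from bot_le (a := x))
    have hnle : ¬ x.space.direction ≤ H.direction := by
      intro h
      apply hle
      intro r hr
      have := h (AffineSubspace.vsub_mem_direction hr hp.1)
      simpa using AffineSubspace.vadd_mem_of_mem_direction this hp.2
    have hsup : x.space.direction ⊔ H.direction = A.ambient.direction := by
      rcases hcov.eq_or_eq le_sup_right (sup_le hxW hcov.le) with h | h
      · exact absurd (sup_eq_right.1 h) hnle
      · exact h
    rw [← hsup] at hcov
    exact inf_covBy_of_covBy_sup_right hcov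

open Classical in
/-- The Poincaré polynomial `π_A(Y) = ∑_{x ∈ L(A)} μ(x) (-Y)^{rk x}`. -/
def poincare (A : HyperplaneArrangement F V) : Polynomial ℤ :=
  ∑ x : A.Flat, Polynomial.C (IncidenceAlgebra.mu ℤ (⊥ : A.Flat) x) *
    (-Polynomial.X) ^ (Order.height x).toNat

open Classical in
/-- The order complex of the poset of flats different from the bottom element: its finite chains,
the empty one included. -/
def flags (A : HyperplaneArrangement F V) : Finset (Finset A.PosFlat) :=
  Finset.univ.filter fun Φ => IsChain (· ≤ ·) (Φ : Set A.PosFlat)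

/-- For a flag `x₁ < ⋯ < x_ℓ`, with `x₀` the bottom element and `x_{ℓ+1} = ∅`, this is the space
`x_{k+1}` that follows `x = x_k`: the largest of the spaces of the elements of the flag that are
greater than `x`, which is the empty affine space if there are none. -/
def flagNext {A : HyperplaneArrangement F V} (Φ : Finset A.PosFlat) (x : A.Flat) :
    AffineSubspace F V :=
  ⨆ y ∈ Φ, ⨆ _ : x < y.1, y.1.space

open Classical in
/-- `π_Φ(Y) = ∏_{k=0}^{ℓ} π_{A^{x_k}_{x_{k+1}}}(Y)` for a flag `Φ = (x₁ < ⋯ < x_ℓ)`, with `x₀` the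
bottom element and `x_{ℓ+1} = ∅`. -/
def flagPoincare {A : HyperplaneArrangement F V} (Φ : Finset A.PosFlat) : Polynomial ℤ :=
  ∏ x ∈ insert (⊥ : A.Flat) (Φ.image Subtype.val), ((A.restrict x).sub (flagNext Φ x)).poincare

/-- The field of rational functions over `ℚ` in indeterminates indexed by the flats of `A`
different from the bottom element. -/
abbrev RatFun (A : HyperplaneArrangement F V) : Type _ :=
  FractionRing (MvPolynomial A.PosFlat ℚ)

/-- The indeterminate of a flat different from the bottom element. -/
def var (A : HyperplaneArrangement F V) (x : A.PosFlat) : A.RatFun :=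
  algebraMap (MvPolynomial A.PosFlat ℚ) A.RatFun (MvPolynomial.X x)

open Classical in
/-- The indeterminate attached to an affine subspace `x` that is a flat of `A` different from the
bottom element (and `0` for all other affine subspaces). -/
def varOf (A : HyperplaneArrangement F V) (x : AffineSubspace F V) : A.RatFun :=
  if h : ∃ y : A.PosFlat, y.1.space = x then A.var h.choose else 0

/-- The flag Hilbert–Poincaré series of `A`, a polynomial in `Y` over the field of rational
functions in the indeterminates `T_x`. -/
def fHP (A : HyperplaneArrangement F V) : Polynomial A.RatFun :=
  ∑ Φ ∈ A.flags, (flagPoincare Φ).map (Int.castRingHom A.RatFun) *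
    Polynomial.C (∏ x ∈ Φ, A.var x / (1 - A.var x))

end HyperplaneArrangement

/-! ### Analytic zeta functions -/

section Analytic

open MeasureTheory

/-- The normalized absolute value `|x| = q ^ (-v x)` on a discrete valuation ring with residue
field of cardinality `q`. -/
def dvrAbs {o : Type*} [CommRing o] [IsDomain o] [IsDiscreteValuationRing o] (x : o) : NNReal :=
  open Classical in
  if x = 0 then 0 else
    ((Nat.card (IsLocalRing.ResidueField o) : NNReal)⁻¹) ^
      (IsDiscreteValuationRing.addVal o x).toNat

variable {K : Type*} [Field K] [NumberField K] {d : ℕ}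

/-- A choice, for every hyperplane of an arrangement in `K ^ d`, of an affine linear polynomial
`c_H + ∑ α_{H,j} X_j` with coefficients in the ring of integers of `K` whose zero set is `H`. -/
structure HyperplaneArrangement.IntegralForms (B : HyperplaneArrangement K (Fin d → K)) where
  coeff : B.hyperplanes → Fin d → NumberField.RingOfIntegers K
  const : B.hyperplanes → NumberField.RingOfIntegers K
  mem_iff : ∀ (H : B.hyperplanes) (z : Fin d → K),
    z ∈ H.1 ↔ (const H : K) + ∑ j, (coeff H j : K) * z j = 0

/-- The value at `z ∈ o ^ d` of the chosen affine linear polynomial of `H`. -/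
def HyperplaneArrangement.IntegralForms.eval {B : HyperplaneArrangement K (Fin d → K)}
    (L : B.IntegralForms) {o : Type*} [CommRing o] [Algebra (NumberField.RingOfIntegers K) o]
    (H : B.hyperplanes) (z : Fin d → o) : o :=
  algebraMap _ o (L.const H) + ∑ j, algebraMap _ o (L.coeff H j) * z j

open Classical in
/-- `‖B_x‖(z)`, the maximum of the `|L_H(z)|` over the hyperplanes `H` of `B` that contain `x`. -/
def HyperplaneArrangement.IntegralForms.maxAbs {B : HyperplaneArrangement K (Fin d → K)}
    (L : B.IntegralForms) {o : Type*} [CommRing o] [IsDomain o] [IsDiscreteValuationRing o]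
    [Algebra (NumberField.RingOfIntegers K) o] (x : B.PosFlat) (z : Fin d → o) : NNReal :=
  (Finset.univ.filter fun H : B.hyperplanes => x.1.space ≤ H.1).sup fun H => dvrAbs (L.eval H z)

/-- The analytic zeta function `∫_{o^d} ∏_x ‖B_x‖^{s_x} dX` of `B` over the compact discrete
valuation ring `o`, with respect to the Haar measure on `o ^ d` of total mass `1`. -/
def HyperplaneArrangement.IntegralForms.analyticZeta
    {B : HyperplaneArrangement K (Fin d → K)} (L : B.IntegralForms) (o : Type*) [CommRing o]
    [IsDomain o] [IsDiscreteValuationRing o] [TopologicalSpace o] [IsTopologicalRing o]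
    [CompactSpace o] [Algebra (NumberField.RingOfIntegers K) o] (s : B.PosFlat → ℂ) : ℂ :=
  letI : MeasurableSpace o := borel o
  haveI : BorelSpace o := ⟨rfl⟩
  ∫ z : Fin d → o, ∏ x : B.PosFlat, (((L.maxAbs x z : NNReal) : ℝ) : ℂ) ^ s x
    ∂(Measure.pi fun _ : Fin d => Measure.addHaarMeasure (⊤ : TopologicalSpace.PositiveCompacts o))

/-- `o'` is an unramified extension of degree `f` of the discrete valuation ring `o`. -/
def IsUnramifiedOfDegree (o o' : Type*) [CommRing o] [IsDomain o] [IsDiscreteValuationRing o]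
    [CommRing o'] [IsDomain o'] [IsDiscreteValuationRing o'] [Algebra o o'] (f : ℕ) : Prop :=
  Module.Finite o o' ∧ Module.finrank o o' = f ∧
    (IsLocalRing.maximalIdeal o).map (algebraMap o o') = IsLocalRing.maximalIdeal o'

end Analytic

/-! ### Topological zeta functions -/

/-- For `a` in a field `k` of characteristic zero, the power
`Q ^ a = ∑_j a (a - 1) ⋯ (a - j + 1) / j! * (Q - 1) ^ j`, as a power series in `Q - 1`. -/
def qPow {k : Type*} [Field k] (a : k) : PowerSeries k :=
  PowerSeries.mk fun j => (∏ i ∈ Finset.range j, (a - i)) / (j.factorial : k)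

namespace HyperplaneArrangement

variable {F V : Type*} [Field F] [AddCommGroup V] [Module F V]

/-- The substitution `W(Y, T) ↦ W(-Q⁻¹, Q ^ (-s))` into power series in `Q - 1` over `ℚ(s)`; the
variable `none` stands for `Y` and `some x` for `T_x`. -/
def expand (A : HyperplaneArrangement F V) (W : MvPolynomial (Option A.PosFlat) ℚ) :
    PowerSeries A.RatFun :=
  MvPolynomial.eval₂ (algebraMap ℚ (PowerSeries A.RatFun))
    (fun i => i.elim (-qPow (-1)) fun x => qPow (-A.var x)) W

/-- The value `W(-q⁻¹, q ^ (-s))` for a positive integer `q` and complex numbers `s_x`. -/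
def evalAt (A : HyperplaneArrangement F V) (W : MvPolynomial (Option A.PosFlat) ℚ) (q : ℕ)
    (s : A.PosFlat → ℂ) : ℂ :=
  MvPolynomial.eval₂ (algebraMap ℚ ℂ)
    (fun i => i.elim (-(q : ℂ)⁻¹) fun x => (q : ℂ) ^ (-s x)) W

/-- The bijection on the flats different from the bottom elements given by an isomorphism of
intersection posets. -/
def posMap {F' V' : Type*} [Field F'] [AddCommGroup V'] [Module F' V']
    {A : HyperplaneArrangement F V} {B : HyperplaneArrangement F' V'} (φ : B.Flat ≃o A.Flat)
    (x : B.PosFlat) : A.PosFlat :=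
  ⟨φ x.1, by simpa using x.2⟩

/-- `Z(s)` is the limit, as `f → 0`, of the analytic zeta functions of `B` over the unramified
extensions `o^(f)`, `f ≥ 1`, of `o`, the variables being renamed along `φ`.  That is: there is a
(necessarily unique) rational function `W = P / D` in `Y` and the `T_x` such that the analytic zeta
function over `o^(f)` is `W(-q ^ (-f), q ^ (-f s))` for all `f ≥ 1` (denominators cleared), with `q` the cardinality of the residue field
of `o`, and `Z(s)` is the constant term of the expansion of `W(-Q⁻¹, Q ^ (-s))` as a power series
in `Q - 1`. -/
def IsUnramifiedLimit {K : Type} [Field K] [NumberField K] {d : ℕ}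
    {A : HyperplaneArrangement F V} {B : HyperplaneArrangement K (Fin d → K)}
    (φ : B.Flat ≃o A.Flat) (L : B.IntegralForms) (o : Type) [CommRing o] [IsDomain o]
    [IsDiscreteValuationRing o] [Algebra (NumberField.RingOfIntegers K) o] (Z : A.RatFun) : Prop :=
  ∃ P D : MvPolynomial (Option A.PosFlat) ℚ,
    (∀ (f : ℕ), 1 ≤ f → ∀ (o' : Type) [CommRing o'] [IsDomain o'] [IsDiscreteValuationRing o']
      [TopologicalSpace o'] [IsTopologicalRing o'] [CompactSpace o'] [T2Space o']
      [Algebra (NumberField.RingOfIntegers K) o'] [Algebra o o']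
      [IsScalarTower (NumberField.RingOfIntegers K) o o'],
      IsUnramifiedOfDegree o o' f →
      ∀ s : A.PosFlat → ℂ, (∀ x, 0 < (s x).re) →
        A.evalAt D (Nat.card (IsLocalRing.ResidueField o) ^ f) s *
            L.analyticZeta o' (fun x => s (posMap φ x)) =
          A.evalAt P (Nat.card (IsLocalRing.ResidueField o) ^ f) s) ∧
    A.expand D ≠ 0 ∧
    ∃ z : PowerSeries A.RatFun, z * A.expand D = A.expand P ∧ PowerSeries.constantCoeff z = Z

/-- `Z` is the multivariate topological zeta function of the arrangement `A` over a field of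
characteristic zero: for all representations `B` of `A` over number fields `K`, given by affine
linear polynomials over the ring of integers, and all compact discrete valuation rings `o` over
the ring of integers whose residue characteristic avoids a finite set of primes, `Z` is the limit,
as `f → 0`, of the analytic zeta functions of `B` over the unramified extensions `o^(f)`. -/
def IsTopologicalZeta (A : HyperplaneArrangement F V) (Z : A.RatFun) : Prop :=
  ∀ (K : Type) [Field K] [NumberField K] (d : ℕ) (B : HyperplaneArrangement K (Fin d → K)),
    B.ambient = ⊤ → ∀ (φ : B.Flat ≃o A.Flat) (L : B.IntegralForms),
    ∃ S : Finset ℕ, ∀ (o : Type) [CommRing o] [IsDomain o] [IsDiscreteValuationRing o]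
      [TopologicalSpace o] [IsTopologicalRing o] [CompactSpace o] [T2Space o]
      [Algebra (NumberField.RingOfIntegers K) o],
      ringChar (IsLocalRing.ResidueField o) ∉ S → IsUnramifiedLimit φ L o Z

end HyperplaneArrangement

/-! ### Generic central arrangements -/

/-- `A` is a generic central arrangement `U_{n,m}`: it consists of the hyperplanes `H₁, …, H_m`
through the origin of `F ^ n`, and for each `k ≤ n` the intersection of any `k` of them has
codimension `k`. -/
structure IsGenericCentral {F : Type*} [Field F] {n m : ℕ}
    (A : HyperplaneArrangement F (Fin n → F)) (H : Fin m → AffineSubspace F (Fin n → F)) :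
    Prop where
  ambient_eq : A.ambient = ⊤
  mem_hyperplanes : ∀ X, X ∈ A.hyperplanes ↔ ∃ i, H i = X
  zero_mem : ∀ i, (0 : Fin n → F) ∈ H i
  codim : ∀ I : Finset (Fin m), I.card ≤ n →
    Module.finrank F (I.inf H).direction + I.card = n

/-- The chains of nonempty subsets of `I`. -/
def weakOrderChains {α : Type*} [DecidableEq α] (I : Finset α) : Finset (Finset (Finset α)) :=
  open Classical in
  (I.powerset.erase ∅).powerset.filter fun C => IsChain (· ⊆ ·) (C : Set (Finset α))

/-- The weak order zeta function of the variables `t_J`, for the nonempty subsets `J` of `I`. -/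
def weakOrderZeta {α k : Type*} [DecidableEq α] [Field k] (I : Finset α) (t : Finset α → k) : k :=
  ∑ C ∈ weakOrderChains I, ∏ J ∈ C, t J / (1 - t J)

end

/-! ### Poincaré polynomials of truncated Boolean lattices -/

section

open Finset Polynomial

/-! A flat of a generic central arrangement is determined by the set of hyperplanes through it, and
the sets that occur are those with fewer than `n` elements and the full set: the intersection poset
is the Boolean lattice of `[m]` truncated at rank `n` (`IsGenericCentral.isTruncatedBoolean`).
Intervals of it are truncated Boolean lattices as well, and their Möbius functions are given by
truncated alternating sums of binomial coefficients (`IsTruncatedBoolean.mu_bot_eq`).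

Flag series. Along a chain of proper flats with largest support `I`, the intervals up to `I` are
Boolean and contribute `(1 + Y) ^ |I|` altogether; the last interval contributes `(1 + Y) ∑ binom(m
- |I| - 1, k) Y ^ k`. Adding the top flat to the chain does not change the polynomial, so the two
chains together give the factor `1 / (1 - T)` of the top. Grouping chains by `I` leaves sums over
the chains that contain `I`, and these are `T_I` times the weak order zeta function of `I`
(`sum_weakOrderChains_mem`).

Topological zeta function. Over almost all compact discrete valuation rings any `n` of the chosen
affine forms are independent and uniformly distributed, and they generate the others
(`exists_genericForms`). For a set `U` of forms, split the integral of the product over the subsets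
of `U` according to the set `I` of forms that are not units at the point. Inclusion-exclusion
evaluates the unit conditions, and rescaling by a uniformizer handles the part where all forms of
`U` are nonunits. The result is a recursion over `I ⊂ U` (`GenericForms.integral_maxProd`,
`integral_residueInd_mul_maxProd`) whose coefficients are rational functions of `-q⁻¹` and the `q ^
(-s_x)`.

As `q` tends to `1`, each quotient `(1 - q⁻¹) / (1 - q ^ (-r - ∑ s))` tends to `1 / (r + ∑ s)`, and
the other coefficients become alternating sums of binomial coefficients. For `|U| < n` these vanish
unless `|I| = |U| - 1`, so exactly the complete chains survive (`exists_hasExpansion_of_recursion`).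
For `U = [m]` they are truncated sums, which are the numerators of the claim
(`exists_hasExpansion_top`). -/

/-- The Poincaré polynomial of a generic central arrangement of `M` hyperplanes of rank `r`. -/
noncomputable def genericPoincare (r M : ℕ) : ℤ[X] :=
  if r = 0 then 1 else (1 + X) * ∑ k ∈ range r, ((M - 1).choose k : ℤ[X]) * X ^ k

/-- The left side lists the unsigned Whitney numbers of the truncated lattice: binomial coefficients
below the top, and one coefficient for the top. Raising `r` by one is an application of Pascal's
rule. -/
theorem sum_choose_mul_pow_add (r M : ℕ) (hr : 1 ≤ r) (hM : r ≤ M) :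
    ∑ k ∈ range r, (M.choose k : ℤ[X]) * X ^ k + ((M - 1).choose (r - 1) : ℤ[X]) * X ^ r =
      genericPoincare r M := by
  rw [genericPoincare, if_neg (by omega)]
  obtain ⟨M, rfl⟩ : ∃ N, M = N + 1 := ⟨M - 1, by omega⟩
  clear hM
  induction r, hr using Nat.le_induction with
  | base => simp
  | succ r hr ih =>
    obtain ⟨r, rfl⟩ : ∃ N, r = N + 1 := ⟨r - 1, by omega⟩
    simp only [Nat.add_sub_cancel] at ih ⊢
    rw [sum_range_succ, sum_range_succ _ (r + 1), mul_add, ← ih, Nat.choose_succ_succ]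
    push_cast
    ring

/-- When the rank equals the number of hyperplanes nothing is truncated, which is the Boolean case.
-/
theorem genericPoincare_self (M : ℕ) : genericPoincare M M = (1 + X) ^ M := by
  rw [genericPoincare]
  split_ifs with h
  · simp [h]
  · obtain ⟨M, rfl⟩ : ∃ N, M = N + 1 := ⟨M - 1, by omega⟩
    rw [Nat.add_sub_cancel, pow_succ', add_comm (1 : ℤ[X]) X, add_pow]
    congr 1
    exact sum_congr rfl fun k _ => by simp [mul_comm]

section TruncatedBoolean

variable {ι P : Type*} [PartialOrder P]

/-- The poset `P` is, by means of `σ`, a truncated Boolean lattice: it is the lattice of the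
subsets of `U` that have fewer than `r` elements or are equal to `U`. -/
structure IsTruncatedBoolean (P : Type*) [PartialOrder P] (σ : P → Finset ι) (U : Finset ι)
    (r : ℕ) : Prop where
  le_iff : ∀ x y, x ≤ y ↔ σ x ⊆ σ y
  exists_iff : ∀ K, (∃ x, σ x = K) ↔ K ⊆ U ∧ (K.card < r ∨ K = U)

namespace IsTruncatedBoolean

variable {σ : P → Finset ι} {U : Finset ι} {r : ℕ}

theorem injective (h : IsTruncatedBoolean P σ U r) : Function.Injective σ := fun x y hxy =>
  le_antisymm ((h.le_iff x y).2 hxy.le) ((h.le_iff y x).2 hxy.ge)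

theorem subset (h : IsTruncatedBoolean P σ U r) (x : P) : σ x ⊆ U := ((h.exists_iff _).1 ⟨x, rfl⟩).1

theorem card_lt_or (h : IsTruncatedBoolean P σ U r) (x : P) : (σ x).card < r ∨ σ x = U :=
  ((h.exists_iff _).1 ⟨x, rfl⟩).2

theorem lt_iff (h : IsTruncatedBoolean P σ U r) (x y : P) : x < y ↔ σ x ⊂ σ y := by
  rw [lt_iff_le_not_ge, h.le_iff, h.le_iff, Finset.ssubset_def]

/-- For `r = 0` the poset is the single point `U`, hence the side condition. -/
theorem map_bot [OrderBot P] (h : IsTruncatedBoolean P σ U r) (hr : r = 0 → U = ∅) :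
    σ ⊥ = ∅ := by
  obtain ⟨x, hx⟩ := (h.exists_iff ∅).2 ⟨empty_subset _, by
    rcases Nat.eq_zero_or_pos r with h0 | h0
    · exact Or.inr (hr h0).symm
    · exact Or.inl (by simpa using h0)⟩
  have := (h.le_iff ⊥ x).1 bot_le
  rw [hx] at this
  exact subset_empty.1 this

theorem sum_eq [DecidableEq ι] [Fintype P] {M : Type*} [AddCommMonoid M]
    (h : IsTruncatedBoolean P σ U r)
    (f : Finset ι → M) :
    ∑ x, f (σ x) = ∑ K ∈ U.powerset.filter (fun K => K.card < r ∨ K = U), f K := by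
  refine sum_bij (fun x _ => σ x) ?_ (fun x _ y _ hxy => h.injective hxy) ?_ (fun _ _ => rfl)
  · intro x _
    rw [mem_filter, mem_powerset]
    exact ⟨h.subset x, h.card_lt_or x⟩
  · intro K hK
    rw [mem_filter, mem_powerset] at hK
    obtain ⟨x, hx⟩ := (h.exists_iff K).2 hK
    exact ⟨x, mem_univ _, hx⟩

/-- Sums over truncated Boolean lattices, by cardinality. -/
theorem sum_filter_eq [DecidableEq ι] {M : Type*} [AddCommMonoid M] (hr : r ≤ U.card)
    (f : Finset ι → M) :
    ∑ K ∈ U.powerset.filter (fun K => K.card < r ∨ K = U), f K =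
      ∑ k ∈ range r, ∑ K ∈ U.powersetCard k, f K + f U := by
  rw [filter_or, sum_union]
  · congr 1
    · rw [← sum_fiberwise_of_maps_to (s := U.powerset.filter fun K => K.card < r)
        (t := range r) (g := Finset.card)]
      · refine sum_congr rfl fun k hk => sum_congr ?_ fun _ _ => rfl
        ext K
        simp only [mem_filter, mem_powerset, mem_powersetCard, mem_range] at hk ⊢
        constructor
        · rintro ⟨⟨h1, h2⟩, h3⟩
          exact ⟨h1, h3⟩
        · rintro ⟨h1, rfl⟩
          exact ⟨⟨h1, hk⟩, rfl⟩
      · intro K hK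
        simpa using (mem_filter.1 hK).2
    · rw [filter_eq' U.powerset U, if_pos (by simp), sum_singleton]
  · rw [disjoint_filter]
    rintro K - hK rfl
    omega

/-- Strictly below any element the supports have fewer than `r` elements, so cardinality counts the
steps until the truncation caps it at `r`; removing elements one at a time attains the bound. -/
theorem height_eq (h : IsTruncatedBoolean P σ U r) (x : P) :
    Order.height x = ((min (σ x).card r : ℕ) : ℕ∞) := by
  have key : ∀ k, ∀ x : P, min (σ x).card r = k → Order.height x = (k : ℕ∞) := by
    intro k
    induction k using Nat.strong_induction_on with
    | _ k ih =>
    intro x hx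
    have hlt : ∀ y < x, min (σ y).card r < k := by
      intro y hy
      have h1 := (h.lt_iff y x).1 hy
      have h2 := card_lt_card h1
      rcases h.card_lt_or y with h3 | h3
      · omega
      · exact absurd (h3 ▸ h1) (not_ssubset_of_subset (h.subset x))
    apply le_antisymm
    · rw [Order.height_le_coe_iff]
      intro y hy
      rw [ih _ (hlt y hy) y rfl]
      exact_mod_cast hlt y hy
    · rcases k with _ | k
      · simp
      · have hk : k ≤ (σ x).card := by omega
        obtain ⟨K, hK, hKc⟩ := exists_subset_card_eq hk
        obtain ⟨y, hy⟩ := (h.exists_iff K).2 ⟨hK.trans (h.subset x), Or.inl (by omega)⟩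
        have hyx : y < x := by
          rw [h.lt_iff, hy]
          refine ssubset_of_subset_of_ne hK ?_
          rintro rfl
          omega
        have := Order.height_add_one_le hyx
        rw [ih k (Nat.lt_succ_self k) y (by rw [hy, hKc]; omega)] at this
        exact_mod_cast this
  exact key _ x rfl

theorem sum_powersetCard_neg_one_pow (U : Finset ι) (r : ℕ) (hr : 1 ≤ r) (hrU : r ≤ U.card) :
    ∑ k ∈ range r, ∑ K ∈ U.powersetCard k, (-1 : ℤ) ^ K.card =
      -((-1) ^ r * ((U.card - 1).choose (r - 1) : ℤ)) := by
  have : ∑ k ∈ range r, ∑ K ∈ U.powersetCard k, (-1 : ℤ) ^ K.card =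
      ∑ k ∈ range r, (-1 : ℤ) ^ k * (U.card.choose k : ℤ) := by
    refine sum_congr rfl fun k _ => ?_
    rw [sum_congr rfl fun K hK => by rw [(mem_powersetCard.1 hK).2], sum_const, card_powersetCard,
      nsmul_eq_mul, mul_comm]
  rw [this]
  obtain ⟨r, rfl⟩ : ∃ N, r = N + 1 := ⟨r - 1, by omega⟩
  obtain ⟨M, hM⟩ : ∃ N, U.card = N + 1 := ⟨U.card - 1, by omega⟩
  rw [hM, Int.alternating_sum_range_choose_eq_choose]
  simp [pow_succ]

/-- The claimed values sum to zero over every interval from the bottom to a larger element, and this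
determines the Möbius function. Below the truncation this is the alternating sum over a power set;
the top value is minus the truncated alternating sum of binomial coefficients. -/
theorem mu_bot_eq [DecidableEq ι] [OrderBot P] [LocallyFiniteOrder P] [DecidableEq P]
    [Fintype P]
    (h : IsTruncatedBoolean P σ U r) (hr : 1 ≤ r) (hrU : r ≤ U.card) (x : P) :
    IncidenceAlgebra.mu ℤ (⊥ : P) x = if (σ x).card < r then (-1) ^ (σ x).card else
      (-1) ^ r * ((U.card - 1).choose (r - 1) : ℤ) := by
  set f : Finset ι → ℤ := fun K => if K.card < r then (-1) ^ K.card else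
      (-1) ^ r * ((U.card - 1).choose (r - 1) : ℤ) with hf
  have hsum : ∀ x : P, x ≠ ⊥ → ∑ y ∈ Icc ⊥ x, f (σ y) = 0 := by
    intro x hx
    have hx0 : σ x ≠ ∅ := fun h0 => hx (h.injective (h0.trans (h.map_bot (by omega)).symm))
    have e : ∑ y ∈ Icc ⊥ x, f (σ y) =
        ∑ K ∈ (σ x).powerset.filter (fun K => K.card < r ∨ K = U), f K := by
      refine sum_bij (fun x _ => σ x) ?_ (fun x _ y _ hxy => h.injective hxy) ?_ (fun _ _ => rfl)
      · intro y hy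
        rw [mem_filter, mem_powerset]
        exact ⟨(h.le_iff _ _).1 (mem_Icc.1 hy).2, h.card_lt_or y⟩
      · intro K hK
        rw [mem_filter, mem_powerset] at hK
        obtain ⟨y, hy⟩ := (h.exists_iff K).2 ⟨hK.1.trans (h.subset x), hK.2⟩
        exact ⟨y, mem_Icc.2 ⟨bot_le, (h.le_iff _ _).2 (hy ▸ hK.1)⟩, hy⟩
    rw [e]
    by_cases hc : (σ x).card < r
    · rw [filter_true_of_mem]
      · rw [sum_congr rfl (g := fun K => (-1 : ℤ) ^ K.card), sum_powerset_neg_one_pow_card, if_neg hx0]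
        intro K hK
        have := card_le_card (mem_powerset.1 hK)
        simp only [hf]
        rw [if_pos (by omega)]
      · intro K hK
        have := card_le_card (mem_powerset.1 hK)
        exact Or.inl (by omega)
    · have hU : σ x = U := (h.card_lt_or x).resolve_left hc
      rw [hU, sum_filter_eq hrU]
      have : ∑ k ∈ range r, ∑ K ∈ U.powersetCard k, f K =
          ∑ k ∈ range r, ∑ K ∈ U.powersetCard k, (-1 : ℤ) ^ K.card := by
        refine sum_congr rfl fun k hk => sum_congr rfl fun K hK => ?_
        simp only [hf]
        rw [if_pos]
        rw [(mem_powersetCard.1 hK).2]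
        exact mem_range.1 hk
      rw [this, sum_powersetCard_neg_one_pow U r hr hrU]
      simp only [hf]
      rw [if_neg (by omega)]
      ring
  have hmain : ∀ k, ∀ x : P, (σ x).card = k → IncidenceAlgebra.mu ℤ (⊥ : P) x = f (σ x) := by
    intro k
    induction k using Nat.strong_induction_on with
    | _ k ih =>
    intro x hx
    by_cases hb : x = ⊥
    · subst hb
      rw [IncidenceAlgebra.mu_self, hf, h.map_bot (by omega)]
      simp only [card_empty, pow_zero]
      rw [if_pos (by omega)]
    · have h1 := hsum x hb
      rw [IncidenceAlgebra.mu_eq_neg_sum_Ico_of_ne (Ne.symm hb)]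
      rw [← Ico_insert_right bot_le, sum_insert (by simp)] at h1
      rw [sum_congr rfl fun y hy => ih _ (hx ▸ card_lt_card ((h.lt_iff y x).1 (mem_Ico.1 hy).2)) y rfl]
      linarith
  exact hmain _ x rfl

/-- The signs of the Möbius function cancel those of `(-X) ^ height`, so that only the unsigned
Whitney numbers remain. -/
theorem sum_mu_mul_pow_height [DecidableEq ι] [OrderBot P] [LocallyFiniteOrder P] [DecidableEq P]
    [Fintype P]
    (h : IsTruncatedBoolean P σ U r) (hr : r = 0 → U = ∅) (hrU : r ≤ U.card) :
    ∑ x : P, C (IncidenceAlgebra.mu ℤ (⊥ : P) x) * (-X : ℤ[X]) ^ (Order.height x).toNat =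
      genericPoincare r U.card := by
  rcases Nat.eq_zero_or_pos r with h0 | h0
  · have hall : ∀ x : P, x = ⊥ := fun x => h.injective <| by
      rw [h.map_bot hr, ← subset_empty, ← hr h0]
      exact h.subset x
    rw [Fintype.sum_eq_single ⊥ fun x hx => absurd (hall x) hx]
    simp [genericPoincare, h0]
  · rw [← sum_choose_mul_pow_add r _ h0 hrU]
    have : ∀ x : P, C (IncidenceAlgebra.mu ℤ (⊥ : P) x) * (-X : ℤ[X]) ^ (Order.height x).toNat =
        (fun K : Finset ι => C (if K.card < r then (-1) ^ K.card else
      (-1) ^ r * ((U.card - 1).choose (r - 1) : ℤ)) * (-X : ℤ[X]) ^ (min K.card r)) (σ x) := by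
      intro x
      rw [h.mu_bot_eq h0 hrU, h.height_eq, ENat.toNat_natCast]
    rw [sum_congr rfl fun x _ => this x, h.sum_eq (fun K : Finset ι => C (if K.card < r then (-1) ^ K.card else
      (-1) ^ r * ((U.card - 1).choose (r - 1) : ℤ)) * (-X : ℤ[X]) ^ (min K.card r)),
      sum_filter_eq hrU]
    congr 1
    · refine sum_congr rfl fun k hk => ?_
      have hk := mem_range.1 hk
      rw [sum_congr rfl (g := fun _ => (X : ℤ[X]) ^ k), sum_const, card_powersetCard, nsmul_eq_mul]
      intro K hK
      rw [(mem_powersetCard.1 hK).2, if_pos hk, min_eq_left hk.le, map_pow, ← mul_pow]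
      simp
    · rw [if_neg (by omega), min_eq_right hrU, map_mul, map_pow, mul_right_comm, ← mul_pow]
      simp [mul_comm]

end IsTruncatedBoolean

end TruncatedBoolean

end

/-! ### Flats and intervals of a generic central arrangement -/

section

open Finset Polynomial

namespace HyperplaneArrangement

variable {F V : Type*} [Field F] [AddCommGroup V] [Module F V]

theorem Flat.space_injective (A : HyperplaneArrangement F V) :
    Function.Injective (Flat.space : A.Flat → AffineSubspace F V) := fun _ _ h =>
  Subtype.ext (congrArg OrderDual.toDual h)

theorem Flat.le_iff {A : HyperplaneArrangement F V} (x y : A.Flat) :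
    x ≤ y ↔ y.space ≤ x.space := Iff.rfl

theorem Flat.space_bot (A : HyperplaneArrangement F V) : (⊥ : A.Flat).space = A.ambient := rfl

open Classical in
/-- The set of the indices of the hyperplanes that contain an affine subspace. -/
noncomputable def support {ι : Type*} [Fintype ι] (H : ι → AffineSubspace F V)
    (S : AffineSubspace F V) : Finset ι := univ.filter fun i => S ≤ H i

section Support

variable {ι : Type*} [Fintype ι] {H : ι → AffineSubspace F V} {S T : AffineSubspace F V}

theorem mem_support {i : ι} : i ∈ support H S ↔ S ≤ H i := by simp [support]

theorem subset_support_iff {I : Finset ι} : I ⊆ support H S ↔ S ≤ I.inf H := by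
  simp [subset_iff, mem_support, Finset.le_inf_iff]

theorem support_antitone (h : S ≤ T) : support H T ⊆ support H S := fun _ hi =>
  mem_support.2 (h.trans (mem_support.1 hi))

theorem support_bot : support H (⊥ : AffineSubspace F V) = univ := by simp [support]

end Support

end HyperplaneArrangement

open HyperplaneArrangement

namespace IsGenericCentral

variable {F : Type*} [Field F] {n m : ℕ} {A : HyperplaneArrangement F (Fin n → F)}
  {H : Fin m → AffineSubspace F (Fin n → F)}

theorem zero_mem_inf (hA : IsGenericCentral A H) (I : Finset (Fin m)) :
    (0 : Fin n → F) ∈ I.inf H := by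
  have : AffineSubspace.mk' (0 : Fin n → F) (⊥ : Submodule F (Fin n → F)) ≤ I.inf H := by
    refine Finset.le_inf fun i _ x hx => ?_
    have : x = 0 := by simpa using hx
    exact this ▸ hA.zero_mem i
  exact this (AffineSubspace.self_mem_mk' _ _)

/-- A further hyperplane through the intersection would not lower its dimension, although the
codimension of `|I| + 1 ≤ n` hyperplanes has to be `|I| + 1`. -/
theorem support_inf_of_lt (hA : IsGenericCentral A H) {I : Finset (Fin m)} (hI : I.card < n) :
    support H (I.inf H) = I := by
  classical
  ext i
  rw [mem_support]
  refine ⟨fun h => ?_, fun h => Finset.inf_le h⟩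
  by_contra hi
  have h1 := hA.codim I hI.le
  have h2 := hA.codim (insert i I) (by rw [card_insert_of_notMem hi]; omega)
  rw [card_insert_of_notMem hi, inf_insert, inf_eq_right.2 h] at h2
  omega

/-- Any `n` of the hyperplanes already meet in the origin alone. -/
theorem support_inf_of_le (hA : IsGenericCentral A H) {I : Finset (Fin m)} (hI : n ≤ I.card) :
    support H (I.inf H) = univ := by
  obtain ⟨J, hJ, hJn⟩ := exists_subset_card_eq hI
  have h1 := hA.codim J hJn.le
  have h2 : (J.inf H).direction = ⊥ := Submodule.finrank_eq_zero.1 (by omega)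
  refine eq_univ_of_forall fun i => mem_support.2 ((Finset.inf_mono hJ).trans fun x hx => ?_)
  have h3 := AffineSubspace.vsub_mem_direction hx (hA.zero_mem_inf J)
  rw [h2, Submodule.mem_bot] at h3
  have h4 : x = 0 := by simpa using h3
  exact h4 ▸ hA.zero_mem i

theorem support_inf (hA : IsGenericCentral A H) (I : Finset (Fin m)) :
    support H (I.inf H) = if I.card < n then I else univ := by
  split_ifs with h
  · exact hA.support_inf_of_lt h
  · exact hA.support_inf_of_le (not_lt.1 h)

/-- The intersection of a set of hyperplanes of a generic central arrangement. -/
noncomputable def flat (hA : IsGenericCentral A H) (I : Finset (Fin m)) : A.Flat :=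
  ⟨OrderDual.toDual (I.inf H), ⟨0, hA.zero_mem_inf I⟩, by
    classical
    refine ⟨I.image H, fun X hX => ?_, ?_⟩
    · obtain ⟨i, -, rfl⟩ := mem_image.1 hX
      exact (hA.mem_hyperplanes _).2 ⟨i, rfl⟩
    · rw [hA.ambient_eq, top_inf_eq, inf_image]
      rfl⟩

theorem flat_space (hA : IsGenericCentral A H) (I : Finset (Fin m)) :
    (hA.flat I).space = I.inf H := rfl

theorem space_eq_inf (hA : IsGenericCentral A H) (x : A.Flat) :
    x.space = (support H x.space).inf H := by
  classical
  apply le_antisymm (subset_support_iff.1 subset_rfl)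
  obtain ⟨B, hB, h⟩ := x.2.2
  replace h : A.ambient ⊓ B.inf id = x.space := h
  refine le_trans ?_ h.le
  rw [hA.ambient_eq, top_inf_eq]
  refine Finset.le_inf fun X hX => ?_
  obtain ⟨i, rfl⟩ := (hA.mem_hyperplanes X).1 (hB hX)
  refine Finset.inf_le (mem_support.2 ?_)
  rw [← h]
  exact inf_le_right.trans (Finset.inf_le hX)

theorem isTruncatedBoolean (hA : IsGenericCentral A H) :
    IsTruncatedBoolean A.Flat (fun x => support H x.space) univ n where
  le_iff x y := by
    rw [Flat.le_iff, subset_support_iff, ← hA.space_eq_inf]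
  exists_iff K := by
    constructor
    · rintro ⟨x, rfl⟩
      refine ⟨subset_univ _, ?_⟩
      have := hA.support_inf (support H x.space)
      rw [← hA.space_eq_inf] at this
      split_ifs at this with h
      · exact Or.inl h
      · exact Or.inr this
    · rintro ⟨-, hK⟩
      refine ⟨hA.flat K, ?_⟩
      rw [hA.flat_space, hA.support_inf]
      split_ifs with h
      · rfl
      · exact (hK.resolve_left h).symm

/-- The flats of the arrangement that corresponds to an interval of the intersection poset. -/
theorem isTruncatedBoolean_restrict_sub (hA : IsGenericCentral A H) (x : A.Flat)
    (y : AffineSubspace F (Fin n → F)) (hy : (support H y).card < n ∨ support H y = univ)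
    (hxy : y ≤ x.space) :
    IsTruncatedBoolean ((A.restrict x).sub y).Flat
      (fun z => support H z.space \ support H x.space) (support H y \ support H x.space)
      (min (support H y).card n - (support H x.space).card) := by
  classical
  set E := (A.restrict x).sub y with hE
  have hyp : ∀ X, X ∈ E.hyperplanes ↔ ∃ i ∈ support H y \ support H x.space, x.space ⊓ H i = X := by
    intro X
    simp only [hE, HyperplaneArrangement.sub, HyperplaneArrangement.restrict, mem_filter, mem_image,
      mem_sdiff, mem_support]
    constructor
    · rintro ⟨⟨Y, ⟨hYA, hY1, -⟩, rfl⟩, h2⟩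
      obtain ⟨i, rfl⟩ := (hA.mem_hyperplanes _).1 hYA
      exact ⟨i, ⟨h2.trans inf_le_right, hY1⟩, rfl⟩
    · rintro ⟨i, ⟨h1, h2⟩, rfl⟩
      refine ⟨⟨H i, ⟨(hA.mem_hyperplanes _).2 ⟨i, rfl⟩, h2, 0, ?_⟩, rfl⟩, le_inf hxy h1⟩
      have h3 := hA.zero_mem_inf (support H x.space)
      rw [← hA.space_eq_inf] at h3
      exact ⟨h3, hA.zero_mem i⟩
  have hle : ∀ z : E.Flat, z.space ≤ x.space := by
    rintro ⟨z, -, B, -, h⟩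
    change OrderDual.ofDual z ≤ _
    rw [← h]
    exact inf_le_left
  -- Distinct hyperplanes may have the same trace on `x`, so a flat of the interval is described by
  -- all indices whose trace is used, together with those of `x`.
  have hspace : ∀ z : E.Flat, ∃ I ⊆ support H y, support H x.space ⊆ I ∧ z.space = I.inf H := by
    rintro ⟨z, -, B, hB, h⟩
    refine ⟨support H x.space ∪ (support H y).filter (fun i => x.space ⊓ H i ∈ B), ?_, ?_, ?_⟩
    · exact union_subset (support_antitone hxy) (filter_subset _ _)
    · exact subset_union_left
    · rw [inf_union, ← hA.space_eq_inf]
      change OrderDual.ofDual z = _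
      rw [← h]
      change x.space ⊓ _ = _
      apply le_antisymm
      · refine le_inf inf_le_left (Finset.le_inf fun i hi => ?_)
        exact inf_le_right.trans ((Finset.inf_le (mem_filter.1 hi).2).trans inf_le_right)
      · refine le_inf inf_le_left (Finset.le_inf fun X hX => ?_)
        obtain ⟨i, hi, rfl⟩ := (hyp X).1 (hB hX)
        refine le_inf inf_le_left (inf_le_right.trans ?_)
        exact Finset.inf_le (mem_filter.2 ⟨(mem_sdiff.1 hi).1, hX⟩)
  have hinf : ∀ z : E.Flat, z.space = (support H z.space).inf H := by
    intro z
    obtain ⟨I, -, -, hI⟩ := hspace z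
    exact le_antisymm (subset_support_iff.1 subset_rfl)
      (hI ▸ Finset.inf_mono (subset_support_iff.2 le_rfl))
  constructor
  · intro z w
    have hz := support_antitone (H := H) (hle z)
    have hw := support_antitone (H := H) (hle w)
    rw [Flat.le_iff, hinf z, ← subset_support_iff, ← hinf z]
    refine ⟨fun h => sdiff_subset_sdiff h subset_rfl, fun h i hi => ?_⟩
    by_cases hix : i ∈ support H x.space
    · exact hw hix
    · exact (mem_sdiff.1 (h (mem_sdiff.2 ⟨hi, hix⟩))).1
  · intro K
    constructor
    · rintro ⟨z, rfl⟩
      obtain ⟨I, hIy, hxI, hI⟩ := hspace z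
      simp only [hI, hA.support_inf]
      split_ifs with h
      · refine ⟨sdiff_subset_sdiff hIy subset_rfl, ?_⟩
        rw [card_sdiff_of_subset hxI]
        have := card_le_card hIy
        have := card_le_card hxI
        by_cases hc : I = support H y
        · exact Or.inr (by rw [hc])
        · have := card_lt_card (ssubset_of_subset_of_ne hIy hc)
          exact Or.inl (by omega)
      · have := card_le_card hIy
        rw [hy.resolve_left (by omega)]
        exact ⟨subset_rfl, Or.inr rfl⟩
    · rintro ⟨hK, hK2⟩
      have hKx : Disjoint K (support H x.space) := disjoint_of_subset_left hK sdiff_disjoint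
      have hsp : x.space ⊓ K.inf H = (support H x.space ∪ K).inf H := by
        rw [inf_union, ← hA.space_eq_inf]
      refine ⟨⟨OrderDual.toDual (x.space ⊓ K.inf H), ⟨0, ?_⟩, K.image (x.space ⊓ H ·), ?_, ?_⟩, ?_⟩
      · change (0 : Fin n → F) ∈ x.space ⊓ K.inf H
        rw [hsp]
        exact hA.zero_mem_inf _
      · intro X hX
        obtain ⟨i, hi, rfl⟩ := mem_image.1 hX
        exact (hyp _).2 ⟨i, hK hi, rfl⟩
      · change x.space ⊓ _ = x.space ⊓ _
        rw [inf_image]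
        apply le_antisymm
        · refine le_inf inf_le_left (Finset.le_inf fun i hi => ?_)
          exact inf_le_right.trans ((Finset.inf_le hi).trans inf_le_right)
        · refine le_inf inf_le_left (Finset.le_inf fun i hi => ?_)
          exact le_inf inf_le_left (inf_le_right.trans (Finset.inf_le hi))
      · change support H (x.space ⊓ K.inf H) \ support H x.space = K
        rw [hsp, hA.support_inf]
        have hc := card_union_of_disjoint hKx.symm
        split_ifs with h
        · rw [union_sdiff_left, sdiff_eq_self_of_disjoint hKx]
        · rcases hK2 with h2 | h2
          · omega
          · rw [h2]
            have h3 : support H x.space ∪ K = support H y := by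
              rw [h2, union_sdiff_of_subset (support_antitone hxy)]
            rw [h3] at h
            rw [hy.resolve_left h]

theorem poincare_restrict_sub (hA : IsGenericCentral A H) (hnm : n ≤ m) (x : A.Flat)
    (y : AffineSubspace F (Fin n → F)) (hy : (support H y).card < n ∨ support H y = univ)
    (hxy : y ≤ x.space) :
    ((A.restrict x).sub y).poincare = genericPoincare
      (min (support H y).card n - (support H x.space).card)
      ((support H y).card - (support H x.space).card) := by
  classical
  have h := hA.isTruncatedBoolean_restrict_sub x y hy hxy
  have hs := support_antitone (H := H) hxy
  have hc := card_sdiff_of_subset hs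
  rw [poincare, h.sum_mu_mul_pow_height, hc]
  -- Rank zero means that `x` and `y` have the same support, or that `x` already lies in all
  -- hyperplanes; no index is left in either case.
  · intro h0
    rcases hy with h1 | h1
    · rw [← card_eq_zero, hc]
      omega
    · have h2 := hA.support_inf (support H x.space)
      rw [← hA.space_eq_inf] at h2
      split_ifs at h2 with h3
      · rw [h1, card_univ, Fintype.card_fin] at h0
        omega
      · rw [h2, sdiff_eq_empty_iff_subset]
        exact subset_univ _
  · rw [hc]
    omega

end IsGenericCentral

end

/-! ### Poincaré polynomials of flags -/

section

open Finset Polynomial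

theorem IsChain.exists_isGreatest {α : Type*} [PartialOrder α] {s : Finset α}
    (hs : IsChain (· ≤ ·) (s : Set α)) (hne : s.Nonempty) : ∃ a ∈ s, ∀ b ∈ s, b ≤ a := by
  obtain ⟨a, ha, hmax⟩ := s.exists_maximal hne
  refine ⟨a, ha, fun b hb => ?_⟩
  rcases hs.total hb ha with h | h
  · exact h
  · exact hmax hb h

namespace HyperplaneArrangement

variable {F V : Type*} [Field F] [AddCommGroup V] [Module F V] {A : HyperplaneArrangement F V}

theorem flagNext_eq_bot {Φ : Finset A.PosFlat} {x : A.Flat} (h : ∀ y ∈ Φ, ¬ x < y.1) :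
    flagNext Φ x = ⊥ := by
  rw [flagNext, eq_bot_iff]
  exact iSup₂_le fun y hy => iSup_le fun hxy => absurd hxy (h y hy)

open Classical in
theorem flagNext_insert_of_lt {Φ : Finset A.PosFlat} {x : A.Flat} {y : A.PosFlat} (hxy : x < y.1) :
    flagNext (insert y Φ) x = y.1.space ⊔ flagNext Φ x := by
  rw [flagNext, Finset.iSup_insert, iSup_pos hxy, flagNext]

theorem space_le_flagNext {Φ : Finset A.PosFlat} {x : A.Flat} {y : A.PosFlat} (hy : y ∈ Φ)
    (hxy : x < y.1) : y.1.space ≤ flagNext Φ x :=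
  le_iSup₂_of_le y hy (le_iSup_of_le hxy le_rfl)

open Classical in
/-- The flats of a flag, with the bottom element added. -/
noncomputable def flagFlats (Φ : Finset A.PosFlat) : Finset A.Flat :=
  insert ⊥ (Φ.image Subtype.val)

theorem mem_flagFlats {Φ : Finset A.PosFlat} {x : A.Flat} :
    x ∈ flagFlats Φ ↔ x = ⊥ ∨ ∃ y ∈ Φ, y.1 = x := by simp [flagFlats]

open Classical in
theorem flagFlats_insert (Φ : Finset A.PosFlat) (y : A.PosFlat) :
    flagFlats (insert y Φ) = insert y.1 (flagFlats Φ) := by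
  rw [flagFlats, image_insert, Finset.insert_comm, flagFlats]

theorem flagPoincare_eq (Φ : Finset A.PosFlat) :
    flagPoincare Φ = ∏ x ∈ flagFlats Φ, ((A.restrict x).sub (flagNext Φ x)).poincare := rfl

open Classical in
-- Below `M` the successor space already contains that of `M`, hence that of `y`, and the supremum
-- does not change. Only `M` gets a new successor, `y` in place of the empty space.
theorem prod_flagFlats_insert {Φ : Finset A.PosFlat} {y : A.PosFlat} (hy : ∀ z ∈ Φ, z < y)
    {M : A.Flat} (hM : M ∈ flagFlats Φ) (hmax : ∀ x ∈ flagFlats Φ, x ≤ M) :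
    ∏ x ∈ flagFlats Φ, ((A.restrict x).sub (flagNext (insert y Φ) x)).poincare =
      (∏ x ∈ (flagFlats Φ).erase M, ((A.restrict x).sub (flagNext Φ x)).poincare) *
        ((A.restrict M).sub y.1.space).poincare := by
  have hlt : ∀ x ∈ flagFlats Φ, x < y.1 := by
    intro x hx
    rcases mem_flagFlats.1 hx with rfl | ⟨z, hz, rfl⟩
    · exact bot_lt_iff_ne_bot.2 y.2
    · exact hy z hz
  rw [← prod_erase_mul _ _ hM]
  congr 1
  · refine prod_congr rfl fun x hx => ?_
    obtain ⟨hxM, hxΦ⟩ := mem_erase.1 hx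
    have hxM' : x < M := lt_of_le_of_ne (hmax x hxΦ) hxM
    have hMΦ : ∃ z ∈ Φ, z.1 = M := (mem_flagFlats.1 hM).resolve_left fun h =>
      not_lt_bot (h ▸ hxM')
    obtain ⟨z, hz, rfl⟩ := hMΦ
    rw [flagNext_insert_of_lt (hlt x hxΦ), sup_eq_right.2]
    exact le_trans ((Flat.le_iff z.1 y.1).1 (hy z hz).le) (space_le_flagNext hz hxM')
  · rw [flagNext_insert_of_lt (hlt M hM), flagNext_eq_bot, sup_bot_eq]
    intro z hz h
    exact absurd (hmax z.1 (mem_flagFlats.2 (Or.inr ⟨z, hz, rfl⟩))) (not_le_of_gt h)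

theorem exists_isGreatest_flagFlats {Φ : Finset A.PosFlat}
    (h : IsChain (· ≤ ·) (Φ : Set A.PosFlat)) :
    ∃ M ∈ flagFlats Φ, ∀ x ∈ flagFlats Φ, x ≤ M := by
  rcases Φ.eq_empty_or_nonempty with rfl | hne
  · exact ⟨⊥, by simp [flagFlats], by simp [flagFlats]⟩
  · obtain ⟨y, hy, hmax⟩ := h.exists_isGreatest hne
    refine ⟨y.1, mem_flagFlats.2 (Or.inr ⟨y, hy, rfl⟩), fun x hx => ?_⟩
    rcases mem_flagFlats.1 hx with rfl | ⟨z, hz, rfl⟩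
    · exact bot_le
    · exact hmax z hz

end HyperplaneArrangement

open HyperplaneArrangement

namespace IsGenericCentral

variable {F : Type*} [Field F] {n m : ℕ} {A : HyperplaneArrangement F (Fin n → F)}
  {H : Fin m → AffineSubspace F (Fin n → F)}

theorem support_bot_flat (hA : IsGenericCentral A H) (hn : 1 ≤ n) :
    support H (⊥ : A.Flat).space = ∅ :=
  hA.isTruncatedBoolean.map_bot (by omega)

open Classical in
-- Intervals between proper flats are Boolean, so the exponents are differences of consecutive
-- cardinalities and telescope. The induction removes the largest element of the flag.
theorem prod_erase_flagFlats (hA : IsGenericCentral A H) (hn : 1 ≤ n) (hnm : n ≤ m)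
    {Φ : Finset A.PosFlat} (hΦ : IsChain (· ≤ ·) (Φ : Set A.PosFlat))
    (hlt : ∀ y ∈ Φ, (support H y.1.space).card < n)
    {M : A.Flat} (hM : M ∈ flagFlats Φ) (hmax : ∀ x ∈ flagFlats Φ, x ≤ M) :
    ∏ x ∈ (flagFlats Φ).erase M, ((A.restrict x).sub (flagNext Φ x)).poincare =
      (1 + X) ^ (support H M.space).card := by
  induction hk : Φ.card generalizing Φ M with
  | zero =>
    obtain rfl := card_eq_zero.1 hk
    have : M = ⊥ := by simpa [flagFlats] using hM
    subst this
    simp [flagFlats, hA.support_bot_flat hn]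
  | succ k ih =>
    obtain ⟨y, hy, hymax⟩ := hΦ.exists_isGreatest (card_pos.1 (by omega))
    obtain rfl : M = y.1 := by
      apply le_antisymm
      · rcases mem_flagFlats.1 hM with rfl | ⟨z, hz, rfl⟩
        · exact bot_le
        · exact hymax z hz
      · exact hmax _ (mem_flagFlats.2 (Or.inr ⟨y, hy, rfl⟩))
    have hΨ : IsChain (· ≤ ·) ((Φ.erase y : Finset A.PosFlat) : Set A.PosFlat) :=
      hΦ.mono (by exact_mod_cast erase_subset _ _)
    obtain ⟨N, hN, hNmax⟩ := exists_isGreatest_flagFlats hΨ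
    have hyN : ∀ z ∈ Φ.erase y, z < y := fun z hz =>
      lt_of_le_of_ne (hymax z (mem_of_mem_erase hz)) (ne_of_mem_erase hz)
    have hNy : N < y.1 := by
      rcases mem_flagFlats.1 hN with rfl | ⟨z, hz, rfl⟩
      · exact bot_lt_iff_ne_bot.2 y.2
      · exact hyN z hz
    have h1 := ih hΨ (fun z hz => hlt z (mem_of_mem_erase hz)) hN hNmax
      (by rw [card_erase_of_mem hy, hk]; omega)
    have h2 := prod_flagFlats_insert hyN hN hNmax
    rw [insert_erase hy] at h2
    have h3 : (flagFlats Φ).erase y.1 = flagFlats (Φ.erase y) := by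
      rw [← insert_erase hy, flagFlats_insert, insert_erase hy, erase_insert]
      intro h
      exact absurd (hNmax _ h) (not_le_of_gt hNy)
    rw [h3, h2, h1, hA.poincare_restrict_sub hnm N y.1.space (Or.inl (hlt y hy))
      ((Flat.le_iff _ _).1 hNy.le), min_eq_left (hlt y hy).le, genericPoincare_self, ← pow_add]
    congr 1
    have := card_le_card (support_antitone (H := H) ((Flat.le_iff _ _).1 hNy.le))
    omega

theorem poincare_restrict_sub_of_univ (hA : IsGenericCentral A H) (hnm : n ≤ m) (x : A.Flat)
    {y : AffineSubspace F (Fin n → F)} (hy : support H y = univ) (hxy : y ≤ x.space) :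
    ((A.restrict x).sub y).poincare = genericPoincare (n - (support H x.space).card)
      (m - (support H x.space).card) := by
  rw [hA.poincare_restrict_sub hnm x y (Or.inr hy) hxy, hy, card_univ, Fintype.card_fin,
    min_eq_right hnm]

open Classical in
theorem flagPoincare_eq (hA : IsGenericCentral A H) (hn : 1 ≤ n) (hnm : n ≤ m)
    {Φ : Finset A.PosFlat} (hΦ : IsChain (· ≤ ·) (Φ : Set A.PosFlat))
    (hlt : ∀ y ∈ Φ, (support H y.1.space).card < n)
    {M : A.Flat} (hM : M ∈ flagFlats Φ) (hmax : ∀ x ∈ flagFlats Φ, x ≤ M) :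
    flagPoincare Φ = (1 + X) ^ (support H M.space).card *
      genericPoincare (n - (support H M.space).card) (m - (support H M.space).card) := by
  rw [HyperplaneArrangement.flagPoincare_eq, ← prod_erase_mul _ _ hM,
    hA.prod_erase_flagFlats hn hnm hΦ hlt hM hmax, flagNext_eq_bot,
    hA.poincare_restrict_sub_of_univ hnm M support_bot bot_le]
  intro z hz h
  exact absurd (hmax z.1 (mem_flagFlats.2 (Or.inr ⟨z, hz, rfl⟩))) (not_le_of_gt h)

open Classical in
-- The top flat and the empty space have the same support, so the factor of the previous maximum is
-- unchanged; the new factor, of the top flat itself, has rank zero and equals `1`.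
theorem flagPoincare_insert_eq (hA : IsGenericCentral A H) (hn : 1 ≤ n) (hnm : n ≤ m)
    {Φ : Finset A.PosFlat} (hΦ : IsChain (· ≤ ·) (Φ : Set A.PosFlat))
    (hlt : ∀ y ∈ Φ, (support H y.1.space).card < n) {y : A.PosFlat}
    (hy : support H y.1.space = univ) :
    flagPoincare (insert y Φ) = flagPoincare Φ := by
  obtain ⟨M, hM, hmax⟩ := exists_isGreatest_flagFlats hΦ
  have hle : ∀ x : A.Flat, x ≤ y.1 := fun x => by
    rw [hA.isTruncatedBoolean.le_iff, hy]
    exact subset_univ _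
  have hyΦ : y ∉ Φ := fun h => by
    have := hlt y h
    rw [hy, card_univ, Fintype.card_fin] at this
    omega
  have hyF : y.1 ∉ flagFlats Φ := fun h => by
    rcases mem_flagFlats.1 h with h | ⟨z, hz, h⟩
    · exact y.2 h
    · exact hyΦ (Subtype.ext h ▸ hz)
  have h2 := prod_flagFlats_insert (y := y)
    (fun z hz => lt_of_le_of_ne (hle z.1) fun h => hyΦ (h ▸ hz)) hM hmax
  rw [HyperplaneArrangement.flagPoincare_eq, flagFlats_insert, prod_insert hyF, h2,
    hA.flagPoincare_eq hn hnm hΦ hlt hM hmax, hA.prod_erase_flagFlats hn hnm hΦ hlt hM hmax,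
    hA.poincare_restrict_sub_of_univ hnm M hy ((Flat.le_iff _ _).1 (hle M)), flagNext_eq_bot,
    hA.poincare_restrict_sub_of_univ hnm y.1 support_bot bot_le, hy, card_univ, Fintype.card_fin,
    Nat.sub_eq_zero_of_le hnm]
  · simp [genericPoincare]
  · intro z hz h
    exact absurd (hle z.1) (not_le_of_gt h)

end IsGenericCentral

end

/-! ### The flag Hilbert–Poincaré series -/

section

open Finset Polynomial

section WeakOrder

variable {α k : Type*} [DecidableEq α] [Field k]

theorem mem_weakOrderChains {I : Finset α} {C : Finset (Finset α)} :
    C ∈ weakOrderChains I ↔ (∀ J ∈ C, J ≠ ∅ ∧ J ⊆ I) ∧ IsChain (· ⊆ ·) (C : Set (Finset α)) := by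
  simp only [weakOrderChains, mem_filter, mem_powerset, and_congr_left_iff]
  intro _
  simp only [subset_iff, mem_erase, mem_powerset]

theorem sum_weakOrderChains_filter_mem {M : Type*} [AddCommMonoid M] {I : Finset α} (hI : I ≠ ∅)
    (f : Finset (Finset α) → M) :
    ∑ C ∈ (weakOrderChains I).filter (fun C => I ∈ C), f C =
      ∑ C ∈ (weakOrderChains I).filter (fun C => I ∉ C), f (insert I C) := by
  symm
  refine sum_bij' (fun C _ => insert I C) (fun C _ => C.erase I) ?_ ?_ ?_ ?_ ?_
  · intro C hC
    simp only [mem_filter, mem_weakOrderChains] at hC ⊢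
    refine ⟨⟨?_, ?_⟩, mem_insert_self _ _⟩
    · intro J hJ
      rcases mem_insert.1 hJ with rfl | hJ
      · exact ⟨hI, subset_rfl⟩
      · exact hC.1.1 J hJ
    · rw [coe_insert]
      exact hC.1.2.insert fun J hJ _ => Or.inr (hC.1.1 J hJ).2
  · intro C hC
    simp only [mem_filter, mem_weakOrderChains] at hC ⊢
    refine ⟨⟨fun J hJ => hC.1.1 J (mem_of_mem_erase hJ), hC.1.2.mono ?_⟩, notMem_erase _ _⟩
    exact_mod_cast erase_subset _ _
  · intro C hC
    exact erase_insert (mem_filter.1 hC).2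
  · intro C hC
    exact insert_erase (mem_filter.1 hC).2
  · intro C hC
    rfl

/-- If `S` is the sum over the chains avoiding `I`, the chains containing `I` contribute `t I / (1 -
t I) * S`, and all chains together `S / (1 - t I)`. -/
theorem sum_weakOrderChains_mem (I : Finset α) (hI : I ≠ ∅) (t : Finset α → k) (ht : t I ≠ 1) :
    ∑ C ∈ (weakOrderChains I).filter (fun C => I ∈ C), ∏ J ∈ C, t J / (1 - t J) =
      t I * weakOrderZeta I t := by
  have h1 : 1 - t I ≠ 0 := sub_ne_zero.2 ht.symm
  rw [weakOrderZeta, ← sum_filter_add_sum_filter_not (weakOrderChains I) (fun C => I ∈ C),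
    sum_weakOrderChains_filter_mem hI]
  have h2 : ∑ C ∈ (weakOrderChains I).filter (fun C => I ∉ C), ∏ J ∈ insert I C, t J / (1 - t J) =
      t I / (1 - t I) * ∑ C ∈ (weakOrderChains I).filter (fun C => I ∉ C),
        ∏ J ∈ C, t J / (1 - t J) := by
    rw [mul_sum]
    exact sum_congr rfl fun C hC => prod_insert (mem_filter.1 hC).2
  rw [h2]
  field_simp
  ring

end WeakOrder

namespace HyperplaneArrangement

variable {F V : Type*} [Field F] [AddCommGroup V] [Module F V] (A : HyperplaneArrangement F V)

theorem varOf_space (x : A.PosFlat) : A.varOf x.1.space = A.var x := by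
  have h : ∃ y : A.PosFlat, y.1.space = x.1.space := ⟨x, rfl⟩
  rw [varOf, dif_pos h]
  exact congrArg _ (Subtype.ext (Flat.space_injective A h.choose_spec))

theorem var_ne_one (x : A.PosFlat) : A.var x ≠ 1 := by
  intro h
  rw [var, ← map_one (algebraMap (MvPolynomial A.PosFlat ℚ) A.RatFun)] at h
  have := IsFractionRing.injective (MvPolynomial A.PosFlat ℚ) A.RatFun h
  simpa using congrArg (MvPolynomial.eval 0) this

end HyperplaneArrangement

open HyperplaneArrangement

namespace IsGenericCentral

variable {F : Type*} [Field F] {n m : ℕ} {A : HyperplaneArrangement F (Fin n → F)}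
  {H : Fin m → AffineSubspace F (Fin n → F)}

theorem support_flat (hA : IsGenericCentral A H) (I : Finset (Fin m)) :
    support H (hA.flat I).space = if I.card < n then I else univ := hA.support_inf I

theorem flat_ne_bot (hA : IsGenericCentral A H) (hn : 1 ≤ n) (hnm : n ≤ m) {I : Finset (Fin m)}
    (hI : I ≠ ∅) : hA.flat I ≠ ⊥ := by
  intro h
  have h1 := hA.support_flat I
  rw [h, hA.support_bot_flat hn] at h1
  split_ifs at h1
  · exact hI h1.symm
  · have := congrArg Finset.card h1
    simp at this
    omega

theorem univ_ne_empty (hn : 1 ≤ n) (hnm : n ≤ m) : (univ : Finset (Fin m)) ≠ ∅ := by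
  intro h
  have := congrArg Finset.card h
  simp at this
  omega

theorem exists_posFlat (hA : IsGenericCentral A H) (hn : 1 ≤ n) (hnm : n ≤ m) :
    ∃ p : Finset (Fin m) → A.PosFlat, ∀ I, I ≠ ∅ → (p I).1 = hA.flat I := by
  classical
  -- The empty set would give the excluded bottom flat; the top flat serves as a dummy value.
  refine ⟨fun I => if h : I = ∅ then ⟨hA.flat univ, hA.flat_ne_bot hn hnm (univ_ne_empty hn hnm)⟩
    else ⟨hA.flat I, hA.flat_ne_bot hn hnm h⟩, fun I hI => ?_⟩
  simp [hI]

/-- The intersection of a nonempty set of hyperplanes of a generic central arrangement, as a flat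
different from the bottom element. -/
noncomputable def posFlat (hA : IsGenericCentral A H) (hn : 1 ≤ n) (hnm : n ≤ m) :
    Finset (Fin m) → A.PosFlat := (hA.exists_posFlat hn hnm).choose

variable (hA : IsGenericCentral A H) (hn : 1 ≤ n) (hnm : n ≤ m)

theorem posFlat_coe {I : Finset (Fin m)} (hI : I ≠ ∅) :
    (hA.posFlat hn hnm I).1 = hA.flat I := (hA.exists_posFlat hn hnm).choose_spec I hI

theorem support_posFlat_of_lt {I : Finset (Fin m)} (hI : I ≠ ∅) (hlt : I.card < n) :
    support H (hA.posFlat hn hnm I).1.space = I := by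
  rw [hA.posFlat_coe hn hnm hI, hA.support_flat, if_pos hlt]

theorem support_posFlat_univ : support H (hA.posFlat hn hnm univ).1.space = univ := by
  rw [hA.posFlat_coe hn hnm (univ_ne_empty hn hnm), hA.support_flat]
  split_ifs <;> rfl

theorem posFlat_support (x : A.PosFlat) : hA.posFlat hn hnm (support H x.1.space) = x := by
  have h0 : support H x.1.space ≠ ∅ := fun h => x.2 <| hA.isTruncatedBoolean.injective <| by
    rw [h, hA.support_bot_flat hn]
  refine Subtype.ext (Flat.space_injective A ?_)
  rw [hA.posFlat_coe hn hnm h0, flat_space, ← hA.space_eq_inf]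

theorem support_ne_empty (hA : IsGenericCentral A H) (hn : 1 ≤ n) (x : A.PosFlat) :
    support H x.1.space ≠ ∅ := fun h =>
  x.2 <| hA.isTruncatedBoolean.injective <| by
    rw [h, hA.support_bot_flat hn]

theorem varOf_inf {I : Finset (Fin m)} (hI : I ≠ ∅) :
    A.varOf (I.inf H) = A.var (hA.posFlat hn hnm I) := by
  rw [← varOf_space, hA.posFlat_coe hn hnm hI, flat_space]

theorem posFlat_le_iff {I J : Finset (Fin m)} (hI : I ≠ ∅) (hIn : I.card < n) (hJ : J ≠ ∅)
    (hJn : J.card < n) : hA.posFlat hn hnm I ≤ hA.posFlat hn hnm J ↔ I ⊆ J := by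
  rw [← Subtype.coe_le_coe, hA.isTruncatedBoolean.le_iff, hA.support_posFlat_of_lt hn hnm hI hIn,
    hA.support_posFlat_of_lt hn hnm hJ hJn]

/-- The chains of nonempty sets of fewer than `n` hyperplanes. -/
noncomputable def properChains (n m : ℕ) : Finset (Finset (Finset (Fin m))) :=
  (weakOrderChains (univ : Finset (Fin m))).filter fun C => ∀ J ∈ C, J.card < n

theorem mem_properChains {C : Finset (Finset (Fin m))} :
    C ∈ properChains n m ↔ (∀ J ∈ C, J ≠ ∅ ∧ J.card < n) ∧
      IsChain (· ⊆ ·) (C : Set (Finset (Fin m))) := by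
  simp only [properChains, mem_filter, mem_weakOrderChains, subset_univ, and_true]
  constructor
  · rintro ⟨⟨h1, h2⟩, h3⟩
    exact ⟨fun J hJ => ⟨h1 J hJ, h3 J hJ⟩, h2⟩
  · rintro ⟨h1, h2⟩
    exact ⟨⟨fun J hJ => (h1 J hJ).1, h2⟩, fun J hJ => (h1 J hJ).2⟩

theorem posFlat_injOn : Set.InjOn (hA.posFlat hn hnm) {I | I ≠ ∅ ∧ I.card < n} := by
  intro I hI J hJ h
  rw [← hA.support_posFlat_of_lt hn hnm hI.1 hI.2, h, hA.support_posFlat_of_lt hn hnm hJ.1 hJ.2]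

open Classical in
theorem isChain_image_posFlat {C : Finset (Finset (Fin m))} (hC : C ∈ properChains n m) :
    IsChain (· ≤ ·) ((C.image (hA.posFlat hn hnm) : Finset A.PosFlat) : Set A.PosFlat) := by
  rw [mem_properChains] at hC
  rw [coe_image]
  rintro _ ⟨I, hI, rfl⟩ _ ⟨J, hJ, rfl⟩ -
  change hA.posFlat hn hnm I ≤ hA.posFlat hn hnm J ∨ hA.posFlat hn hnm J ≤ hA.posFlat hn hnm I
  rw [hA.posFlat_le_iff hn hnm (hC.1 I hI).1 (hC.1 I hI).2 (hC.1 J hJ).1 (hC.1 J hJ).2,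
    hA.posFlat_le_iff hn hnm (hC.1 J hJ).1 (hC.1 J hJ).2 (hC.1 I hI).1 (hC.1 I hI).2]
  exact hC.2.total hI hJ

open Classical in
-- The top flat is comparable with everything, so flags come in pairs that differ by it; those
-- without it are chains of proper supports.
theorem sum_flags {M : Type*} [AddCommMonoid M] (f : Finset A.PosFlat → M) :
    ∑ Φ ∈ A.flags, f Φ = ∑ C ∈ properChains n m, (f (C.image (hA.posFlat hn hnm)) +
      f (insert (hA.posFlat hn hnm univ) (C.image (hA.posFlat hn hnm)))) := by
  set p := hA.posFlat hn hnm with hp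
  have hle : ∀ x : A.PosFlat, x ≤ p univ := fun x => by
    rw [← Subtype.coe_le_coe, hA.isTruncatedBoolean.le_iff, hA.support_posFlat_univ hn hnm]
    exact subset_univ _
  have hs : ∀ x : A.PosFlat, x ≠ p univ → (support H x.1.space).card < n := fun x hx =>
    (hA.isTruncatedBoolean.card_lt_or x.1).resolve_right fun h => hx (by
      rw [← hA.posFlat_support hn hnm x]
      exact congrArg p h)
  have key : ∀ g : Finset A.PosFlat → M,
      ∑ Φ ∈ A.flags.filter (fun Φ => p univ ∉ Φ), g Φ = ∑ C ∈ properChains n m, g (C.image p) := by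
    intro g
    symm
    refine sum_bij' (fun C _ => C.image p) (fun Φ _ => Φ.image fun x => support H x.1.space)
      ?_ ?_ ?_ ?_ (fun _ _ => rfl)
    · intro C hC
      simp only [flags, mem_filter, mem_univ, true_and]
      refine ⟨hA.isChain_image_posFlat hn hnm hC, fun h => ?_⟩
      obtain ⟨J, hJ, hJ2⟩ := mem_image.1 h
      rw [mem_properChains] at hC
      have h1 := hA.support_posFlat_of_lt hn hnm (hC.1 J hJ).1 (hC.1 J hJ).2
      rw [← hp, hJ2, hA.support_posFlat_univ hn hnm] at h1
      have h2 := (hC.1 J hJ).2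
      rw [← h1, card_univ, Fintype.card_fin] at h2
      omega
    · intro Φ hΦ
      simp only [flags, mem_filter, mem_univ, true_and] at hΦ
      rw [mem_properChains]
      constructor
      · intro J hJ
        obtain ⟨x, hx, rfl⟩ := mem_image.1 hJ
        exact ⟨hA.support_ne_empty hn x, hs x fun h => hΦ.2 (h ▸ hx)⟩
      · rw [coe_image]
        rintro _ ⟨x, hx, rfl⟩ _ ⟨y, hy, rfl⟩ -
        exact (hΦ.1.total hx hy).imp (hA.isTruncatedBoolean.le_iff x.1 y.1).1
          (hA.isTruncatedBoolean.le_iff y.1 x.1).1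
    · intro C hC
      rw [mem_properChains] at hC
      simp only [image_image]
      rw [image_congr (g := id), image_id]
      intro J hJ
      exact hA.support_posFlat_of_lt hn hnm (hC.1 J hJ).1 (hC.1 J hJ).2
    · intro Φ hΦ
      simp only [image_image]
      rw [image_congr (g := id), image_id]
      intro x hx
      exact hA.posFlat_support hn hnm x
  rw [sum_add_distrib, ← key, ← key fun Φ => f (insert (p univ) Φ),
    ← sum_filter_add_sum_filter_not A.flags (fun Φ => p univ ∉ Φ)]
  congr 1
  symm
  refine sum_bij' (fun Φ _ => insert (p univ) Φ) (fun Φ _ => Φ.erase (p univ)) ?_ ?_ ?_ ?_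
    (fun _ _ => rfl)
  · intro Φ hΦ
    simp only [flags, mem_filter, mem_univ, true_and, not_not] at hΦ ⊢
    rw [coe_insert]
    exact ⟨hΦ.1.insert fun x _ _ => Or.inr (hle x), mem_insert_self _ _⟩
  · intro Φ hΦ
    simp only [flags, mem_filter, mem_univ, true_and, not_not] at hΦ ⊢
    exact ⟨hΦ.1.mono (by exact_mod_cast erase_subset _ _), notMem_erase _ _⟩
  · intro Φ hΦ
    exact erase_insert (mem_filter.1 hΦ).2
  · intro Φ hΦ
    exact insert_erase (not_not.1 (mem_filter.1 hΦ).2)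

theorem sup_mem_of_mem_properChains {C : Finset (Finset (Fin m))} (hC : C ∈ properChains n m)
    (hne : C.Nonempty) : C.sup id ∈ C := by
  rw [mem_properChains] at hC
  obtain ⟨I, hI, hmax⟩ := IsChain.exists_isGreatest (s := C) hC.2 hne
  have : C.sup id = I := le_antisymm (Finset.sup_le hmax) (Finset.le_sup (f := id) hI)
  rwa [this]

/-- A nonempty chain is sorted by its largest element `I`, which is its supremum; below `I` the
bound on cardinalities is automatic. -/
theorem sum_properChains {M : Type*} [AddCommMonoid M] (hn : 1 ≤ n)
    (f : Finset (Finset (Fin m)) → M) :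
    ∑ C ∈ properChains n m, f C = f ∅ + ∑ ℓ ∈ Icc 1 (n - 1), ∑ I ∈ powersetCard ℓ univ,
      ∑ C ∈ (weakOrderChains I).filter (fun C => I ∈ C), f C := by
  classical
  have h0 : (∅ : Finset (Finset (Fin m))) ∈ properChains n m := by simp [mem_properChains]
  rw [← add_sum_erase _ _ h0]
  congr 1
  rw [← sum_fiberwise_of_maps_to (g := fun C => (C.sup id).card) (t := Icc 1 (n - 1))]
  · refine sum_congr rfl fun ℓ hℓ => ?_
    rw [mem_Icc] at hℓ
    rw [← sum_fiberwise_of_maps_to (g := fun C => C.sup id) (t := powersetCard ℓ univ)]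
    · refine sum_congr rfl fun I hI => sum_congr ?_ fun _ _ => rfl
      have hI := (mem_powersetCard.1 hI).2
      ext C
      simp only [mem_filter, mem_erase, mem_weakOrderChains]
      constructor
      · rintro ⟨⟨⟨h1, h2⟩, h3⟩, rfl⟩
        have h4 := sup_mem_of_mem_properChains h2 (nonempty_iff_ne_empty.2 h1)
        rw [mem_properChains] at h2
        exact ⟨⟨fun J hJ => ⟨(h2.1 J hJ).1, Finset.le_sup (f := id) hJ⟩, h2.2⟩, h4⟩
      · rintro ⟨⟨h1, h2⟩, h3⟩
        have h4 : C.sup id = I := le_antisymm (Finset.sup_le fun J hJ => (h1 J hJ).2)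
          (Finset.le_sup (f := id) h3)
        refine ⟨⟨⟨ne_empty_of_mem h3, mem_properChains.2 ⟨fun J hJ => ⟨(h1 J hJ).1, ?_⟩, h2⟩⟩, ?_⟩, h4⟩
        · have := card_le_card (h1 J hJ).2
          omega
        · rw [h4, hI]
    · intro C hC
      exact mem_powersetCard.2 ⟨subset_univ _, (mem_filter.1 hC).2⟩
  · intro C hC
    obtain ⟨h1, h2⟩ := mem_erase.1 hC
    have h3 := sup_mem_of_mem_properChains h2 (nonempty_iff_ne_empty.2 h1)
    have h4 := (mem_properChains.1 h2).1 _ h3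
    have h5 := card_pos.2 (nonempty_iff_ne_empty.2 h4.1)
    exact mem_Icc.2 ⟨h5, by omega⟩

open Classical in
theorem flagPoincare_image {C : Finset (Finset (Fin m))} (hC : C ∈ properChains n m) :
    flagPoincare (C.image (hA.posFlat hn hnm)) = (1 + X) ^ (C.sup id).card *
      genericPoincare (n - (C.sup id).card) (m - (C.sup id).card) := by
  have hC' := mem_properChains.1 hC
  have hlt : ∀ y ∈ C.image (hA.posFlat hn hnm), (support H y.1.space).card < n := by
    intro y hy
    obtain ⟨J, hJ, rfl⟩ := mem_image.1 hy
    rw [hA.support_posFlat_of_lt hn hnm (hC'.1 J hJ).1 (hC'.1 J hJ).2]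
    exact (hC'.1 J hJ).2
  have hch := hA.isChain_image_posFlat hn hnm hC
  obtain ⟨M, hM, hmax⟩ := exists_isGreatest_flagFlats hch
  have hMs : support H M.space = C.sup id := by
    rcases C.eq_empty_or_nonempty with rfl | hne
    · have : M = ⊥ := by simpa [flagFlats] using hM
      rw [this, hA.support_bot_flat hn]
      rfl
    · have h1 := sup_mem_of_mem_properChains hC hne
      apply subset_antisymm
      · rcases mem_flagFlats.1 hM with rfl | ⟨z, hz, rfl⟩
        · rw [hA.support_bot_flat hn]
          exact empty_subset _
        · obtain ⟨J, hJ, rfl⟩ := mem_image.1 hz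
          rw [hA.support_posFlat_of_lt hn hnm (hC'.1 J hJ).1 (hC'.1 J hJ).2]
          exact Finset.le_sup (f := id) hJ
      · have h2 := hmax (hA.posFlat hn hnm (C.sup id)).1
          (mem_flagFlats.2 (Or.inr ⟨_, mem_image_of_mem _ h1, rfl⟩))
        rw [hA.isTruncatedBoolean.le_iff,
          hA.support_posFlat_of_lt hn hnm (hC'.1 _ h1).1 (hC'.1 _ h1).2] at h2
        exact h2
  rw [hA.flagPoincare_eq hn hnm hch hlt hM hmax, hMs]

/-- The polynomial of a flag depends only on its largest proper support, so it factors out of the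
sum over the chains with that maximum. -/
theorem fHP_eq (hA : IsGenericCentral A H) (hn : 1 ≤ n) (hnm : n ≤ m)
    (t : Finset (Fin m) → A.RatFun) (ht : ∀ I, t I = A.varOf (I.inf H))
    (t₁ : A.RatFun) (ht₁ : t₁ = A.varOf (Finset.univ.inf H)) :
    A.fHP = C (1 / (1 - t₁)) * (1 + X) *
            ∑ k ∈ range n, ((m - 1).choose k : A.RatFun[X]) * X ^ k +
          ∑ ℓ ∈ Icc 1 (n - 1), ∑ k ∈ range (n - ℓ),
            C (1 / (1 - t₁)) * (1 + X) ^ (ℓ + 1) *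
              ((m - ℓ - 1).choose k : A.RatFun[X]) * X ^ k *
              ∑ I ∈ powersetCard ℓ (univ : Finset (Fin m)),
                C (t I * weakOrderZeta I t) := by
  classical
  set p := hA.posFlat hn hnm with hp
  have htv : ∀ I, I ≠ ∅ → t I = A.var (p I) := fun I hI => by
    rw [ht, hA.varOf_inf hn hnm hI]
  have ht1 : t₁ = A.var (p univ) := by
    rw [ht₁, hA.varOf_inf hn hnm (univ_ne_empty hn hnm)]
  have h1 : 1 - t₁ ≠ 0 := sub_ne_zero.2 (by rw [ht1]; exact (A.var_ne_one _).symm)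
  have hgp : ∀ ℓ, ℓ < n → (genericPoincare (n - ℓ) (m - ℓ)).map (Int.castRingHom A.RatFun) =
      (1 + X) * ∑ k ∈ range (n - ℓ), ((m - ℓ - 1).choose k : A.RatFun[X]) * X ^ k := by
    intro ℓ hℓ
    rw [genericPoincare, if_neg (by omega)]
    simp [Polynomial.map_sum]
  have hterm : ∀ D ∈ properChains n m,
      ((flagPoincare (D.image p)).map (Int.castRingHom A.RatFun) *
        C (∏ x ∈ D.image p, A.var x / (1 - A.var x)) +
      (flagPoincare (insert (p univ) (D.image p))).map (Int.castRingHom A.RatFun) *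
        C (∏ x ∈ insert (p univ) (D.image p), A.var x / (1 - A.var x))) =
      C (1 / (1 - t₁)) * (1 + X) ^ (D.sup id).card *
        (genericPoincare (n - (D.sup id).card) (m - (D.sup id).card)).map
          (Int.castRingHom A.RatFun) * C (∏ J ∈ D, t J / (1 - t J)) := by
    intro D hD
    have hD' := mem_properChains.1 hD
    have hlt : ∀ y ∈ D.image p, (support H y.1.space).card < n := by
      intro y hy
      obtain ⟨J, hJ, rfl⟩ := mem_image.1 hy
      rw [hA.support_posFlat_of_lt hn hnm (hD'.1 J hJ).1 (hD'.1 J hJ).2]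
      exact (hD'.1 J hJ).2
    have hni : p univ ∉ D.image p := fun h => by
      have := hlt _ h
      rw [hA.support_posFlat_univ hn hnm, card_univ, Fintype.card_fin] at this
      omega
    have hprod : ∏ x ∈ D.image p, A.var x / (1 - A.var x) = ∏ J ∈ D, t J / (1 - t J) := by
      rw [prod_image fun I hI J hJ h => hA.posFlat_injOn hn hnm (hD'.1 I hI) (hD'.1 J hJ) h]
      exact prod_congr rfl fun J hJ => by rw [htv J (hD'.1 J hJ).1]
    rw [hA.flagPoincare_insert_eq hn hnm (hA.isChain_image_posFlat hn hnm hD) hlt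
      (hA.support_posFlat_univ hn hnm), prod_insert hni, hprod, hA.flagPoincare_image hn hnm hD,
      ← ht1]
    -- The summand `1` is the flag without the top flat, the other one the flag with it.
    have h3 : (C (1 / (1 - t₁)) : A.RatFun[X]) = 1 + C (t₁ / (1 - t₁)) := by
      rw [← C_1, ← C_add]
      congr 1
      field_simp
      ring
    rw [h3, C_mul]
    simp only [Polynomial.map_mul, Polynomial.map_pow, Polynomial.map_add, Polynomial.map_one, map_X]
    ring
  rw [fHP, hA.sum_flags hn hnm, sum_congr rfl hterm, sum_properChains hn]
  congr 1
  · have := hgp 0 (by omega)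
    simp only [Nat.sub_zero] at this
    simp [this, mul_assoc]
  · refine sum_congr rfl fun ℓ hℓ => ?_
    rw [mem_Icc] at hℓ
    have hI : ∀ I ∈ powersetCard ℓ (univ : Finset (Fin m)),
        ∑ D ∈ (weakOrderChains I).filter (fun D => I ∈ D),
          C (1 / (1 - t₁)) * (1 + X) ^ (D.sup id).card *
        (genericPoincare (n - (D.sup id).card) (m - (D.sup id).card)).map
          (Int.castRingHom A.RatFun) * C (∏ J ∈ D, t J / (1 - t J)) =
        C (1 / (1 - t₁)) * (1 + X) ^ (ℓ + 1) *
          (∑ k ∈ range (n - ℓ), ((m - ℓ - 1).choose k : A.RatFun[X]) * X ^ k) *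
          C (t I * weakOrderZeta I t) := by
      intro I hI
      have hIℓ := (mem_powersetCard.1 hI).2
      have hI0 : I ≠ ∅ := by
        rintro rfl
        simp at hIℓ
        omega
      rw [← sum_weakOrderChains_mem I hI0 t (by rw [htv I hI0]; exact A.var_ne_one _), map_sum, mul_sum]
      refine sum_congr rfl fun D hD => ?_
      simp only [mem_filter, mem_weakOrderChains] at hD
      have hsup : D.sup id = I := le_antisymm (Finset.sup_le fun J hJ => (hD.1.1 J hJ).2)
        (Finset.le_sup (f := id) hD.2)
      rw [hsup, hIℓ, hgp ℓ (by omega)]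
      ring
    rw [sum_congr rfl hI, ← mul_sum]
    generalize ∑ I ∈ powersetCard ℓ (univ : Finset (Fin m)), C (t I * weakOrderZeta I t) = S
    rw [mul_sum, sum_mul]
    exact sum_congr rfl fun k _ => by ring

end IsGenericCentral

end

/-! ### Haar measure on compact discrete valuation rings -/

section

open MeasureTheory Finset Topology IsLocalRing

section CompactDVR

variable {o : Type*} [CommRing o] [IsDomain o] [IsDiscreteValuationRing o]

theorem dvrAbs_zero : dvrAbs (0 : o) = 0 := by simp [dvrAbs]

theorem dvrAbs_mul (x y : o) : dvrAbs (x * y) = dvrAbs x * dvrAbs y := by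
  by_cases hx : x = 0
  · simp [hx, dvrAbs_zero]
  by_cases hy : y = 0
  · simp [hy, dvrAbs_zero]
  have hx' := (IsDiscreteValuationRing.addVal_eq_top_iff (R := o)).not.2 hx
  have hy' := (IsDiscreteValuationRing.addVal_eq_top_iff (R := o)).not.2 hy
  rw [dvrAbs, dvrAbs, dvrAbs, if_neg hx, if_neg hy, if_neg (mul_ne_zero hx hy),
    IsDiscreteValuationRing.addVal_mul, ENat.toNat_add hx' hy', pow_add]

theorem dvrAbs_of_irreducible {ϖ : o} (h : Irreducible ϖ) :
    dvrAbs ϖ = (Nat.card (ResidueField o) : NNReal)⁻¹ := by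
  rw [dvrAbs, if_neg h.ne_zero, IsDiscreteValuationRing.addVal_uniformizer h]
  simp

theorem dvrAbs_of_notMem {x : o} (h : x ∉ maximalIdeal o) : dvrAbs x = 1 := by
  have hu : IsUnit x := by simpa using h
  rw [dvrAbs, if_neg hu.ne_zero, IsDiscreteValuationRing.addVal_eq_zero_iff.2 hu]
  simp

theorem dvrAbs_le_one (x : o) : dvrAbs x ≤ 1 := by
  rw [dvrAbs]
  split_ifs
  · exact zero_le_one
  · refine pow_le_one₀ zero_le ?_
    rcases Nat.eq_zero_or_pos (Nat.card (ResidueField o)) with h | h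
    · simp [h]
    · exact inv_le_one_of_one_le₀ (by exact_mod_cast h)

variable [TopologicalSpace o] [IsTopologicalRing o] [CompactSpace o] [T2Space o]

/-- The powers of the maximal ideal are compact and decreasing, and intersect in zero by Krull's
theorem, so a neighbourhood of zero contains one of them. -/
theorem exists_maximalIdeal_pow_subset {U : Set o} (hU : U ∈ 𝓝 (0 : o)) :
    ∃ k, ((maximalIdeal o ^ k : Ideal o) : Set o) ⊆ U := by
  refine exists_subset_nhds_of_isCompact (V := fun k => ((maximalIdeal o ^ k : Ideal o) : Set o))
    ?_ (fun k => ?_) ?_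
  · exact Antitone.directed_ge fun a b h => Ideal.pow_le_pow_right h
  · exact (Ideal.isCompact_of_fg (IsNoetherian.noetherian _))
  · intro x hx
    have h1 : x ∈ (⨅ k : ℕ, maximalIdeal o ^ k : Ideal o) := by
      simpa [Submodule.mem_iInf] using hx
    rw [Ideal.iInf_pow_eq_bot_of_isLocalRing _ (maximalIdeal.isMaximal o).ne_top] at h1
    rw [(Submodule.mem_bot o).1 h1]
    exact hU

/-- Needed for the Borel structure on powers of `o` to be the product one. The maximal-adic
neighbourhoods make the uniformity countably generated, hence pseudometrizable, and compactness does
the rest. -/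
theorem secondCountableTopology_of_compact_dvr : SecondCountableTopology o := by
  have hb : (𝓝 (0 : o)).HasBasis (fun _ : ℕ => True)
      fun k => ((maximalIdeal o ^ k : Ideal o) : Set o) := by
    refine ⟨fun U => ⟨fun hU => ?_, ?_⟩⟩
    · obtain ⟨k, hk⟩ := exists_maximalIdeal_pow_subset hU
      exact ⟨k, trivial, hk⟩
    · rintro ⟨k, -, hk⟩
      exact Filter.mem_of_superset ((isOpen_maximalIdeal_pow o k).mem_nhds (zero_mem _)) hk
  have : (𝓝 (0 : o)).IsCountablyGenerated := hb.isCountablyGenerated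
  let := IsTopologicalAddGroup.rightUniformSpace o
  have : IsUniformAddGroup o := isUniformAddGroup_of_addCommGroup
  have := IsUniformAddGroup.uniformity_countably_generated (α := o)
  let := UniformSpace.pseudoMetricSpace o
  exact inferInstance

variable [MeasurableSpace o] [BorelSpace o]

theorem measurable_dvrAbs : Measurable (dvrAbs : o → NNReal) := by
  obtain ⟨ϖ, hϖ⟩ := IsDiscreteValuationRing.exists_irreducible o
  let : MeasurableSpace ℕ∞ := ⊤
  -- These sets are powers of the maximal ideal, which are open; level sets of the valuation are
  -- differences of them.
  have hge : ∀ k : ℕ, MeasurableSet {x : o | (k : ℕ∞) ≤ IsDiscreteValuationRing.addVal o x} := by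
    intro k
    have : {x : o | (k : ℕ∞) ≤ IsDiscreteValuationRing.addVal o x} =
        ((maximalIdeal o ^ k : Ideal o) : Set o) := by
      ext x
      rw [(IsDiscreteValuationRing.irreducible_iff_uniformizer ϖ).1 hϖ, Ideal.span_singleton_pow,
        SetLike.mem_coe, Ideal.mem_span_singleton, ← IsDiscreteValuationRing.addVal_le_iff_dvd,
        hϖ.addVal_pow, Set.mem_ofPred_eq]
    rw [this]
    exact (isOpen_maximalIdeal_pow o k).measurableSet
  have hv : Measurable (IsDiscreteValuationRing.addVal o : o → ℕ∞) := by
    refine measurable_to_countable' fun k => ?_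
    induction k using ENat.recTopCoe with
    | top =>
      have : (IsDiscreteValuationRing.addVal o : o → ℕ∞) ⁻¹' {⊤} = {0} := by
        ext x
        exact IsDiscreteValuationRing.addVal_eq_top_iff
      rw [this]
      exact measurableSet_singleton 0
    | coe k =>
      have : (IsDiscreteValuationRing.addVal o : o → ℕ∞) ⁻¹' {(k : ℕ∞)} =
          {x : o | (k : ℕ∞) ≤ IsDiscreteValuationRing.addVal o x} \
            {x : o | ((k + 1 : ℕ) : ℕ∞) ≤ IsDiscreteValuationRing.addVal o x} := by
        ext x
        simp only [Set.mem_preimage, Set.mem_singleton_iff, Set.mem_sdiff, Set.mem_ofPred_eq]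
        generalize IsDiscreteValuationRing.addVal o x = a
        induction a using ENat.recTopCoe with
        | top => simp
        | coe a =>
          norm_cast
          omega
      rw [this]
      exact (hge k).diff (hge (k + 1))
  have : (dvrAbs : o → NNReal) = (fun a : ℕ∞ => if a = ⊤ then 0 else
      ((Nat.card (ResidueField o) : NNReal)⁻¹) ^ a.toNat) ∘ IsDiscreteValuationRing.addVal o := by
    ext x
    by_cases hx : x = 0
    · simp [dvrAbs, hx]
    · simp [dvrAbs, hx, IsDiscreteValuationRing.addVal_eq_top_iff]
  rw [this]
  exact (measurable_from_top).comp hv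

theorem measurableSet_maximalIdeal : MeasurableSet {x : o | x ∈ maximalIdeal o} :=
  (isOpen_maximalIdeal o).measurableSet

variable (o) in
/-- The Haar measure of total mass `1` on a power of a compact discrete valuation ring. -/
noncomputable def haarPi (κ : Type*) [Fintype κ] : Measure (κ → o) :=
  Measure.pi fun _ : κ => Measure.addHaarMeasure (⊤ : TopologicalSpace.PositiveCompacts o)

section HaarPi

variable {κ : Type*} [Fintype κ]

instance isProbabilityMeasure_addHaarMeasure_top : IsProbabilityMeasure
    (Measure.addHaarMeasure (⊤ : TopologicalSpace.PositiveCompacts o)) :=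
  ⟨Measure.addHaarMeasure_self (K₀ := (⊤ : TopologicalSpace.PositiveCompacts o))⟩

instance : IsProbabilityMeasure (haarPi o κ) := by
  unfold haarPi
  infer_instance

instance : (haarPi o κ).IsAddHaarMeasure := by
  have := secondCountableTopology_of_compact_dvr (o := o)
  unfold haarPi
  infer_instance

/-- The cosets of the maximal ideal have equal measure, and there are as many as residue classes. -/
theorem addHaarMeasure_maximalIdeal :
    (Measure.addHaarMeasure (⊤ : TopologicalSpace.PositiveCompacts o)) {x | x ∈ maximalIdeal o} =
      (Nat.card (ResidueField o) : ENNReal)⁻¹ := by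
  have : Finite (o ⧸ (maximalIdeal o).toAddSubgroup) :=
    inferInstanceAs (Finite (ResidueField o))
  have : (maximalIdeal o).toAddSubgroup.FiniteIndex :=
    AddSubgroup.finiteIndex_of_finite_quotient
  have h := AddSubgroup.index_mul_measure (maximalIdeal o).toAddSubgroup
    measurableSet_maximalIdeal
    (Measure.addHaarMeasure (⊤ : TopologicalSpace.PositiveCompacts o))
  have h2 : (maximalIdeal o).toAddSubgroup.index = Nat.card (ResidueField o) := rfl
  rw [h2, measure_univ] at h
  exact ENNReal.eq_inv_of_mul_eq_one_left (by rw [mul_comm]; exact h)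

theorem measurableSet_forall_mem_maximalIdeal :
    MeasurableSet {x : κ → o | ∀ i, x i ∈ maximalIdeal o} := by
  simp only [Set.ofPred_forall]
  exact MeasurableSet.iInter fun i => measurable_pi_apply i measurableSet_maximalIdeal

theorem haarPi_forall_mem_maximalIdeal :
    haarPi o κ {x | ∀ i, x i ∈ maximalIdeal o} =
      ((Nat.card (ResidueField o) : ENNReal)⁻¹) ^ Fintype.card κ := by
  have : {x : κ → o | ∀ i, x i ∈ maximalIdeal o} = Set.univ.pi fun _ => {x | x ∈ maximalIdeal o} := by
    ext x
    simp
  rw [this, haarPi, Measure.pi_pi, prod_congr rfl fun i _ => addHaarMeasure_maximalIdeal]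
  simp

theorem integral_indicator_one_haarPi :
    ∫ x, {x : κ → o | ∀ i, x i ∈ maximalIdeal o}.indicator (fun _ => (1 : ℂ)) x ∂haarPi o κ =
      ((Nat.card (ResidueField o) : ℂ)⁻¹) ^ Fintype.card κ := by
  rw [integral_indicator measurableSet_forall_mem_maximalIdeal, setIntegral_const, measureReal_def,
    haarPi_forall_mem_maximalIdeal]
  simp

/-- The change of variables `x ↦ ϖ x`. -/
theorem integral_indicator_haarPi {ϖ : o} (hϖ : Irreducible ϖ) (f : (κ → o) → ℂ) :
    ∫ x, {x : κ → o | ∀ i, x i ∈ maximalIdeal o}.indicator f x ∂haarPi o κ =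
      ((Nat.card (ResidueField o) : ℂ)⁻¹) ^ Fintype.card κ * ∫ x, f (ϖ • x) ∂haarPi o κ := by
  have := secondCountableTopology_of_compact_dvr (o := o)
  set T : (κ → o) →+ (κ → o) := DistribSMul.toAddMonoidHom (κ → o) ϖ with hT
  have hTc : Continuous T := continuous_pi fun i => continuous_const.mul (continuous_apply i)
  have hTi : Function.Injective T := fun x y h => funext fun i =>
    mul_left_cancel₀ hϖ.ne_zero (congrFun h i)
  have hr : Set.range T = {x : κ → o | ∀ i, x i ∈ maximalIdeal o} := by
    ext x
    rw [Set.mem_ofPred_eq, (IsDiscreteValuationRing.irreducible_iff_uniformizer ϖ).1 hϖ]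
    simp only [Ideal.mem_span_singleton]
    constructor
    · rintro ⟨y, rfl⟩ i
      exact ⟨y i, rfl⟩
    · intro h
      choose y hy using h
      exact ⟨y, funext fun i => (hy i).symm⟩
  have hopen : IsOpen (Set.range T) := by
    rw [hr]
    simp only [Set.ofPred_forall]
    exact isOpen_iInter_of_finite fun i => (isOpen_maximalIdeal o).preimage (continuous_apply i)
  have hemb : IsOpenEmbedding T := ⟨(hTc.isClosedEmbedding hTi).isEmbedding, hopen⟩
  have : ((haarPi o κ).comap T).IsAddHaarMeasure :=
    Measure.IsAddHaarMeasure.comap (mH := inferInstance) _ hemb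
  -- By uniqueness of Haar measure, the pullback along multiplication by `ϖ` is a multiple of the
  -- measure itself; the factor is read off from the total mass.
  have hscal := Measure.isAddInvariant_eq_smul_of_compactSpace ((haarPi o κ).comap T) (haarPi o κ)
  set c := ((haarPi o κ).comap T).addHaarScalarFactor (haarPi o κ) with hc
  have hc2 : (c : ENNReal) = ((Nat.card (ResidueField o) : ENNReal)⁻¹) ^ Fintype.card κ := by
    have h1 := congrArg (fun μ => μ Set.univ) hscal
    simp only [Measure.smul_apply, measure_univ, ENNReal.smul_def, smul_eq_mul, mul_one] at h1
    rw [← h1, hemb.measurableEmbedding.comap_apply, Set.image_univ, hr,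
      haarPi_forall_mem_maximalIdeal]
  rw [integral_indicator measurableSet_forall_mem_maximalIdeal, ← hr,
    ← hemb.measurableEmbedding.map_comap, hemb.measurableEmbedding.integral_map, hscal,
    integral_smul_nnreal_measure, NNReal.smul_def, Complex.real_smul]
  congr 1
  have h3 := congrArg ENNReal.toReal hc2
  simp only [ENNReal.coe_toReal, ENNReal.toReal_pow, ENNReal.toReal_inv, ENNReal.toReal_natCast] at h3
  rw [h3]
  push_cast
  rfl

end HaarPi

end CompactDVR

end

/-! ### Integrands: products of maxima and residue indicators -/

section

open MeasureTheory Finset Topology IsLocalRing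

/-- At `x = q⁻¹` the left side is, by inclusion-exclusion, the probability that all forms in `W` are
units when any `r` of them are independent and the vanishing of `r` residues forces the others to
vanish. The proof raises `r` by one at a time. -/
theorem sum_powerset_neg_one_pow_mul_pow_min {ι k : Type*} [Field k] (W : Finset ι) (hW : W ≠ ∅)
    (r : ℕ) (x : k) :
    ∑ K ∈ W.powerset, (-1 : k) ^ K.card * x ^ min K.card r =
      (1 - x) * ∑ j ∈ range r, (-1 : k) ^ j * ((W.card - 1).choose j : k) * x ^ j := by
  classical
  rw [sum_powerset_apply_card (fun j => (-1 : k) ^ j * x ^ min j r) (x := W)]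
  obtain ⟨N, hN⟩ : ∃ N, W.card = N + 1 := ⟨W.card - 1, by
    have := card_pos.2 (nonempty_iff_ne_empty.2 hW)
    omega⟩
  rw [hN, Nat.add_sub_cancel]
  simp only [nsmul_eq_mul]
  have halt : ∀ r, ∑ j ∈ range (r + 1), (-1 : k) ^ j * ((N + 1).choose j : k) =
      (-1) ^ r * (N.choose r : k) := by
    intro r
    have := congrArg (Int.cast : ℤ → k) (Int.alternating_sum_range_choose_eq_choose (n := N) (m := r))
    push_cast at this
    exact this
  have hall : ∑ j ∈ range (N + 1 + 1), (-1 : k) ^ j * ((N + 1).choose j : k) = 0 := by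
    rw [halt]
    simp
  induction r with
  | zero =>
    simp only [Nat.min_zero, pow_zero, mul_one, range_zero, sum_empty, mul_zero]
    rw [← hall]
    exact sum_congr rfl fun j _ => mul_comm _ _
  | succ r ih =>
    rw [sum_range_succ _ r, mul_add, ← ih, ← sub_eq_iff_eq_add', ← sum_sub_distrib]
    -- Only sizes above `r` feel the new cap. Their alternating sum is minus the one over sizes up
    -- to `r`, since the full sum is zero.
    have h1 : ∀ j ∈ range (N + 1 + 1), ((N + 1).choose j : k) * ((-1) ^ j * x ^ min j (r + 1)) -
        ((N + 1).choose j : k) * ((-1) ^ j * x ^ min j r) = (x ^ (r + 1) - x ^ r) *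
          (((-1) ^ j * ((N + 1).choose j : k)) -
            if j ∈ range (r + 1) then (-1) ^ j * ((N + 1).choose j : k) else 0) := by
      intro j _
      simp only [mem_range]
      split_ifs with h
      · rw [min_eq_left (by omega), min_eq_left (by omega)]
        ring
      · rw [min_eq_right (by omega), min_eq_right (by omega)]
        ring
    rw [sum_congr rfl h1, ← mul_sum, sum_sub_distrib, hall, sum_ite_mem]
    have h2 : ∑ j ∈ range (N + 1 + 1) ∩ range (r + 1), (-1 : k) ^ j * ((N + 1).choose j : k) =
        ∑ j ∈ range (r + 1), (-1 : k) ^ j * ((N + 1).choose j : k) := by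
      refine sum_subset inter_subset_right fun j _ hj => ?_
      have : N + 1 < j := by
        by_contra h
        exact hj (mem_inter.2 ⟨mem_range.2 (by omega), by assumption⟩)
      rw [Nat.choose_eq_zero_of_lt this]
      simp
    rw [h2, halt]
    ring

section Recursion

variable {o : Type*} [CommRing o] [IsDomain o] [IsDiscreteValuationRing o]
  {ι : Type*}

/-- The product of the powers of the maxima of the `|y_j|`, `j ∈ J`, for `J ⊆ U` in a family. -/
noncomputable def maxProd [DecidableEq ι] (E : Finset (Finset ι)) (S : Finset ι → ℂ)
    (U : Finset ι) (y : ι → o) : ℂ :=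
  ∏ J ∈ E.filter (· ⊆ U), (((J.sup fun j => dvrAbs (y j) : NNReal) : ℝ) : ℂ) ^ S J

open Classical in
/-- The indicator function of the set where `y_i`, `i ∈ I`, is in the maximal ideal. -/
noncomputable def residueInd (I : Finset ι) (y : ι → o) : ℂ :=
  if ∀ i ∈ I, y i ∈ maximalIdeal o then 1 else 0

variable {E : Finset (Finset ι)} {S : Finset ι → ℂ}

theorem maxProd_congr [DecidableEq ι] {U : Finset ι} {y y' : ι → o} (h : ∀ i ∈ U, y i = y' i) :
    maxProd E S U y = maxProd E S U y' := by
  refine prod_congr rfl fun J hJ => ?_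
  rw [Finset.sup_congr rfl fun j hj => by rw [h j ((mem_filter.1 hJ).2 hj)]]

theorem residueInd_congr {U : Finset ι} {y y' : ι → o} (h : ∀ i ∈ U, y i = y' i) :
    residueInd U y = residueInd U y' := by
  have : (∀ i ∈ U, y i ∈ maximalIdeal o) ↔ (∀ i ∈ U, y' i ∈ maximalIdeal o) :=
    forall₂_congr fun i hi => by rw [h i hi]
  classical
  rw [residueInd, residueInd, if_congr this rfl rfl]

theorem norm_maxProd_le_one [DecidableEq ι] (hS : ∀ J ∈ E, 0 < (S J).re) (U : Finset ι)
    (y : ι → o) :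
    ‖maxProd E S U y‖ ≤ 1 := by
  rw [maxProd, norm_prod]
  refine prod_le_one (fun _ _ => norm_nonneg _) fun J hJ => ?_
  have hJ := hS J (mem_filter.1 hJ).1
  have h1 : (J.sup fun j => dvrAbs (y j)) ≤ 1 := Finset.sup_le fun j _ => dvrAbs_le_one _
  rw [Complex.norm_cpow_eq_rpow_re_of_nonneg (NNReal.coe_nonneg _) hJ.ne']
  exact Real.rpow_le_one (NNReal.coe_nonneg _) (by exact_mod_cast h1) hJ.le

theorem norm_residueInd_le_one (I : Finset ι) (y : ι → o) : ‖residueInd I y‖ ≤ 1 := by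
  rw [residueInd]
  split_ifs <;> simp

/-- A set `J` not contained in `I` has a unit among its values, so its maximum is `1`. -/
theorem maxProd_eq_of_forall_notMem [DecidableEq ι] {I U : Finset ι} (hIU : I ⊆ U) {y : ι → o}
    (h : ∀ i ∈ U, i ∉ I → y i ∉ maximalIdeal o) : maxProd E S U y = maxProd E S I y := by
  symm
  refine prod_subset (fun J hJ => ?_) fun J hJ hJI => ?_
  · rw [mem_filter] at hJ ⊢
    exact ⟨hJ.1, hJ.2.trans hIU⟩
  · rw [mem_filter] at hJ hJI
    obtain ⟨j, hj, hjI⟩ := not_subset.1 fun h => hJI ⟨hJ.1, h⟩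
    have : (J.sup fun j => dvrAbs (y j)) = 1 := by
      refine le_antisymm (Finset.sup_le fun j _ => dvrAbs_le_one _) ?_
      rw [← dvrAbs_of_notMem (h j (hJ.2 hj) hjI)]
      exact Finset.le_sup (f := fun j => dvrAbs (y j)) hj
    rw [this]
    simp

theorem maxProd_smul [DecidableEq ι] {ϖ : o} (hϖ : Irreducible ϖ) (U : Finset ι) (y : ι → o) :
    maxProd E S U (fun i => ϖ * y i) =
      (∏ J ∈ E.filter (· ⊆ U), (Nat.card (ResidueField o) : ℂ) ^ (-S J)) * maxProd E S U y := by
  have h1 : ∀ J ∈ E.filter (· ⊆ U),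
      (((J.sup fun j => dvrAbs (ϖ * y j) : NNReal) : ℝ) : ℂ) ^ S J =
      (Nat.card (ResidueField o) : ℂ) ^ (- S J) *
        (((J.sup fun j => dvrAbs (y j) : NNReal) : ℝ) : ℂ) ^ S J := by
    intro J _
    have : (J.sup fun j => dvrAbs (ϖ * y j)) =
        (Nat.card (ResidueField o) : NNReal)⁻¹ * J.sup fun j => dvrAbs (y j) := by
      rw [NNReal.mul_finset_sup]
      exact Finset.sup_congr rfl fun j _ => by rw [dvrAbs_mul, dvrAbs_of_irreducible hϖ]
    rw [this, NNReal.coe_mul, Complex.ofReal_mul,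
      Complex.mul_cpow_ofReal_nonneg (NNReal.coe_nonneg _) (NNReal.coe_nonneg _)]
    congr 1
    push_cast
    -- Inverting the base of a complex power requires its argument to differ from `π`; here it is
    -- `0`.
    rw [Complex.cpow_neg, Complex.inv_cpow]
    rw [Complex.natCast_arg]
    exact Real.pi_pos.ne
  rw [maxProd, prod_congr rfl h1, prod_mul_distrib, maxProd]

variable [TopologicalSpace o] [IsTopologicalRing o] [CompactSpace o] [T2Space o]
  [MeasurableSpace o] [BorelSpace o]

theorem measurable_maxProd [DecidableEq ι] (U : Finset ι) :
    Measurable (maxProd E S U : (ι → o) → ℂ) := by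
  refine Finset.measurable_prod _ fun J hJ => ?_
  clear hJ
  refine Measurable.pow_const ?_ _
  have : Measurable fun y : ι → o => J.sup fun j => dvrAbs (y j) := by
    induction J using Finset.induction_on with
    | empty => simp
    | insert i J _ ih =>
      simp only [Finset.sup_insert]
      exact (measurable_dvrAbs.comp (measurable_pi_apply i)).sup ih
  exact Complex.measurable_ofReal.comp (measurable_coe_nnreal_real.comp this)

theorem measurable_residueInd (I : Finset ι) : Measurable (residueInd I : (ι → o) → ℂ) := by
  refine Measurable.ite ?_ measurable_const measurable_const
  simp only [Set.ofPred_forall]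
  exact Finset.measurableSet_biInter I fun i _ => measurable_pi_apply i measurableSet_maximalIdeal

end Recursion

end

/-! ### The recursion for integrals over generic forms -/

section

open MeasureTheory Finset Topology IsLocalRing

section GenericForms

variable {o : Type*} [CommRing o] {ι Ω : Type*}

open Classical in
/-- The extension by zero of a family. -/
noncomputable def extendZero (I : Finset ι) (x : I → o) (i : ι) : o :=
  if h : i ∈ I then x ⟨i, h⟩ else 0

theorem extendZero_restrict {I : Finset ι} (y : ι → o) {i : ι} (hi : i ∈ I) :
    extendZero I (fun j : I => y j) i = y i := by simp [extendZero, hi]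

theorem measurable_extendZero [MeasurableSpace o] (I : Finset ι) :
    Measurable (extendZero I : (I → o) → ι → o) := by
  refine measurable_pi_lambda _ fun i => ?_
  by_cases h : i ∈ I
  · simp only [extendZero, h, dif_pos]
    exact measurable_pi_apply _
  · simp only [extendZero, h]
    exact measurable_const

variable [IsDomain o] [IsDiscreteValuationRing o]

theorem residueInd_extendZero (I : Finset ι) (x : I → o) :
    residueInd I (extendZero I x) =
      {x : I → o | ∀ i, x i ∈ maximalIdeal o}.indicator (fun _ => (1 : ℂ)) x := by
  classical
  rw [residueInd, Set.indicator_apply]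
  refine if_congr ?_ rfl rfl
  constructor
  · intro h i
    simpa [extendZero] using h i.1 i.2
  · intro h i hi
    simpa [extendZero, hi] using h ⟨i, hi⟩

theorem residueInd_mul_residueInd [DecidableEq ι] (I J : Finset ι) (y : ι → o) :
    residueInd I y * residueInd J y = residueInd (I ∪ J) y := by
  classical
  simp only [residueInd, mem_union, or_imp, forall_and, ite_and, ite_mul, one_mul, zero_mul]

variable [TopologicalSpace o] [IsTopologicalRing o] [CompactSpace o] [T2Space o]
  [MeasurableSpace o] [BorelSpace o] [MeasurableSpace Ω]

/-- Random variables `ℓ_i` with values in a compact discrete valuation ring of which any `n` are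
independent and uniformly distributed, and linearly generate all others. -/
structure GenericForms (μ : Measure Ω) (n : ℕ) (ℓ : Ω → ι → o) : Prop where
  measurable : Measurable ℓ
  measurePreserving : ∀ I J : Finset ι, Disjoint I J → I.card + J.card ≤ n →
    MeasurePreserving (fun z => ((fun i : I => ℓ z i), (fun j : J => ℓ z j))) μ
      ((haarPi o I).prod (haarPi o J))
  span : ∀ K : Finset ι, K.card = n → ∀ j, ∃ a : ι → o, ∀ z, ℓ z j = ∑ i ∈ K, a i * ℓ z i

namespace GenericForms

variable {μ : Measure Ω} {n : ℕ} {ℓ : Ω → ι → o}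
  {E : Finset (Finset ι)} {S : Finset ι → ℂ}

theorem measurePreserving_single (h : GenericForms μ n ℓ) {I : Finset ι} (hI : I.card ≤ n) :
    MeasurePreserving (fun z (i : I) => ℓ z i) μ (haarPi o I) :=
  measurePreserving_fst.comp (h.measurePreserving I ∅ (disjoint_empty_right I) (by simpa using hI))

theorem integral_comp_restrict (h : GenericForms μ n ℓ) {I : Finset ι} (hI : I.card ≤ n)
    {g : (I → o) → ℂ} (hg : Measurable g) :
    ∫ z, g (fun i => ℓ z i) ∂μ = ∫ x, g x ∂haarPi o I := by
  have hm := h.measurePreserving_single hI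
  rw [← hm.map_eq, integral_map hm.measurable.aemeasurable hg.aestronglyMeasurable]

variable [DecidableEq ι]

/-- Up to `n` forms in all are independent, so the integral splits, and each condition in `J` has
probability `q⁻¹`. -/
theorem integral_mul_residueInd_of_le (h : GenericForms μ n ℓ) {I J : Finset ι} (hIJ : Disjoint I J)
    (hc : I.card + J.card ≤ n) :
    ∫ z, residueInd I (ℓ z) * maxProd E S I (ℓ z) * residueInd J (ℓ z) ∂μ =
      (Nat.card (ResidueField o) : ℂ)⁻¹ ^ J.card *
        ∫ z, residueInd I (ℓ z) * maxProd E S I (ℓ z) ∂μ := by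
  set g : (I → o) → ℂ := fun x => residueInd I (extendZero I x) * maxProd E S I (extendZero I x)
  set g' : (J → o) → ℂ := fun x => residueInd J (extendZero J x)
  have hg : Measurable g := ((measurable_residueInd I).comp (measurable_extendZero I)).mul
    ((measurable_maxProd I).comp (measurable_extendZero I))
  have hg' : Measurable g' := (measurable_residueInd J).comp (measurable_extendZero J)
  have e1 : ∀ z, residueInd I (ℓ z) * maxProd E S I (ℓ z) = g fun i => ℓ z i := fun z => by
    have := fun i (hi : i ∈ I) => (extendZero_restrict (ℓ z) hi).symm
    rw [residueInd_congr this, maxProd_congr this]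
  have e2 : ∀ z, residueInd J (ℓ z) = g' fun i => ℓ z i := fun z =>
    residueInd_congr fun i (hi : i ∈ J) => (extendZero_restrict (ℓ z) hi).symm
  have hm := h.measurePreserving I J hIJ hc
  simp only [e1, e2]
  rw [h.integral_comp_restrict (by omega) hg]
  have h1 : ∫ z, g (fun i => ℓ z i) * g' (fun i => ℓ z i) ∂μ =
      ∫ p, g p.1 * g' p.2 ∂((haarPi o I).prod (haarPi o J)) := by
    rw [← hm.map_eq, integral_map hm.measurable.aemeasurable]
    exact ((hg.comp measurable_fst).mul (hg'.comp measurable_snd)).aestronglyMeasurable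
  rw [h1, integral_prod_mul, mul_comm]
  congr 1
  simp only [g', residueInd_extendZero]
  rw [integral_indicator_one_haarPi, Fintype.card_coe]

/-- Any `n` forms generate all the others, so if `n` values are in the maximal ideal then all are.
-/
theorem residueInd_eq_of_card_le (h : GenericForms μ n ℓ) {I J : Finset ι}
    (hI : n ≤ I.card) (hJ : n ≤ J.card) (z : Ω) : residueInd I (ℓ z) = residueInd J (ℓ z) := by
  classical
  have key : ∀ I J : Finset ι, n ≤ I.card →
      (∀ i ∈ I, ℓ z i ∈ maximalIdeal o) → ∀ j ∈ J, ℓ z j ∈ maximalIdeal o := by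
    intro I J hI hmem j _
    obtain ⟨K, hK, hKn⟩ := exists_subset_card_eq hI
    obtain ⟨a, ha⟩ := h.span K hKn j
    rw [ha]
    exact sum_mem fun i hi => Ideal.mul_mem_left _ _ (hmem i (hK hi))
  rw [residueInd, residueInd, if_congr ⟨key I J hI, key J I hJ⟩ rfl rfl]

/-- Once `I` is imposed, only `n - |I|` further conditions are independent; these imply the
remaining ones. -/
theorem integral_mul_residueInd (h : GenericForms μ n ℓ) {I J : Finset ι} (hIJ : Disjoint I J)
    (hI : I.card ≤ n) :
    ∫ z, residueInd I (ℓ z) * maxProd E S I (ℓ z) * residueInd J (ℓ z) ∂μ =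
      (Nat.card (ResidueField o) : ℂ)⁻¹ ^ min J.card (n - I.card) *
        ∫ z, residueInd I (ℓ z) * maxProd E S I (ℓ z) ∂μ := by
  rcases le_total (I.card + J.card) n with hc | hc
  · rw [h.integral_mul_residueInd_of_le hIJ hc, min_eq_left (by omega)]
  · obtain ⟨K, hK, hKn⟩ := exists_subset_card_eq (show n - I.card ≤ J.card by omega)
    have hIK := disjoint_of_subset_right hK hIJ
    have h1 := h.integral_mul_residueInd_of_le (E := E) (S := S) hIK (by omega)
    rw [min_eq_right (by omega), ← hKn, ← h1]
    congr 1
    ext z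
    rw [mul_right_comm, mul_right_comm _ _ (residueInd K (ℓ z)), residueInd_mul_residueInd,
      residueInd_mul_residueInd, h.residueInd_eq_of_card_le]
    · rw [card_union_of_disjoint hIJ]
      exact hc
    · rw [card_union_of_disjoint hIK]
      omega

/-- Rescaling by a uniformizer maps the whole space onto the part where all forms of `U` are
nonunits. The Jacobian is the power of `q⁻¹`, and homogeneity of the maxima yields the powers `q ^
(-S J)`. -/
theorem integral_residueInd_mul_maxProd (h : GenericForms μ n ℓ) (U : Finset ι) :
    ∫ z, residueInd U (ℓ z) * maxProd E S U (ℓ z) ∂μ =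
      (Nat.card (ResidueField o) : ℂ)⁻¹ ^ min U.card n *
        (∏ J ∈ E.filter (· ⊆ U), (Nat.card (ResidueField o) : ℂ) ^ (-S J)) *
        ∫ z, maxProd E S U (ℓ z) ∂μ := by
  have := secondCountableTopology_of_compact_dvr (o := o)
  obtain ⟨ϖ, hϖ⟩ := IsDiscreteValuationRing.exists_irreducible o
  -- The forms in `K` serve as independent coordinates in terms of which all forms of `U` are
  -- linear.
  obtain ⟨K, hKU, hKn⟩ := exists_subset_card_eq (show min U.card n ≤ U.card from min_le_left _ _)
  have hspan : ∀ j ∈ U, ∃ a : ι → o, ∀ z, ℓ z j = ∑ i ∈ K, a i * ℓ z i := by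
    intro j hj
    rcases le_total U.card n with hc | hc
    · have : K = U := eq_of_subset_of_card_le hKU (by omega)
      refine ⟨Pi.single j 1, fun z => ?_⟩
      rw [sum_eq_single j]
      · simp
      · intro i _ hij
        simp [hij]
      · intro hj'
        exact absurd (this ▸ hj) hj'
    · exact h.span K (by omega) j
  have hspan' : ∃ a : ι → ι → o, ∀ j ∈ U, ∀ z, ℓ z j = ∑ i ∈ K, a j i * ℓ z i := by
    choose! a ha using hspan
    exact ⟨a, ha⟩
  obtain ⟨a, ha⟩ := hspan'
  set L : (K → o) → ι → o := fun x j => ∑ i : K, a j i * x i with hL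
  have hLm : Measurable L := measurable_pi_lambda _ fun j =>
    (continuous_finsetSum _ fun i _ => continuous_const.mul (continuous_apply i)).measurable
  have hLz : ∀ z, ∀ j ∈ U, ℓ z j = L (fun i => ℓ z i) j := by
    intro z j hj
    rw [ha j hj, hL]
    exact (sum_coe_sort K fun i => a j i * ℓ z i).symm
  have e1 : ∀ z, maxProd E S U (ℓ z) = maxProd E S U (L fun i => ℓ z i) := fun z =>
    maxProd_congr (hLz z)
  have e2 : ∀ z, residueInd U (ℓ z) = residueInd K (extendZero K fun i => ℓ z i) := by
    intro z
    rw [← residueInd_congr fun i (hi : i ∈ K) => (extendZero_restrict (ℓ z) hi).symm]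
    classical
    rw [residueInd, residueInd]
    refine if_congr ⟨fun h i hi => h i (hKU hi), fun h j hj => ?_⟩ rfl rfl
    rw [ha j hj]
    exact sum_mem fun i hi => Ideal.mul_mem_left _ _ (h i hi)
  have hm1 : Measurable fun x => maxProd E S U (L x) := (measurable_maxProd U).comp hLm
  have hm2 : Measurable fun x : K → o => residueInd K (extendZero K x) :=
    (measurable_residueInd K).comp (measurable_extendZero K)
  simp only [e1, e2]
  have hKn' : K.card ≤ n := by omega
  rw [h.integral_comp_restrict hKn' (g := fun x => maxProd E S U (L x)) hm1,
    h.integral_comp_restrict hKn' (g := fun x => residueInd K (extendZero K x) * maxProd E S U (L x))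
      (hm2.mul hm1)]
  have e3 : ∀ x : K → o, residueInd K (extendZero K x) * maxProd E S U (L x) =
      {x : K → o | ∀ i, x i ∈ maximalIdeal o}.indicator (fun x => maxProd E S U (L x)) x := by
    intro x
    rw [residueInd_extendZero]
    by_cases hx : x ∈ {x : K → o | ∀ i, x i ∈ maximalIdeal o}
    · rw [Set.indicator_of_mem hx, Set.indicator_of_mem hx, one_mul]
    · rw [Set.indicator_of_notMem hx, Set.indicator_of_notMem hx, zero_mul]
  simp only [e3]
  have e4 : ∀ x : K → o, maxProd E S U (L (ϖ • x)) =
      (∏ J ∈ E.filter (· ⊆ U), (Nat.card (ResidueField o) : ℂ) ^ (-S J)) * maxProd E S U (L x) := by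
    intro x
    rw [← maxProd_smul hϖ]
    congr 1
    ext j
    simp only [hL, Pi.smul_apply, smul_eq_mul, mul_sum]
    exact sum_congr rfl fun i _ => by ring
  rw [integral_indicator_haarPi hϖ, Fintype.card_coe, hKn]
  simp only [e4]
  rw [integral_const_mul, mul_assoc]

theorem integrable_residueInd_mul_maxProd [IsProbabilityMeasure μ] (h : GenericForms μ n ℓ)
    (hS : ∀ J ∈ E, 0 < (S J).re)
    (I J U : Finset ι) :
    Integrable (fun z => residueInd I (ℓ z) * maxProd E S U (ℓ z) * residueInd J (ℓ z)) μ := by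
  refine Integrable.of_bound (C := 1) ?_ ?_
  · exact ((((measurable_residueInd I).comp h.measurable).mul
      ((measurable_maxProd U).comp h.measurable)).mul
      ((measurable_residueInd J).comp h.measurable)).aestronglyMeasurable
  · refine Filter.Eventually.of_forall fun z => ?_
    rw [norm_mul, norm_mul]
    exact mul_le_one₀ (mul_le_one₀ (norm_residueInd_le_one I _) (norm_nonneg _)
      (norm_maxProd_le_one hS U _)) (norm_nonneg _) (norm_residueInd_le_one J _)

/-- Let `Z` be the set of forms of `U` whose value at `z` is a nonunit. The sum over `K` is
inclusion-exclusion for the condition `Z = I`, under which the product over `U` reduces to that over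
`I`; the first term covers `Z = U`. -/
theorem maxProd_eq_sum (h : GenericForms μ n ℓ) (U : Finset ι) (z : Ω) :
    maxProd E S U (ℓ z) = residueInd U (ℓ z) * maxProd E S U (ℓ z) +
      ∑ I ∈ U.powerset.filter (fun I => I ≠ U ∧ I.card < n), ∑ K ∈ (U \ I).powerset,
        (-1 : ℂ) ^ K.card * (residueInd I (ℓ z) * maxProd E S I (ℓ z) * residueInd K (ℓ z)) := by
  classical
  set Z := U.filter fun i => ℓ z i ∈ maximalIdeal o with hZ
  have hind : ∀ I ⊆ U, residueInd I (ℓ z) = if I ⊆ Z then 1 else 0 := by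
    intro I hI
    rw [residueInd]
    refine if_congr ?_ rfl rfl
    simp only [hZ, subset_iff, mem_filter]
    exact forall₂_congr fun i hi => by simp [hI hi]
  have hinner : ∀ I ∈ U.powerset.filter (fun I => I ≠ U ∧ I.card < n),
      ∑ K ∈ (U \ I).powerset,
        (-1 : ℂ) ^ K.card * (residueInd I (ℓ z) * maxProd E S I (ℓ z) * residueInd K (ℓ z)) =
      if I = Z then maxProd E S U (ℓ z) else 0 := by
    intro I hI
    rw [mem_filter, mem_powerset] at hI
    rw [hind I hI.1]
    by_cases hIZ : I ⊆ Z
    · have h1 : ∀ K ∈ (U \ I).powerset, (-1 : ℂ) ^ K.card *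
          ((if I ⊆ Z then 1 else 0) * maxProd E S I (ℓ z) * residueInd K (ℓ z)) =
          maxProd E S I (ℓ z) * if K ∈ (Z \ I).powerset then (-1 : ℂ) ^ K.card else 0 := by
        intro K hK
        rw [mem_powerset] at hK
        rw [if_pos hIZ, hind K (hK.trans sdiff_subset), one_mul]
        have : K ⊆ Z ↔ K ∈ (Z \ I).powerset := by
          rw [mem_powerset, subset_sdiff]
          exact ⟨fun hh => ⟨hh, (subset_sdiff.1 hK).2⟩, fun hh => hh.1⟩
        rw [if_congr this rfl rfl]
        split_ifs <;> ring
      have hZU : Z ⊆ U := filter_subset _ _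
      rw [sum_congr rfl h1, ← mul_sum, sum_ite_mem, inter_eq_right.2
        (powerset_mono.2 (sdiff_subset_sdiff hZU subset_rfl))]
      have h2 := congrArg (Int.cast : ℤ → ℂ) (sum_powerset_neg_one_pow_card (x := Z \ I))
      push_cast at h2
      rw [h2]
      by_cases he : I = Z
      · rw [if_pos he, if_pos (by rw [he, sdiff_self]; rfl), mul_one]
        refine (maxProd_eq_of_forall_notMem hI.1 fun i hi hiI => ?_).symm
        rw [he, hZ, mem_filter] at hiI
        exact fun hm => hiI ⟨hi, hm⟩
      · rw [if_neg he, if_neg, mul_zero]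
        rw [sdiff_eq_empty_iff_subset]
        exact fun hh => he (subset_antisymm hIZ hh)
    · have hne : I ≠ Z := fun hh => hIZ (Finset.subset_of_eq hh)
      simp [hIZ, hne]
  rw [sum_congr rfl hinner, sum_ite_eq', hind U subset_rfl]
  have hZU : Z ⊆ U := filter_subset _ _
  by_cases hU : U ⊆ Z
  · have : Z = U := subset_antisymm hZU hU
    simp [this]
  · have hZn : Z ≠ U := fun hh => hU hh.ge
    -- With `n` nonunits all forms are nonunits, so a proper `Z` is small and occurs in the sum.
    have hcard : Z.card < n := by
      by_contra hc
      have h1 := h.residueInd_eq_of_card_le (I := Z) (J := U) (by omega)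
        (by have := card_le_card hZU; omega) z
      rw [hind Z hZU, hind U subset_rfl, if_pos subset_rfl, if_neg hU] at h1
      exact one_ne_zero h1
    rw [if_neg hU, if_pos (mem_filter.2 ⟨mem_powerset.2 hZU, hZn, hcard⟩)]
    ring

/-- The recursion for the integrals over the points whose values at the forms in `U` are in the
maximal ideal. -/
theorem integral_maxProd [IsProbabilityMeasure μ] (h : GenericForms μ n ℓ)
    (hS : ∀ J ∈ E, 0 < (S J).re) (U : Finset ι) :
    ∫ z, maxProd E S U (ℓ z) ∂μ = ∫ z, residueInd U (ℓ z) * maxProd E S U (ℓ z) ∂μ +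
      (1 - (Nat.card (ResidueField o) : ℂ)⁻¹) *
        ∑ I ∈ U.powerset.filter (fun I => I ≠ U ∧ I.card < n),
          (∑ j ∈ range (n - I.card), (-1 : ℂ) ^ j * ((U.card - I.card - 1).choose j : ℂ) *
            (Nat.card (ResidueField o) : ℂ)⁻¹ ^ j) *
          ∫ z, residueInd I (ℓ z) * maxProd E S I (ℓ z) ∂μ := by
  rw [integral_congr_ae (Filter.Eventually.of_forall fun z => h.maxProd_eq_sum U z), integral_add,
    integral_finsetSum]
  · congr 1
    rw [mul_sum]
    refine sum_congr rfl fun I hI => ?_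
    rw [mem_filter, mem_powerset] at hI
    rw [integral_finsetSum]
    · have h1 : ∀ K ∈ (U \ I).powerset, ∫ z, (-1 : ℂ) ^ K.card *
          (residueInd I (ℓ z) * maxProd E S I (ℓ z) * residueInd K (ℓ z)) ∂μ =
          ((-1 : ℂ) ^ K.card * (Nat.card (ResidueField o) : ℂ)⁻¹ ^ min K.card (n - I.card)) *
            ∫ z, residueInd I (ℓ z) * maxProd E S I (ℓ z) ∂μ := by
        intro K hK
        rw [mem_powerset, subset_sdiff] at hK
        rw [integral_const_mul, h.integral_mul_residueInd hK.2.symm hI.2.2.le, mul_assoc]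
      rw [sum_congr rfl h1, ← sum_mul, sum_powerset_neg_one_pow_mul_pow_min, card_sdiff_of_subset hI.1,
        mul_assoc]
      rw [Ne, sdiff_eq_empty_iff_subset]
      exact fun hh => hI.2.1 (subset_antisymm hI.1 hh)
    · exact fun K _ => (h.integrable_residueInd_mul_maxProd hS I K I).const_mul _
  · exact fun I _ => integrable_finsetSum _ fun K _ =>
      (h.integrable_residueInd_mul_maxProd hS I K I).const_mul _
  · simpa [residueInd] using h.integrable_residueInd_mul_maxProd hS U ∅ U
  · exact integrable_finsetSum _ fun I _ => integrable_finsetSum _ fun K _ =>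
      (h.integrable_residueInd_mul_maxProd hS I K I).const_mul _

end GenericForms

end GenericForms

end

/-! ### Complete chains and the limit as `q` tends to `1` -/

section

open Finset

section CompleteChains

variable {α k : Type*}

theorem card_injOn_of_isChain {C : Finset (Finset α)} (hC : IsChain (· ⊆ ·) (C : Set (Finset α))) :
    Set.InjOn Finset.card (C : Set (Finset α)) := by
  intro I hI J hJ h
  rcases hC.total hI hJ with hIJ | hIJ
  · exact eq_of_subset_of_card_le hIJ h.ge
  · exact (eq_of_subset_of_card_le hIJ h.le).symm

variable [DecidableEq α] [Field k]

theorem card_le_card_of_mem_weakOrderChains {I : Finset α} {C : Finset (Finset α)}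
    (hC : C ∈ weakOrderChains I) : C.card ≤ I.card := by
  rw [mem_weakOrderChains] at hC
  have h : C.image Finset.card ⊆ Icc 1 I.card := by
    intro a ha
    obtain ⟨J, hJ, rfl⟩ := mem_image.1 ha
    exact mem_Icc.2 ⟨card_pos.2 (nonempty_iff_ne_empty.2 (hC.1 J hJ).1), card_le_card (hC.1 J hJ).2⟩
  have := card_le_card h
  rwa [card_image_of_injOn (card_injOn_of_isChain hC.2), Nat.card_Icc, Nat.add_sub_cancel] at this

theorem mem_weakOrderChains_sup {I : Finset α} {C : Finset (Finset α)}
    (hC : C ∈ weakOrderChains I) : C ∈ weakOrderChains (C.sup id) := by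
  rw [mem_weakOrderChains] at hC ⊢
  exact ⟨fun J hJ => ⟨(hC.1 J hJ).1, Finset.le_sup (f := id) hJ⟩, hC.2⟩

theorem sup_subset_of_mem_weakOrderChains {I : Finset α} {C : Finset (Finset α)}
    (hC : C ∈ weakOrderChains I) : C.sup id ⊆ I :=
  Finset.sup_le fun J hJ => ((mem_weakOrderChains.1 hC).1 J hJ).2

theorem sup_mem_of_mem_weakOrderChains {I : Finset α} {C : Finset (Finset α)}
    (hC : C ∈ weakOrderChains I) (hne : C.Nonempty) : C.sup id ∈ C := by
  obtain ⟨J, hJ, hmax⟩ := IsChain.exists_isGreatest (s := C) (mem_weakOrderChains.1 hC).2 hne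
  have : C.sup id = J := le_antisymm (Finset.sup_le hmax) (Finset.le_sup (f := id) hJ)
  rwa [this]

/-- A chain has at most as many members as its supremum has elements, so `|I|` members force the
supremum to be `I`. -/
theorem sup_eq_of_card_eq {I : Finset α} {C : Finset (Finset α)}
    (hC : C ∈ weakOrderChains I) (h : C.card = I.card) : C.sup id = I :=
  eq_of_subset_of_card_le (sup_subset_of_mem_weakOrderChains hC) (by
    rw [← h]
    exact card_le_card_of_mem_weakOrderChains (mem_weakOrderChains_sup hC))

/-- The sum over the complete chains of nonempty subsets of `I` of products of weights. -/
noncomputable def completeChainSum (w : Finset α → k) (I : Finset α) : k :=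
  ∑ C ∈ (weakOrderChains I).filter (fun C => C.card = I.card), ∏ J ∈ C, w J

theorem completeChainSum_empty (w : Finset α → k) : completeChainSum w ∅ = 1 := by
  have : (weakOrderChains (∅ : Finset α)).filter (fun C => C.card = (∅ : Finset α).card) = {∅} := by
    ext C
    simp only [mem_filter, card_empty, card_eq_zero, mem_singleton, and_iff_right_iff_imp]
    rintro rfl
    simp [mem_weakOrderChains]
  rw [completeChainSum, this]
  simp

/-- A complete chain contains `I`, and without it is a complete chain in a set `J` with one element
less. This is the recursion to which that of the integrals degenerates. -/
theorem completeChainSum_eq (w : Finset α → k) {I : Finset α} (hI : I ≠ ∅) :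
    completeChainSum w I =
      w I * ∑ J ∈ I.powerset.filter (fun J => J.card + 1 = I.card), completeChainSum w J := by
  have hIc := card_pos.2 (nonempty_iff_ne_empty.2 hI)
  have hmem : ∀ C ∈ (weakOrderChains I).filter (fun C => C.card = I.card),
      I ∈ C ∧ C.erase I ∈ weakOrderChains I ∧ (C.erase I).sup id ⊆ I ∧
        ((C.erase I).sup id).card + 1 = I.card ∧ (C.erase I).card + 1 = I.card := by
    intro C hC
    obtain ⟨hC, hc⟩ := mem_filter.1 hC
    have hsup := sup_eq_of_card_eq hC hc
    have hIC : I ∈ C := by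
      have := sup_mem_of_mem_weakOrderChains hC (card_pos.1 (by omega))
      rwa [hsup] at this
    have hE : C.erase I ∈ weakOrderChains I := by
      rw [mem_weakOrderChains] at hC ⊢
      exact ⟨fun J hJ => hC.1 J (mem_of_mem_erase hJ),
        hC.2.mono (by exact_mod_cast erase_subset _ _)⟩
    have hEs := sup_subset_of_mem_weakOrderChains hE
    have hEc : (C.erase I).card + 1 = I.card := by rw [card_erase_add_one hIC, hc]
    refine ⟨hIC, hE, hEs, ?_, hEc⟩
    have h1 := card_le_card_of_mem_weakOrderChains (mem_weakOrderChains_sup hE)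
    have h2 : (C.erase I).sup id ≠ I := by
      intro h
      rcases (C.erase I).eq_empty_or_nonempty with h0 | h0
      · rw [h0] at h
        exact hI h.symm
      · have := sup_mem_of_mem_weakOrderChains hE h0
        rw [h] at this
        exact notMem_erase _ _ this
    have h3 := card_lt_card (ssubset_of_subset_of_ne hEs h2)
    omega
  rw [completeChainSum, ← sum_fiberwise_of_maps_to (g := fun C => (C.erase I).sup id)
    (t := I.powerset.filter fun J => J.card + 1 = I.card), mul_sum]
  · refine sum_congr rfl fun J hJ => ?_
    rw [mem_filter, mem_powerset] at hJ
    have hIJ : ∀ C ∈ weakOrderChains J, I ∉ C := fun C hC h => by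
      have := card_le_card ((mem_weakOrderChains.1 hC).1 I h).2
      omega
    rw [completeChainSum, mul_sum]
    refine sum_bij' (fun C _ => C.erase I) (fun C _ => insert I C) ?_ ?_ ?_ ?_ ?_
    · intro C hC
      rw [mem_filter] at hC
      obtain ⟨hIC, hE, -, h1, h2⟩ := hmem C hC.1
      refine mem_filter.2 ⟨?_, by omega⟩
      have := mem_weakOrderChains_sup hE
      rwa [hC.2] at this
    · intro C hC
      rw [mem_filter] at hC
      have hC' := mem_weakOrderChains.1 hC.1
      refine mem_filter.2 ⟨mem_filter.2 ⟨mem_weakOrderChains.2 ⟨fun K hK => ?_, ?_⟩, ?_⟩, ?_⟩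
      · rcases mem_insert.1 hK with rfl | hK
        · exact ⟨hI, subset_rfl⟩
        · exact ⟨(hC'.1 K hK).1, (hC'.1 K hK).2.trans hJ.1⟩
      · rw [coe_insert]
        exact hC'.2.insert fun K hK _ => Or.inr ((hC'.1 K hK).2.trans hJ.1)
      · rw [card_insert_of_notMem (hIJ C hC.1), hC.2, hJ.2]
      · rw [erase_insert (hIJ C hC.1)]
        exact sup_eq_of_card_eq hC.1 hC.2
    · intro C hC
      exact insert_erase (hmem C (mem_filter.1 hC).1).1
    · intro C hC
      exact erase_insert (hIJ C (mem_filter.1 hC).1)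
    · intro C hC
      exact (mul_prod_erase C w (hmem C (mem_filter.1 hC).1).1).symm
  · intro C hC
    obtain ⟨-, -, h1, h2, -⟩ := hmem C hC
    exact mem_filter.2 ⟨mem_powerset.2 h1, h2⟩

end CompleteChains

/-- The range covers the whole binomial row, whose alternating sum is `(1 - 1) ^ N`. -/
theorem sum_range_neg_one_pow_mul_choose {k : Type*} [Field k] {N r : ℕ} (h : N < r) :
    ∑ j ∈ range r, (-1 : k) ^ j * (N.choose j : k) = if N = 0 then 1 else 0 := by
  have h1 : ∑ j ∈ range r, (-1 : k) ^ j * (N.choose j : k) =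
      ∑ j ∈ range (N + 1), (-1 : k) ^ j * (N.choose j : k) := by
    symm
    refine sum_subset (range_mono h) fun j _ hj => ?_
    rw [Nat.choose_eq_zero_of_lt (by simpa using hj)]
    simp
  rw [h1]
  have := congrArg (Int.cast : ℤ → k) (Int.alternating_sum_range_choose (n := N))
  push_cast at this
  exact this

namespace HyperplaneArrangement

variable {F V : Type*} [Field F] [AddCommGroup V] [Module F V] (A : HyperplaneArrangement F V)

/-- The substitution `expand`, as a ring homomorphism. -/
noncomputable def expandHom : MvPolynomial (Option A.PosFlat) ℚ →+* PowerSeries A.RatFun :=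
  MvPolynomial.eval₂Hom (algebraMap ℚ (PowerSeries A.RatFun))
    (fun i => i.elim (-qPow (-1)) fun x => qPow (-A.var x))

/-- The evaluation `evalAt`, as a ring homomorphism. -/
noncomputable def evalAtHom (q : ℕ) (s : A.PosFlat → ℂ) : MvPolynomial (Option A.PosFlat) ℚ →+* ℂ :=
  MvPolynomial.eval₂Hom (algebraMap ℚ ℂ)
    (fun i => i.elim (-(q : ℂ)⁻¹) fun x => (q : ℂ) ^ (-s x))

theorem expand_eq (W : MvPolynomial (Option A.PosFlat) ℚ) : A.expand W = A.expandHom W := rfl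

theorem evalAt_eq (W : MvPolynomial (Option A.PosFlat) ℚ) (q : ℕ) (s : A.PosFlat → ℂ) :
    A.evalAt W q s = A.evalAtHom q s W := rfl

theorem expandHom_X_none : A.expandHom (MvPolynomial.X none) = -qPow (-1) := by
  simp [expandHom]

theorem expandHom_X_some (x : A.PosFlat) :
    A.expandHom (MvPolynomial.X (some x)) = qPow (-A.var x) := by
  simp [expandHom]

theorem evalAtHom_X_none (q : ℕ) (s : A.PosFlat → ℂ) :
    A.evalAtHom q s (MvPolynomial.X none) = -(q : ℂ)⁻¹ := by
  simp [evalAtHom]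

theorem evalAtHom_X_some (q : ℕ) (s : A.PosFlat → ℂ) (x : A.PosFlat) :
    A.evalAtHom q s (MvPolynomial.X (some x)) = (q : ℂ) ^ (-s x) := by
  simp [evalAtHom]

/-- The function `g(q, s)` is given by a rational function in `Y = -q⁻¹` and `T_x = q ^ (-s_x)`
whose expansion is the power series `z`. -/
def HasExpansion (g : ℕ → (A.PosFlat → ℂ) → ℂ) (z : PowerSeries A.RatFun) : Prop :=
  ∃ P D : MvPolynomial (Option A.PosFlat) ℚ, A.expand D ≠ 0 ∧ z * A.expand D = A.expand P ∧
    ∀ (q : ℕ) (s : A.PosFlat → ℂ), 2 ≤ q → (∀ x, 0 < (s x).re) →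
      A.evalAt D q s * g q s = A.evalAt P q s

namespace HasExpansion

variable {A} {g g' : ℕ → (A.PosFlat → ℂ) → ℂ} {z z' : PowerSeries A.RatFun}

theorem of_poly (W : MvPolynomial (Option A.PosFlat) ℚ) :
    A.HasExpansion (fun q s => A.evalAtHom q s W) (A.expandHom W) :=
  ⟨W, 1, by simp [expand_eq], by simp [expand_eq], fun q s _ _ => by simp [evalAt_eq]⟩

theorem add (h : A.HasExpansion g z) (h' : A.HasExpansion g' z') :
    A.HasExpansion (fun q s => g q s + g' q s) (z + z') := by
  obtain ⟨P, D, h1, h2, h3⟩ := h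
  obtain ⟨P', D', h1', h2', h3'⟩ := h'
  refine ⟨P * D' + P' * D, D * D', ?_, ?_, fun q s hq hs => ?_⟩ <;>
  simp only [expand_eq, evalAt_eq, map_add, map_mul] at *
  · exact mul_ne_zero h1 h1'
  · rw [← h2, ← h2']
    ring
  · rw [← h3 q s hq hs, ← h3' q s hq hs]
    ring

theorem mul (h : A.HasExpansion g z) (h' : A.HasExpansion g' z') :
    A.HasExpansion (fun q s => g q s * g' q s) (z * z') := by
  obtain ⟨P, D, h1, h2, h3⟩ := h
  obtain ⟨P', D', h1', h2', h3'⟩ := h'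
  refine ⟨P * P', D * D', ?_, ?_, fun q s hq hs => ?_⟩ <;>
  simp only [expand_eq, evalAt_eq, map_mul] at *
  · exact mul_ne_zero h1 h1'
  · rw [← h2, ← h2']
    ring
  · rw [← h3 q s hq hs, ← h3' q s hq hs]
    ring

theorem sum {κ : Type*} (T : Finset κ) {g : κ → ℕ → (A.PosFlat → ℂ) → ℂ}
    {z : κ → PowerSeries A.RatFun} (h : ∀ i ∈ T, A.HasExpansion (g i) (z i)) :
    A.HasExpansion (fun q s => ∑ i ∈ T, g i q s) (∑ i ∈ T, z i) := by
  classical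
  induction T using Finset.induction_on with
  | empty => simpa using of_poly (A := A) 0
  | insert i T hi ih =>
    simp only [sum_insert hi]
    exact (h i (mem_insert_self _ _)).add (ih fun j hj => h j (mem_insert_of_mem hj))

end HasExpansion

section Monomials

variable {κ : Type*} (r : ℕ) (T : Finset κ) (v : κ → A.PosFlat)

/-- The monomial with value `q ^ (-r - ∑ s_x)`. -/
noncomputable def zetaMonomial : MvPolynomial (Option A.PosFlat) ℚ :=
  (-MvPolynomial.X none) ^ r * ∏ i ∈ T, MvPolynomial.X (some (v i))

theorem evalAtHom_zetaMonomial (q : ℕ) (s : A.PosFlat → ℂ) :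
    A.evalAtHom q s (A.zetaMonomial r T v) = (q : ℂ)⁻¹ ^ r * ∏ i ∈ T, (q : ℂ) ^ (-s (v i)) := by
  simp [zetaMonomial, evalAtHom_X_none, evalAtHom_X_some]

theorem constantCoeff_qPow {k : Type*} [Field k] (a : k) :
    PowerSeries.constantCoeff (qPow a) = 1 := by
  rw [← PowerSeries.coeff_zero_eq_constantCoeff_apply, qPow, PowerSeries.coeff_mk]
  simp

theorem coeff_one_qPow {k : Type*} [Field k] (a : k) : PowerSeries.coeff 1 (qPow a) = a := by
  simp [qPow]

theorem coeff_one_mul_of_constantCoeff {k : Type*} [Field k] {f g : PowerSeries k}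
    (hf : PowerSeries.constantCoeff f = 1) (hg : PowerSeries.constantCoeff g = 1) :
    PowerSeries.coeff 1 (f * g) = PowerSeries.coeff 1 f + PowerSeries.coeff 1 g := by
  rw [PowerSeries.coeff_mul, Nat.antidiagonal_succ]
  simp [hf, hg, add_comm]

/-- To first order `Q ^ a = 1 + a (Q - 1)`, and first-order terms add under multiplication. -/
theorem expandHom_zetaMonomial :
    PowerSeries.constantCoeff (A.expandHom (A.zetaMonomial r T v)) = 1 ∧
    PowerSeries.coeff 1 (A.expandHom (A.zetaMonomial r T v)) =
      -((r : A.RatFun) + ∑ i ∈ T, A.var (v i)) := by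
  classical
  have h1 : PowerSeries.constantCoeff ((qPow (-1) : PowerSeries A.RatFun) ^ r) = 1 ∧
      PowerSeries.coeff 1 ((qPow (-1) : PowerSeries A.RatFun) ^ r) = -(r : A.RatFun) := by
    induction r with
    | zero => simp [PowerSeries.coeff_one]
    | succ r ih =>
      constructor
      · rw [pow_succ, map_mul, ih.1, constantCoeff_qPow, one_mul]
      · rw [pow_succ, coeff_one_mul_of_constantCoeff ih.1 (constantCoeff_qPow _), ih.2,
          coeff_one_qPow]
        push_cast
        ring
  have h2 : PowerSeries.constantCoeff (∏ i ∈ T, qPow (-A.var (v i))) = 1 ∧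
      PowerSeries.coeff 1 (∏ i ∈ T, qPow (-A.var (v i))) = -∑ i ∈ T, A.var (v i) := by
    induction T using Finset.induction_on with
    | empty => simp [PowerSeries.coeff_one]
    | insert i T hi ih =>
      rw [prod_insert hi, sum_insert hi]
      constructor
      · rw [map_mul, ih.1, constantCoeff_qPow, one_mul]
      · rw [coeff_one_mul_of_constantCoeff (constantCoeff_qPow _) ih.1, ih.2, coeff_one_qPow]
        ring
  have h3 : A.expandHom (A.zetaMonomial r T v) = qPow (-1) ^ r * ∏ i ∈ T, qPow (-A.var (v i)) := by
    simp [zetaMonomial, expandHom_X_none, expandHom_X_some]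
  rw [h3]
  constructor
  · rw [map_mul, h1.1, h2.1, one_mul]
  · rw [coeff_one_mul_of_constantCoeff h1.1 h2.1, h1.2, h2.2]
    ring

theorem natCast_add_sum_var_ne_zero (hr : 1 ≤ r) : (r : A.RatFun) + ∑ i ∈ T, A.var (v i) ≠ 0 := by
  intro h
  have h1 : (r : A.RatFun) + ∑ i ∈ T, A.var (v i) =
      algebraMap (MvPolynomial A.PosFlat ℚ) A.RatFun
        ((r : MvPolynomial A.PosFlat ℚ) + ∑ i ∈ T, MvPolynomial.X (v i)) := by
    simp [var]
  rw [h1] at h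
  have h2 := (map_eq_zero_iff _ (IsFractionRing.injective (MvPolynomial A.PosFlat ℚ) A.RatFun)).1 h
  have h3 := congrArg (MvPolynomial.eval 0) h2
  simp at h3
  omega

/-- This keeps the denominators `1 - t` nonzero wherever the integrals are evaluated. -/
theorem norm_evalAtHom_zetaMonomial_lt_one (hr : 1 ≤ r) {q : ℕ} {s : A.PosFlat → ℂ} (hq : 2 ≤ q)
    (hs : ∀ x, 0 < (s x).re) : ‖A.evalAtHom q s (A.zetaMonomial r T v)‖ < 1 := by
  have hq0 : (0 : ℝ) < q := by exact_mod_cast (by omega : 0 < q)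
  have hq1 : (1 : ℝ) < q := by exact_mod_cast (by omega : 1 < q)
  rw [evalAtHom_zetaMonomial, norm_mul, norm_pow, norm_inv, Complex.norm_natCast, norm_prod]
  refine mul_lt_one_of_nonneg_of_lt_one_left (by positivity)
    (pow_lt_one₀ (by positivity) (inv_lt_one_of_one_lt₀ hq1) (by omega))
    (prod_le_one (fun _ _ => norm_nonneg _) fun i _ => ?_)
  rw [Complex.norm_natCast_cpow_of_pos (by omega)]
  exact Real.rpow_le_one_of_one_le_of_nonpos hq1.le (by simpa using (hs _).le)

/-- The factor `(1 - q⁻¹) / (1 - t)` for a monomial `t` has a limit as `q` tends to `1`. -/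
theorem exists_hasExpansion_div (hr : 1 ≤ r) :
    ∃ z, A.HasExpansion (fun q s => (1 - (q : ℂ)⁻¹) /
      (1 - A.evalAtHom q s (A.zetaMonomial r T v))) z ∧
      PowerSeries.constantCoeff z = ((r : A.RatFun) + ∑ i ∈ T, A.var (v i))⁻¹ := by
  obtain ⟨h1, h2⟩ := A.expandHom_zetaMonomial r T v
  have hw := A.natCast_add_sum_var_ne_zero r T v hr
  set w := (r : A.RatFun) + ∑ i ∈ T, A.var (v i)
  -- Both `1 - t` and `1 - Q⁻¹` are divisible by `Q - 1`, with cofactors `a` and `b` of constant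
  -- terms `w` and `1`; their quotient has constant term `w⁻¹`.
  obtain ⟨a, ha⟩ := PowerSeries.X_dvd_iff.2
    (show PowerSeries.constantCoeff (1 - A.expandHom (A.zetaMonomial r T v)) = 0 by simp [h1])
  obtain ⟨b, hb⟩ := PowerSeries.X_dvd_iff.2
    (show PowerSeries.constantCoeff (1 - (qPow (-1) : PowerSeries A.RatFun)) = 0 by
      simp [constantCoeff_qPow])
  have ha0 : PowerSeries.constantCoeff a = w := by
    have := congrArg (PowerSeries.coeff 1) ha
    rw [← pow_one (PowerSeries.X : PowerSeries A.RatFun), PowerSeries.coeff_X_pow_mul'] at this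
    simpa [h2, PowerSeries.coeff_one] using this.symm
  have hb0 : PowerSeries.constantCoeff b = 1 := by
    have := congrArg (PowerSeries.coeff 1) hb
    rw [← pow_one (PowerSeries.X : PowerSeries A.RatFun), PowerSeries.coeff_X_pow_mul'] at this
    simpa [coeff_one_qPow, PowerSeries.coeff_one] using this.symm
  have ha1 : a⁻¹ * a = 1 := PowerSeries.inv_mul_cancel a (by rw [ha0]; exact hw)
  refine ⟨b * a⁻¹, ⟨1 + MvPolynomial.X none, 1 - A.zetaMonomial r T v, ?_, ?_, ?_⟩, ?_⟩
  · rw [expand_eq, map_sub, map_one, ha]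
    refine mul_ne_zero PowerSeries.X_ne_zero ?_
    rintro rfl
    exact hw (by rw [← ha0, map_zero])
  · rw [expand_eq, expand_eq, map_sub, map_one, ha, map_add, map_one, expandHom_X_none,
      ← sub_eq_add_neg, hb]
    linear_combination (b * PowerSeries.X) * ha1
  · intro q s hq hs
    have hne : 1 - A.evalAtHom q s (A.zetaMonomial r T v) ≠ 0 := by
      intro h
      have h3 := A.norm_evalAtHom_zetaMonomial_lt_one r T v hr hq hs
      rw [← sub_eq_zero.1 h] at h3
      simp at h3
    rw [evalAt_eq, evalAt_eq, map_sub, map_one, map_add, map_one, evalAtHom_X_none]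
    field_simp
    ring
  · rw [map_mul, hb0, PowerSeries.constantCoeff_inv, ha0, one_mul]

end Monomials

end HyperplaneArrangement

end

/-! ### Solving the recursion by rational functions -/

section

open Finset

namespace HyperplaneArrangement

variable {F V : Type*} [Field F] [AddCommGroup V] [Module F V] (A : HyperplaneArrangement F V)
  {ι : Type*} (n : ℕ) (E : Finset (Finset ι)) (v : Finset ι → A.PosFlat)

/-- The coefficients of the recursion for the zeta functions, as polynomials. -/
noncomputable def recursionPoly (U I : Finset ι) : MvPolynomial (Option A.PosFlat) ℚ :=
  ∑ j ∈ range (n - I.card), (-1) ^ j *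
    ((U.card - I.card - 1).choose j : MvPolynomial (Option A.PosFlat) ℚ) * (-MvPolynomial.X none) ^ j

theorem evalAtHom_recursionPoly (q : ℕ) (s : A.PosFlat → ℂ) (U I : Finset ι) :
    A.evalAtHom q s (A.recursionPoly n U I) = ∑ j ∈ range (n - I.card),
      (-1 : ℂ) ^ j * ((U.card - I.card - 1).choose j : ℂ) * (q : ℂ)⁻¹ ^ j := by
  simp [recursionPoly, evalAtHom_X_none]

theorem constantCoeff_recursionPoly (U I : Finset ι) :
    PowerSeries.constantCoeff (A.expandHom (A.recursionPoly n U I)) = ∑ j ∈ range (n - I.card),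
      (-1 : A.RatFun) ^ j * ((U.card - I.card - 1).choose j : A.RatFun) := by
  simp [recursionPoly, expandHom_X_none, constantCoeff_qPow]

variable [DecidableEq ι]

/-- The recursion satisfied by the integrals `G U` over the points whose values at the forms in `U`
are in the maximal ideal. -/
def IsRecursionSolution (q : ℕ) (s : A.PosFlat → ℂ) (G : Finset ι → ℂ) : Prop :=
  G ∅ = 1 ∧ ∀ U : Finset ι, G U =
    A.evalAtHom q s (A.zetaMonomial (min U.card n) (E.filter (· ⊆ U)) v) *
      (G U + (1 - (q : ℂ)⁻¹) * ∑ I ∈ U.powerset.filter (fun I => I ≠ U ∧ I.card < n),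
        A.evalAtHom q s (A.recursionPoly n U I) * G I)

/-- The weight of a set of hyperplanes in the topological zeta function. -/
noncomputable def topWeight (U : Finset ι) : A.RatFun :=
  ((U.card : A.RatFun) + ∑ J ∈ E.filter (· ⊆ U), A.var (v J))⁻¹

/-- Solving for `G U` gives `t (1 - q⁻¹) / (1 - t)` times a sum over proper subsets. In the limit
`t` becomes `1` and the quotient the weight of `U`. Because `|U| < n`, the coefficients are
alternating sums of full binomial rows, so only subsets with one element less survive. -/
theorem exists_hasExpansion_of_recursion (U : Finset ι) (hU : U.card < n) :
    ∃ g z, A.HasExpansion g z ∧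
      PowerSeries.constantCoeff z = completeChainSum (A.topWeight E v) U ∧
      ∀ (q : ℕ) (s : A.PosFlat → ℂ), 2 ≤ q → (∀ x, 0 < (s x).re) →
        ∀ G, A.IsRecursionSolution n E v q s G → G U = g q s := by
  induction U using Finset.strongInduction with
  | H U ih =>
  rcases U.eq_empty_or_nonempty with rfl | hne
  · refine ⟨fun _ _ => 1, 1, ?_, ?_, fun q s _ _ G hG => hG.1⟩
    · simpa using HasExpansion.of_poly (A := A) 1
    · rw [map_one, completeChainSum_empty]
  · have hU1 := card_pos.2 hne
    -- Making the existence unconditional, with dummy values elsewhere, allows `g` and `z` to be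
    -- chosen as functions of `I`.
    have ih' : ∀ I, ∃ g z, I ⊂ U → A.HasExpansion g z ∧
        PowerSeries.constantCoeff z = completeChainSum (A.topWeight E v) I ∧
        ∀ (q : ℕ) (s : A.PosFlat → ℂ), 2 ≤ q → (∀ x, 0 < (s x).re) →
        ∀ G, A.IsRecursionSolution n E v q s G → G I = g q s := by
      intro I
      by_cases hI : I ⊂ U
      · obtain ⟨g, z, h⟩ := ih I hI ((card_lt_card hI).trans hU)
        exact ⟨g, z, fun _ => h⟩
      · exact ⟨fun _ _ => 0, 0, fun h => absurd h hI⟩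
    choose g z hgz using ih'
    have hss : ∀ I ∈ U.powerset.filter (fun I => I ≠ U ∧ I.card < n), I ⊂ U := by
      intro I hI
      rw [mem_filter, mem_powerset] at hI
      exact ssubset_of_subset_of_ne hI.1 hI.2.1
    set t := A.zetaMonomial (min U.card n) (E.filter (· ⊆ U)) v with ht
    obtain ⟨y, hy, hy0⟩ := A.exists_hasExpansion_div (min U.card n) (E.filter (· ⊆ U)) v (by omega)
    have hS := HasExpansion.sum (U.powerset.filter (fun I => I ≠ U ∧ I.card < n)) fun I hI =>
      (HasExpansion.of_poly (A := A) (A.recursionPoly n U I)).mul (hgz I (hss I hI)).1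
    refine ⟨_, _, ((HasExpansion.of_poly t).mul hy).mul hS, ?_, ?_⟩
    · rw [map_mul, map_mul, map_sum, hy0, (A.expandHom_zetaMonomial _ _ v).1, one_mul,
        completeChainSum_eq _ hne.ne_empty, topWeight, min_eq_left hU.le]
      congr 1
      have h1 : ∀ I ∈ U.powerset.filter (fun I => I ≠ U ∧ I.card < n), PowerSeries.constantCoeff
          (A.expandHom (A.recursionPoly n U I) * z I) = if I.card + 1 = U.card then
            completeChainSum (A.topWeight E v) I else 0 := by
        intro I hI
        have h2 := card_lt_card (hss I hI)
        rw [map_mul, constantCoeff_recursionPoly, (hgz I (hss I hI)).2.1,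
          sum_range_neg_one_pow_mul_choose (by omega), ite_mul, one_mul, zero_mul]
        exact if_congr (by omega) rfl rfl
      rw [sum_congr rfl h1, ← sum_filter]
      refine sum_congr ?_ fun _ _ => rfl
      ext I
      simp only [mem_filter, mem_powerset]
      constructor
      · rintro ⟨⟨h1, -⟩, h2⟩
        exact ⟨h1, h2⟩
      · rintro ⟨h1, h2⟩
        exact ⟨⟨h1, by rintro rfl; omega, by omega⟩, h2⟩
    · intro q s hq hs G hG
      have hne : 1 - A.evalAtHom q s t ≠ 0 := by
        intro h
        have h3 := A.norm_evalAtHom_zetaMonomial_lt_one (min U.card n) (E.filter (· ⊆ U)) v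
          (by omega) hq hs
        rw [← ht, ← sub_eq_zero.1 h] at h3
        simp at h3
      have h1 := hG.2 U
      rw [sum_congr rfl fun I hI => by rw [(hgz I (hss I hI)).2.2 q s hq hs G hG]] at h1
      rw [← ht] at h1 ⊢
      field_simp
      linear_combination h1

/-- The full integral `Z` satisfies `G univ = t Z`, so `Z = (1 - q⁻¹) / (1 - t)` times the sum,
without the extra `t`. The number of forms may exceed `n`, so the binomial rows may be cut off and
every proper support can contribute. -/
theorem exists_hasExpansion_top [Fintype ι] (hn : 1 ≤ n) (hnm : n ≤ Fintype.card ι) :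
    ∃ g z, A.HasExpansion g z ∧
      PowerSeries.constantCoeff z = ((n : A.RatFun) + ∑ J ∈ E, A.var (v J))⁻¹ *
        ∑ I ∈ univ.filter (fun I : Finset ι => I.card < n),
          (∑ j ∈ range (n - I.card),
            (-1 : A.RatFun) ^ j * ((Fintype.card ι - I.card - 1).choose j : A.RatFun)) *
          completeChainSum (A.topWeight E v) I ∧
      ∀ (q : ℕ) (s : A.PosFlat → ℂ), 2 ≤ q → (∀ x, 0 < (s x).re) →
        ∀ G Z, A.IsRecursionSolution n E v q s G →
          Z = G univ + (1 - (q : ℂ)⁻¹) *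
            ∑ I ∈ (univ : Finset ι).powerset.filter (fun I => I ≠ univ ∧ I.card < n),
              A.evalAtHom q s (A.recursionPoly n univ I) * G I →
          G univ = A.evalAtHom q s (A.zetaMonomial (min (univ : Finset ι).card n)
            (E.filter (· ⊆ univ)) v) * Z → Z = g q s := by
  have ih : ∀ I : Finset ι, ∃ g z, I.card < n → A.HasExpansion g z ∧
      PowerSeries.constantCoeff z = completeChainSum (A.topWeight E v) I ∧
      ∀ (q : ℕ) (s : A.PosFlat → ℂ), 2 ≤ q → (∀ x, 0 < (s x).re) →
        ∀ G, A.IsRecursionSolution n E v q s G → G I = g q s := by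
    intro I
    by_cases hI : I.card < n
    · obtain ⟨g, z, h⟩ := A.exists_hasExpansion_of_recursion n E v I hI
      exact ⟨g, z, fun _ => h⟩
    · exact ⟨fun _ _ => 0, 0, fun h => absurd h hI⟩
  choose g z hgz using ih
  have hfil : (univ : Finset ι).powerset.filter (fun I => I ≠ univ ∧ I.card < n) =
      univ.filter (fun I : Finset ι => I.card < n) := by
    ext I
    simp only [mem_filter, mem_univ, true_and, powerset_univ, and_iff_right_iff_imp]
    rintro h rfl
    rw [card_univ] at h
    omega
  have hr : min (univ : Finset ι).card n = n := min_eq_right hnm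
  have hEu : E.filter (· ⊆ univ) = E := filter_true_of_mem fun _ _ => subset_univ _
  rw [hfil, hr, hEu]
  obtain ⟨y, hy, hy0⟩ := A.exists_hasExpansion_div n E v hn
  have hS := HasExpansion.sum (univ.filter (fun I : Finset ι => I.card < n)) fun I hI =>
    (HasExpansion.of_poly (A := A) (A.recursionPoly n univ I)).mul (hgz I (mem_filter.1 hI).2).1
  refine ⟨_, _, hy.mul hS, ?_, ?_⟩
  · rw [map_mul, map_sum, hy0]
    congr 1
    refine sum_congr rfl fun I hI => ?_
    rw [map_mul, constantCoeff_recursionPoly, (hgz I (mem_filter.1 hI).2).2.1]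
    rfl
  · intro q s hq hs G Z hG hZ hGZ
    have hne : 1 - A.evalAtHom q s (A.zetaMonomial n E v) ≠ 0 := by
      intro h
      have h3 := A.norm_evalAtHom_zetaMonomial_lt_one n E v hn hq hs
      rw [← sub_eq_zero.1 h] at h3
      simp at h3
    rw [sum_congr rfl fun I hI => by rw [(hgz I (mem_filter.1 hI).2).2.2 q s hq hs G hG], hGZ] at hZ
    field_simp
    linear_combination hZ

end HyperplaneArrangement

end

/-! ### Representations with an isomorphic intersection poset -/

section

open Finset HyperplaneArrangement

/-- The product of the individual elements is a multiple of each of them; this merges finitely many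
denominators into one. -/
theorem exists_common_ne_zero {R κ : Type*} [CommRing R] [IsDomain R] [Fintype κ]
    (P : κ → R → Prop) (h : ∀ k, ∃ δ, δ ≠ 0 ∧ P k δ) (hmul : ∀ k c δ, P k δ → P k (c * δ)) :
    ∃ δ, δ ≠ 0 ∧ ∀ k, P k δ := by
  classical
  choose δ hδ hP using h
  refine ⟨∏ k, δ k, prod_ne_zero_iff.2 fun k _ => hδ k, fun k => ?_⟩
  rw [← prod_erase_mul _ _ (mem_univ k)]
  exact hmul _ _ _ (hP k)

namespace HyperplaneArrangement

variable {F V : Type*} [Field F] [AddCommGroup V] [Module F V] {B : HyperplaneArrangement F V}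

/-- A hyperplane, as a flat. -/
def hyperplaneFlat (B : HyperplaneArrangement F V) (X : B.hyperplanes) : B.Flat :=
  ⟨OrderDual.toDual X.1, B.nonempty X.1 X.2, {X.1}, by simp, by
    simpa using B.le_ambient X.1 X.2⟩

theorem hyperplaneFlat_space (X : B.hyperplanes) : (B.hyperplaneFlat X).space = X.1 := rfl

theorem hyperplaneFlat_ne_bot (X : B.hyperplanes) : B.hyperplaneFlat X ≠ ⊥ := by
  intro h
  have h1 : X.1 = B.ambient := congrArg Flat.space h
  exact (B.covBy X.1 X.2).lt.ne (congrArg AffineSubspace.direction h1)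

theorem exists_hyperplaneFlat_le {x : B.Flat} (hx : x ≠ ⊥) : ∃ X, B.hyperplaneFlat X ≤ x := by
  obtain ⟨C, hC, h⟩ := x.2.2
  replace h : B.ambient ⊓ C.inf id = x.space := h
  rcases C.eq_empty_or_nonempty with rfl | ⟨X, hX⟩
  · refine absurd (Flat.space_injective B ?_) hx
    rw [← h, Flat.space_bot]
    simp
  · refine ⟨⟨X, hC hX⟩, ?_⟩
    rw [Flat.le_iff, hyperplaneFlat_space, ← h]
    exact inf_le_right.trans (Finset.inf_le hX)

theorem eq_of_hyperplane_le {X Y : B.hyperplanes} (h : X.1 ≤ Y.1) : X = Y := by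
  refine Subtype.ext (AffineSubspace.eq_of_direction_eq_of_nonempty_of_le ?_ (B.nonempty _ X.2) h)
  have h1 := AffineSubspace.direction_le h
  exact ((B.covBy X.1 X.2).eq_or_eq h1 (B.covBy Y.1 Y.2).le).resolve_right
    (B.covBy Y.1 Y.2).lt.ne |>.symm

end HyperplaneArrangement

namespace IsGenericCentral

variable {F : Type*} [Field F] {n m : ℕ} {A : HyperplaneArrangement F (Fin n → F)}
  {H : Fin m → AffineSubspace F (Fin n → F)}

theorem flat_singleton_le_iff (hA : IsGenericCentral A H) (i : Fin m) (x : A.Flat) :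
    hA.flat {i} ≤ x ↔ i ∈ support H x.space := by
  rw [Flat.le_iff, flat_space, inf_singleton, mem_support]

theorem exists_flat_singleton_le (hA : IsGenericCentral A H) (hn : 1 ≤ n) {x : A.Flat}
    (hx : x ≠ ⊥) : ∃ i, hA.flat {i} ≤ x := by
  obtain ⟨i, hi⟩ := nonempty_iff_ne_empty.2 (hA.support_ne_empty hn ⟨x, hx⟩)
  exact ⟨i, (hA.flat_singleton_le_iff i x).2 hi⟩

/-- Hyperplanes are the atoms of the intersection poset, and so are preserved by isomorphisms. For
`n = 1` all of them coincide with the top flat, and only the second case below occurs. -/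
theorem eq_flat_singleton (hA : IsGenericCentral A H) (hn : 1 ≤ n) {i : Fin m}
    {x : A.Flat} (hx : x ≠ ⊥) (hxi : x ≤ hA.flat {i}) : x = hA.flat {i} := by
  have h0 : support H x.space ≠ ∅ := hA.support_ne_empty hn ⟨x, hx⟩
  have h1 := (hA.isTruncatedBoolean.le_iff _ _).1 hxi
  refine hA.isTruncatedBoolean.injective (subset_antisymm h1 ?_)
  rcases hA.isTruncatedBoolean.card_lt_or x with h2 | h2
  · have h3 := card_pos.2 (nonempty_iff_ne_empty.2 h0)
    have h4 : ({i} : Finset (Fin m)).card < n := by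
      rw [card_singleton]
      omega
    simp only [hA.support_flat, if_pos h4] at h1 ⊢
    exact (eq_of_subset_of_card_le h1 (by rw [card_singleton]; omega)).ge
  · rw [h2]
    exact subset_univ _

section Representation

variable {K : Type*} [Field K] {V : Type*} [AddCommGroup V] [Module K V]
  {B : HyperplaneArrangement K V}

/-- The hyperplanes of an arrangement whose intersection poset is isomorphic to the one of a generic
central arrangement. -/
theorem exists_hyperplanes (hA : IsGenericCentral A H) (hn : 1 ≤ n) (φ : B.Flat ≃o A.Flat) :
    ∃ X : Fin m → B.hyperplanes, Function.Surjective X ∧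
      ∀ (y : B.Flat) i, y.space ≤ (X i).1 ↔ i ∈ support H (φ y).space := by
  have h1 : ∀ i, ∃ X, φ (B.hyperplaneFlat X) = hA.flat {i} := by
    intro i
    have hne : φ.symm (hA.flat {i}) ≠ ⊥ := by
      intro h
      have h2 : hA.flat {i} = ⊥ := by simpa using h
      have h3 := (hA.flat_singleton_le_iff i _).1 h2.le
      rw [hA.support_bot_flat hn] at h3
      simp at h3
    obtain ⟨X, hX⟩ := exists_hyperplaneFlat_le hne
    refine ⟨X, hA.eq_flat_singleton hn ?_ (by simpa using φ.monotone hX)⟩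
    simpa using hyperplaneFlat_ne_bot X
  choose X hX using h1
  have h2 : ∀ (y : B.Flat) i, y.space ≤ (X i).1 ↔ i ∈ support H (φ y).space := by
    intro y i
    rw [← hA.flat_singleton_le_iff, ← hX, φ.le_iff_le, Flat.le_iff, hyperplaneFlat_space]
  refine ⟨X, fun Y => ?_, h2⟩
  obtain ⟨i, hi⟩ := hA.exists_flat_singleton_le hn (x := φ (B.hyperplaneFlat Y))
    (by simpa using hyperplaneFlat_ne_bot Y)
  rw [hA.flat_singleton_le_iff, ← h2] at hi
  exact ⟨i, (eq_of_hyperplane_le hi).symm⟩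

variable {X : Fin m → B.hyperplanes} {φ : B.Flat ≃o A.Flat}

/-- A representation is again central, since the flat corresponding to the top one is nonempty. -/
theorem exists_mem_hyperplanes (hA : IsGenericCentral A H)
    (hX : ∀ (y : B.Flat) i, y.space ≤ (X i).1 ↔ i ∈ support H (φ y).space) :
    ∃ z, ∀ i, z ∈ (X i).1 := by
  obtain ⟨z, hz⟩ := (φ.symm (hA.flat univ)).2.1
  refine ⟨z, fun i => ?_⟩
  have h1 : (φ.symm (hA.flat univ)).space ≤ (X i).1 := by
    rw [hX, φ.apply_symm_apply, hA.support_flat]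
    split_ifs <;> exact mem_univ i
  exact h1 hz

/-- The flat corresponding to `I` without `i₀` has exactly that support, so it is not contained in
the hyperplane of `i₀`. -/
theorem exists_mem_notMem_hyperplanes (hA : IsGenericCentral A H)
    (hX : ∀ (y : B.Flat) i, y.space ≤ (X i).1 ↔ i ∈ support H (φ y).space)
    {I : Finset (Fin m)} (hI : I.card = n) {i₀ : Fin m} (hi₀ : i₀ ∈ I) :
    ∃ z, (∀ i ∈ I, i ≠ i₀ → z ∈ (X i).1) ∧ z ∉ (X i₀).1 := by
  have hs : support H (φ (φ.symm (hA.flat (I.erase i₀)))).space = I.erase i₀ := by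
    rw [φ.apply_symm_apply, hA.support_flat, if_pos]
    rw [← hI]
    exact card_erase_lt_of_mem hi₀
  have h1 : ¬ (φ.symm (hA.flat (I.erase i₀))).space ≤ (X i₀).1 := by
    rw [hX, hs]
    exact notMem_erase _ _
  obtain ⟨z, hz, hz'⟩ := SetLike.not_le_iff_exists.1 h1
  refine ⟨z, fun i hi hne => ?_, hz'⟩
  have h2 : (φ.symm (hA.flat (I.erase i₀))).space ≤ (X i).1 := by
    rw [hX, hs]
    exact mem_erase.2 ⟨hne, hi⟩
  exact h2 hz

/-- The intersection of the hyperplanes in `I` through `z` is a flat whose support has at least `n`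
elements, hence is everything. -/
theorem mem_hyperplane_of_forall_mem (hA : IsGenericCentral A H)
    (hX : ∀ (y : B.Flat) i, y.space ≤ (X i).1 ↔ i ∈ support H (φ y).space)
    {I : Finset (Fin m)} (hI : I.card = n) {z : V} (hz : ∀ i ∈ I, z ∈ (X i).1) (hzB : z ∈ B.ambient)
    (j : Fin m) : z ∈ (X j).1 := by
  classical
  have hmem : ∀ C : Finset (AffineSubspace K V), (∀ Y ∈ C, z ∈ Y) → z ∈ C.inf id := by
    intro C
    induction C using Finset.induction_on with
    | empty => intro _; simp
    | insert Y C _ ih =>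
      intro h
      rw [Finset.inf_insert]
      exact ⟨h Y (mem_insert_self _ _), ih fun Y' hY' => h Y' (mem_insert_of_mem hY')⟩
  have hwz : z ∈ B.ambient ⊓ (I.image fun i => (X i).1).inf id := by
    refine ⟨hzB, hmem _ fun Y hY => ?_⟩
    obtain ⟨i, hi, rfl⟩ := mem_image.1 hY
    exact hz i hi
  have hsub : (I.image fun i => (X i).1) ⊆ B.hyperplanes := by
    intro Y hY
    obtain ⟨i, -, rfl⟩ := mem_image.1 hY
    exact (X i).2
  let w : B.Flat := ⟨OrderDual.toDual (B.ambient ⊓ (I.image fun i => (X i).1).inf id), ⟨z, hwz⟩,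
    I.image fun i => (X i).1, hsub, rfl⟩
  have h1 : I ⊆ support H (φ w).space := by
    intro i hi
    rw [← hX]
    exact inf_le_right.trans (Finset.inf_le (f := id) (mem_image_of_mem _ hi))
  have h2 := card_le_card h1
  have h3 := (hA.isTruncatedBoolean.card_lt_or (φ w)).resolve_left (by omega)
  exact (hX w j).2 (by rw [h3]; exact mem_univ j) hwz

end Representation

end IsGenericCentral

end

/-! ### Clearing denominators, and unramified extensions -/

section

open Finset

section ClearDenominators

variable {R K : Type*} [CommRing R] [IsDomain R] [Field K] [Algebra R K] [IsFractionRing R K]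
  {ι κ : Type*}

theorem exists_smul_eq_algebraMap [Finite κ] (f : κ → K) :
    ∃ δ : R, δ ≠ 0 ∧ ∃ g : κ → R, ∀ k, algebraMap R K (g k) = algebraMap R K δ * f k := by
  obtain ⟨b, hb⟩ := IsLocalization.exist_integer_multiples_of_finite (nonZeroDivisors R) f
  choose g hg using hb
  exact ⟨b, nonZeroDivisors.ne_zero b.2, g, fun k => by rw [hg, Algebra.smul_def]⟩

variable [Fintype κ] {c : ι → R} {α : ι → κ → R}

/-- An integral vector that is orthogonal to all but one of the given linear forms. -/
theorem exists_integral_dual_vector [DecidableEq ι] {I : Finset ι} {i₀ : ι} {z₀ z : κ → K}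
    (h₀ : ∀ i ∈ I, algebraMap R K (c i) + ∑ k, algebraMap R K (α i k) * z₀ k = 0)
    (h : ∀ i ∈ I, i ≠ i₀ → algebraMap R K (c i) + ∑ k, algebraMap R K (α i k) * z k = 0)
    (hne : algebraMap R K (c i₀) + ∑ k, algebraMap R K (α i₀ k) * z k ≠ 0) (hi₀ : i₀ ∈ I) :
    ∃ δ : R, δ ≠ 0 ∧ ∃ v : κ → R, ∀ i ∈ I, ∑ k, α i k * v k = if i = i₀ then δ else 0 := by
  -- The difference of the two points removes the constant terms; `v` is this difference with
  -- denominators cleared.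
  obtain ⟨δ, hδ, v, hv⟩ := exists_smul_eq_algebraMap (R := R) (fun k => z k - z₀ k)
  have h1 : ∀ i ∈ I, algebraMap R K (∑ k, α i k * v k) = algebraMap R K δ *
      (algebraMap R K (c i) + ∑ k, algebraMap R K (α i k) * z k) := by
    intro i hi
    rw [← sub_zero (algebraMap R K (c i) + ∑ k, algebraMap R K (α i k) * z k), ← h₀ i hi,
      add_sub_add_left_eq_sub, ← sum_sub_distrib, mul_sum, map_sum]
    refine sum_congr rfl fun k _ => ?_
    rw [map_mul, hv]
    ring
  refine ⟨∑ k, α i₀ k * v k, fun h2 => ?_, v, fun i hi => ?_⟩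
  · have h3 := h1 i₀ hi₀
    rw [h2, map_zero, eq_comm, mul_eq_zero] at h3
    exact h3.elim (fun h4 => hδ (FaithfulSMul.algebraMap_injective R K (by simpa using h4))) hne
  · split_ifs with h3
    · rw [h3]
    · refine FaithfulSMul.algebraMap_injective R K ?_
      rw [h1 i hi, h i hi h3, mul_zero, map_zero]

/-- An affine form that vanishes on the common zeros of others is a linear combination of them, up
to denominators. -/
theorem exists_integral_combination {I : Finset ι} {j : ι} {z₀ : κ → K}
    (h₀ : ∀ i, algebraMap R K (c i) + ∑ k, algebraMap R K (α i k) * z₀ k = 0)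
    (h : ∀ z : κ → K, (∀ i ∈ I, algebraMap R K (c i) + ∑ k, algebraMap R K (α i k) * z k = 0) →
      algebraMap R K (c j) + ∑ k, algebraMap R K (α j k) * z k = 0) :
    ∃ δ : R, δ ≠ 0 ∧ ∃ a : ι → R, (∀ k, δ * α j k = ∑ i ∈ I, a i * α i k) ∧
      δ * c j = ∑ i ∈ I, a i * c i := by
  classical
  let lin : ι → Module.Dual K (κ → K) := fun i => ∑ k, algebraMap R K (α i k) • LinearMap.proj k
  have hlin : ∀ i w, lin i w = ∑ k, algebraMap R K (α i k) * w k := by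
    intro i w
    simp [lin, Algebra.smul_def]
  -- Translating by the common zero `z₀` turns the hypothesis on affine zeros into one on kernels,
  -- whence the linear part of `j` is in the span of the others.
  have hker : ⨅ i : I, (lin i).ker ≤ (lin j).ker := by
    intro w hw
    simp only [Submodule.mem_iInf, LinearMap.mem_ker, hlin] at hw ⊢
    have h1 := h (fun k => z₀ k + w k) fun i hi => by
      simp only [mul_add, sum_add_distrib, hw ⟨i, hi⟩, add_zero, h₀]
    simpa only [mul_add, sum_add_distrib, ← add_assoc, h₀, zero_add] using h1
  obtain ⟨b, hb⟩ := (Submodule.mem_span_range_iff_exists_fun K).1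
    (mem_span_of_iInf_ker_le_ker hker)
  obtain ⟨δ, hδ, a, ha⟩ := exists_smul_eq_algebraMap (R := R) b
  have hinj := FaithfulSMul.algebraMap_injective R K
  have h2 : ∀ k, δ * α j k = ∑ i ∈ I, (if h : i ∈ I then a ⟨i, h⟩ else 0) * α i k := by
    intro k
    apply hinj
    have h3 := congrArg (fun f => f (Pi.single k 1)) hb
    simp only [LinearMap.sum_apply, LinearMap.smul_apply, hlin, Pi.single_apply, mul_ite, mul_one,
      mul_zero, sum_ite_eq', mem_univ, if_true, smul_eq_mul] at h3
    rw [map_mul, ← h3, ← sum_coe_sort I, mul_sum, map_sum]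
    refine sum_congr rfl fun i _ => ?_
    rw [dif_pos i.2, map_mul, ha, mul_assoc]
  refine ⟨δ, hδ, fun i => if h : i ∈ I then a ⟨i, h⟩ else 0, h2, hinj ?_⟩
  -- The constant terms are linear in the coefficients because all forms vanish at `z₀`, so they
  -- satisfy the same relation.
  have hc : ∀ i, algebraMap R K (c i) = - ∑ k, algebraMap R K (α i k) * z₀ k :=
    fun i => eq_neg_of_add_eq_zero_left (h₀ i)
  simp only [map_mul, map_sum, hc, mul_neg, sum_neg_distrib, mul_sum]
  rw [sum_comm]
  congr 1
  refine sum_congr rfl fun k _ => ?_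
  rw [← mul_assoc, ← map_mul, h2, map_sum, sum_mul]
  refine sum_congr rfl fun i _ => ?_
  rw [map_mul, mul_assoc]

end ClearDenominators

section Unramified

open IsLocalRing NumberField

variable {o o' : Type*} [CommRing o] [IsDomain o] [IsDiscreteValuationRing o]
  [CommRing o'] [IsDomain o'] [IsDiscreteValuationRing o'] [Algebra o o']

attribute [local instance] Ideal.Quotient.field

/-- A uniformizer of `o` does not map to zero, so the extension is torsion-free and hence free, of
rank `f`. Reduction modulo the maximal ideal preserves the rank, and by hypothesis the quotient is
the residue field of `o'`. -/
theorem IsUnramifiedOfDegree.natCard_residueField {f : ℕ} (h : IsUnramifiedOfDegree o o' f) :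
    Nat.card (ResidueField o') = Nat.card (ResidueField o) ^ f := by
  obtain ⟨h1, h2, h3⟩ := h
  obtain ⟨ϖ, hϖ⟩ := IsDiscreteValuationRing.exists_irreducible o
  have hϖ' : algebraMap o o' ϖ ≠ 0 := by
    intro h
    apply IsDiscreteValuationRing.not_a_field o'
    rw [← h3, hϖ.maximalIdeal_eq, Ideal.map_span, Set.image_singleton, h, Ideal.span_singleton_zero]
  have hinj : Function.Injective (algebraMap o o') := by
    rw [injective_iff_map_eq_zero]
    intro x hx
    by_contra hne
    obtain ⟨k, u, rfl⟩ := IsDiscreteValuationRing.eq_unit_mul_pow_irreducible hne hϖ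
    rw [map_mul, map_pow] at hx
    exact mul_ne_zero (u.isUnit.map (algebraMap o o')).ne_zero (pow_ne_zero _ hϖ') hx
  have : FaithfulSMul o o' := (faithfulSMul_iff_algebraMap_injective o o').2 hinj
  have : Module.IsTorsionFree o o' := inferInstance
  have : Module.Free o o' := inferInstance
  have h4 := IsLocalRing.finrank_quotient_map (R := o) (S := o')
  have : Module.Finite (o ⧸ maximalIdeal o) (o' ⧸ (maximalIdeal o).map (algebraMap o o')) :=
    Module.Finite.of_restrictScalars_finite o _ _
  have h5 := Module.natCard_eq_pow_finrank (K := o ⧸ maximalIdeal o)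
    (V := o' ⧸ (maximalIdeal o).map (algebraMap o o'))
  rw [h4, h2, h3] at h5
  exact h5

/-- The norm of `δ` is a multiple of `δ`. If `δ` mapped to a nonunit, the norm would vanish in the
residue field, whose characteristic would then divide it. -/
theorem isUnit_algebraMap_of_ringChar_notMem {K : Type*} [Field K] [NumberField K]
    [Algebra (𝓞 K) o] [Finite (ResidueField o)] {δ : 𝓞 K} (hδ : δ ≠ 0)
    (h : ringChar (ResidueField o) ∉ (Ideal.absNorm (Ideal.span {δ})).primeFactors) :
    IsUnit (algebraMap (𝓞 K) o δ) := by
  have hN : Ideal.absNorm (Ideal.span {δ}) ≠ 0 := by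
    rw [Ne, Ideal.absNorm_eq_zero_iff, Ideal.span_singleton_eq_bot]
    exact hδ
  have hp : (ringChar (ResidueField o)).Prime :=
    CharP.char_is_prime (ResidueField o) _
  obtain ⟨c, hc⟩ := Ideal.mem_span_singleton'.1 (Ideal.absNorm_mem (Ideal.span {δ}))
  by_contra hu
  have h1 : algebraMap (𝓞 K) o δ ∈ maximalIdeal o := hu
  refine h (Nat.mem_primeFactors.2 ⟨hp, (ringChar.spec _ _).1 ?_, hN⟩)
  have h2 := congrArg (fun x => residue o (algebraMap (𝓞 K) o x)) hc
  simp only [map_mul, map_natCast] at h2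
  rw [← h2, (residue_eq_zero_iff _).2 h1, mul_zero]

end Unramified

end

/-! ### Genericity of the forms over almost all valuation rings -/

section

open MeasureTheory Finset Topology IsLocalRing HyperplaneArrangement

section AffineForms

variable {o ι κ : Type*} [CommRing o] [Fintype ι] [Fintype κ] [DecidableEq ι]
  [IsDomain o] [IsDiscreteValuationRing o] [TopologicalSpace o] [IsTopologicalRing o]
  [CompactSpace o] [T2Space o] [MeasurableSpace o] [BorelSpace o]

/-- Affine forms of which any `n` have linear parts that can be completed to a basis, and of which
any `n` generate the others, are generic. -/
theorem genericForms_of_dual {n : ℕ} {c : ι → o} {α : ι → κ → o} (hn : n ≤ Fintype.card ι)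
    (hdual : ∀ I : Finset ι, I.card = n → ∀ i₀ ∈ I, ∃ v : κ → o,
      ∀ i ∈ I, ∑ k, α i k * v k = if i = i₀ then 1 else 0)
    (hspan : ∀ I : Finset ι, I.card = n → ∀ j, ∃ a : ι → o,
      (∀ k, α j k = ∑ i ∈ I, a i * α i k) ∧ c j = ∑ i ∈ I, a i * c i) :
    GenericForms (haarPi o κ) n (fun z i => c i + ∑ k, α i k * z k) where
  measurable := by
    have := secondCountableTopology_of_compact_dvr (o := o)
    refine Continuous.measurable (continuous_pi fun i => continuous_const.add ?_)
    exact continuous_finsetSum _ fun k _ => continuous_const.mul (continuous_apply k)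
  measurePreserving := by
    intro I J hIJ hcard
    have := secondCountableTopology_of_compact_dvr (o := o)
    let g : (κ → o) →+ (I → o) × (J → o) :=
      { toFun := fun z => (fun i => ∑ k, α i k * z k, fun j => ∑ k, α j k * z k)
        map_zero' := by ext <;> simp
        map_add' := fun z w => by ext <;> simp [mul_add, sum_add_distrib] }
    have hg : Continuous g := by
      refine Continuous.prodMk (continuous_pi fun i => ?_) (continuous_pi fun i => ?_) <;>
      exact continuous_finsetSum _ fun k _ => continuous_const.mul (continuous_apply k)
    have hsurj : Function.Surjective g := by
      rintro ⟨x, y⟩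
      -- The dual vectors exist only for sets of exactly `n` forms, so `I ∪ J` is enlarged to one;
      -- prescribed values are attained by combining the dual vectors of `M`.
      obtain ⟨M, hM, hMn⟩ := exists_superset_card_eq
        ((card_union_of_disjoint hIJ).trans_le hcard) hn
      have h1 : ∀ i₀ : M, ∃ v : κ → o, ∀ i ∈ M, ∑ k, α i k * v k = if i = i₀ then 1 else 0 :=
        fun i₀ => hdual M hMn i₀ i₀.2
      choose v hv using h1
      let t : ι → o := fun i => if h : i ∈ I then x ⟨i, h⟩ else if h : i ∈ J then y ⟨i, h⟩ else 0
      have h2 : ∀ i ∈ M, ∑ k, α i k * ∑ i₀ : M, t i₀ * v i₀ k = t i := by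
        intro i hi
        calc ∑ k, α i k * ∑ i₀ : M, t i₀ * v i₀ k
            = ∑ i₀ : M, t i₀ * ∑ k, α i k * v i₀ k := by
              simp only [mul_sum]
              rw [sum_comm]
              exact sum_congr rfl fun _ _ => sum_congr rfl fun _ _ => mul_left_comm _ _ _
          _ = ∑ i₀ : M, if i = i₀ then t i₀ else 0 := by
              refine sum_congr rfl fun i₀ _ => ?_
              rw [hv i₀ i hi, mul_ite, mul_one, mul_zero]
          _ = t i := by
              rw [sum_coe_sort M fun i₀ => if i = i₀ then t i₀ else 0, sum_ite_eq, if_pos hi]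
      refine ⟨fun k => ∑ i₀ : M, t i₀ * v i₀ k, Prod.ext (funext fun i => ?_) (funext fun j => ?_)⟩
      · refine (h2 i (hM (mem_union_left _ i.2))).trans ?_
        simp [t]
      · refine (h2 j (hM (mem_union_right _ j.2))).trans ?_
        have h3 : (j : ι) ∉ I := fun h => disjoint_left.1 hIJ h j.2
        simp [t, h3]
    -- A continuous surjective homomorphism of compact groups carries normalized Haar measure to
    -- normalized Haar measure; the constant terms are only a translation.
    have h3 : MeasurePreserving g (haarPi o κ) ((haarPi o I).prod (haarPi o J)) :=
      AddMonoidHom.measurePreserving hg hsurj (by rw [measure_univ, measure_univ])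
    exact (measurePreserving_add_left _
      ((fun i : I => c i, fun j : J => c j) : (I → o) × (J → o))).comp h3
  span := by
    intro I hI j
    obtain ⟨a, ha, hc⟩ := hspan I hI j
    refine ⟨a, fun z => ?_⟩
    simp only [hc, ha, mul_add, sum_add_distrib, sum_mul, mul_sum]
    rw [sum_comm]
    congr 1
    exact sum_congr rfl fun _ _ => sum_congr rfl fun _ _ => mul_assoc _ _ _

end AffineForms

namespace IsGenericCentral

open NumberField

variable {F : Type*} [Field F] {n m : ℕ} {A : HyperplaneArrangement F (Fin n → F)}
  {H : Fin m → AffineSubspace F (Fin n → F)} {K : Type*} [Field K] [NumberField K] {d : ℕ}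
  {B : HyperplaneArrangement K (Fin d → K)} {X : Fin m → B.hyperplanes} {φ : B.Flat ≃o A.Flat}

/-- The genericity of the linear forms of a representation over a number field. -/
theorem exists_integral_data (hA : IsGenericCentral A H) (hB : B.ambient = ⊤) (L : B.IntegralForms)
    (hX : ∀ (y : B.Flat) i, y.space ≤ (X i).1 ↔ i ∈ support H (φ y).space) :
    ∃ δ : 𝓞 K, δ ≠ 0 ∧
      (∀ I : Finset (Fin m), I.card = n → ∀ i₀ ∈ I, ∃ v : Fin d → 𝓞 K,
        ∀ i ∈ I, ∑ k, L.coeff (X i) k * v k = if i = i₀ then δ else 0) ∧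
      (∀ I : Finset (Fin m), I.card = n → ∀ j, ∃ a : Fin m → 𝓞 K,
        (∀ k, δ * L.coeff (X j) k = ∑ i ∈ I, a i * L.coeff (X i) k) ∧
          δ * L.const (X j) = ∑ i ∈ I, a i * L.const (X i)) := by
  obtain ⟨z₀, hz₀⟩ := hA.exists_mem_hyperplanes hX
  let P : Finset (Fin m) × Fin m → 𝓞 K → Prop := fun p δ => p.1.card = n → p.2 ∈ p.1 →
    ∃ v : Fin d → 𝓞 K, ∀ i ∈ p.1, ∑ k, L.coeff (X i) k * v k = if i = p.2 then δ else 0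
  let Q : Finset (Fin m) × Fin m → 𝓞 K → Prop := fun p δ => p.1.card = n →
    ∃ a : Fin m → 𝓞 K, (∀ k, δ * L.coeff (X p.2) k = ∑ i ∈ p.1, a i * L.coeff (X i) k) ∧
      δ * L.const (X p.2) = ∑ i ∈ p.1, a i * L.const (X i)
  have hPmul : ∀ p e δ, P p δ → P p (e * δ) := by
    intro p e δ h h1 h2
    obtain ⟨v, hv⟩ := h h1 h2
    refine ⟨fun k => e * v k, fun i hi => ?_⟩
    rw [← mul_zero e, ← mul_ite, ← hv i hi, mul_sum]
    exact sum_congr rfl fun _ _ => mul_left_comm _ _ _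
  have hQmul : ∀ p e δ, Q p δ → Q p (e * δ) := by
    intro p e δ h h1
    obtain ⟨a, ha, hc⟩ := h h1
    refine ⟨fun i => e * a i, fun k => ?_, ?_⟩
    · simp only [mul_assoc, ha, mul_sum]
    · simp only [mul_assoc, hc, mul_sum]
  obtain ⟨δ₁, hδ₁, h1⟩ := exists_common_ne_zero P (by
    rintro ⟨I, i₀⟩
    by_cases h : I.card = n ∧ i₀ ∈ I
    · obtain ⟨z, hz, hz'⟩ := hA.exists_mem_notMem_hyperplanes hX h.1 h.2
      obtain ⟨δ, hδ, hv⟩ := exists_integral_dual_vector (K := K) (c := fun i => L.const (X i))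
        (α := fun i => L.coeff (X i)) (I := I) (fun i _ => (L.mem_iff _ _).1 (hz₀ i))
        (fun i hi hne => (L.mem_iff _ _).1 (hz i hi hne)) ((L.mem_iff _ _).not.1 hz') h.2
      exact ⟨δ, hδ, fun _ _ => hv⟩
    · exact ⟨1, one_ne_zero, fun h1 h2 => absurd ⟨h1, h2⟩ h⟩) hPmul
  obtain ⟨δ₂, hδ₂, h2⟩ := exists_common_ne_zero Q (by
    rintro ⟨I, j⟩
    by_cases h : I.card = n
    · obtain ⟨δ, hδ, hv⟩ := exists_integral_combination (K := K) (c := fun i => L.const (X i))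
        (α := fun i => L.coeff (X i)) (I := I) (j := j) (fun i => (L.mem_iff _ _).1 (hz₀ i))
        (fun z hz => (L.mem_iff _ _).1 (hA.mem_hyperplane_of_forall_mem hX h
          (fun i hi => (L.mem_iff _ _).2 (hz i hi)) (by rw [hB]; trivial) j))
      exact ⟨δ, hδ, fun _ => hv⟩
    · exact ⟨1, one_ne_zero, fun h1 => absurd h1 h⟩) hQmul
  refine ⟨δ₁ * δ₂, mul_ne_zero hδ₁ hδ₂, fun I hI i₀ hi₀ => ?_, fun I hI j => ?_⟩
  · have h3 := hPmul (I, i₀) δ₂ δ₁ (h1 _) hI hi₀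
    rwa [mul_comm] at h3
  · exact hQmul (I, j) δ₁ δ₂ (h2 _) hI

/-- The affine forms of a representation over a number field are generic over almost all compact
discrete valuation rings. -/
theorem exists_genericForms (hA : IsGenericCentral A H) (hnm : n ≤ m) (hB : B.ambient = ⊤)
    (L : B.IntegralForms)
    (hX : ∀ (y : B.Flat) i, y.space ≤ (X i).1 ↔ i ∈ support H (φ y).space) :
    ∃ δ : 𝓞 K, δ ≠ 0 ∧ ∀ (o : Type) [CommRing o] [IsDomain o] [IsDiscreteValuationRing o]
      [TopologicalSpace o] [IsTopologicalRing o] [CompactSpace o] [T2Space o] [MeasurableSpace o]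
      [BorelSpace o] [Algebra (𝓞 K) o], IsUnit (algebraMap (𝓞 K) o δ) →
      GenericForms (haarPi o (Fin d)) n (fun z i => L.eval (X i) z) := by
  obtain ⟨δ, hδ, h1, h2⟩ := hA.exists_integral_data hB L hX
  refine ⟨δ, hδ, fun o => ?_⟩
  intros _ _ _ _ _ _ _ _ _ _ hu
  -- Multiplying the integral relations by the inverse of `δ` normalizes the dual vectors and solves
  -- for the remaining forms.
  obtain ⟨e, he⟩ := hu.exists_left_inv
  refine genericForms_of_dual (by simpa using hnm) (fun I hI i₀ hi₀ => ?_) (fun I hI j => ?_)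
  · obtain ⟨v, hv⟩ := h1 I hI i₀ hi₀
    refine ⟨fun k => e * algebraMap _ o (v k), fun i hi => ?_⟩
    have h3 := congrArg (fun x => e * algebraMap _ o x) (hv i hi)
    simp only [map_sum, map_mul, mul_sum, apply_ite (algebraMap (𝓞 K) o), mul_ite,
      map_zero, he, mul_zero] at h3
    rw [← h3]
    exact sum_congr rfl fun _ _ => mul_left_comm _ _ _
  · obtain ⟨a, ha, hc⟩ := h2 I hI j
    refine ⟨fun i => e * algebraMap _ o (a i), fun k => ?_, ?_⟩
    · have h3 := congrArg (fun x => e * algebraMap _ o x) (ha k)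
      simpa only [map_sum, map_mul, mul_sum, ← mul_assoc, he, one_mul] using h3
    · have h3 := congrArg (fun x => e * algebraMap _ o x) hc
      simpa only [map_sum, map_mul, mul_sum, ← mul_assoc, he, one_mul] using h3

end IsGenericCentral

end

/-! ### The topological zeta function as an unramified limit -/

section

open MeasureTheory Finset Topology IsLocalRing HyperplaneArrangement

namespace IsGenericCentral

open NumberField

/-- The sets of hyperplanes of a generic central arrangement that contain a given flat. -/
def flatSupports (n m : ℕ) : Finset (Finset (Fin m)) :=
  univ.filter fun J => J ≠ ∅ ∧ (J.card < n ∨ J = univ)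

theorem mem_flatSupports {n m : ℕ} {J : Finset (Fin m)} :
    J ∈ flatSupports n m ↔ J ≠ ∅ ∧ (J.card < n ∨ J = univ) := by
  simp [flatSupports]

variable {F : Type*} [Field F] {n m : ℕ} {A : HyperplaneArrangement F (Fin n → F)}
  {H : Fin m → AffineSubspace F (Fin n → F)}

theorem support_posFlat (hA : IsGenericCentral A H) (hn : 1 ≤ n) (hnm : n ≤ m)
    {J : Finset (Fin m)} (hJ : J ∈ flatSupports n m) :
    support H (hA.posFlat hn hnm J).1.space = J := by
  obtain ⟨h0, h | rfl⟩ := mem_flatSupports.1 hJ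
  · exact hA.support_posFlat_of_lt hn hnm h0 h
  · exact hA.support_posFlat_univ hn hnm

theorem prod_posFlat {M : Type*} [CommMonoid M] (hA : IsGenericCentral A H) (hn : 1 ≤ n)
    (hnm : n ≤ m) (f : A.PosFlat → M) :
    ∏ x, f x = ∏ J ∈ flatSupports n m, f (hA.posFlat hn hnm J) := by
  refine prod_bij' (fun x _ => support H x.1.space) (fun J _ => hA.posFlat hn hnm J)
    (fun x _ => mem_flatSupports.2 ⟨hA.support_ne_empty hn x, ?_⟩) (fun _ _ => mem_univ _)
    (fun x _ => hA.posFlat_support hn hnm x) (fun J hJ => hA.support_posFlat hn hnm hJ)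
    (fun x _ => by rw [hA.posFlat_support hn hnm x])
  exact hA.isTruncatedBoolean.card_lt_or x.1

section Representation

variable {K : Type*} [Field K] {d : ℕ}
  {B : HyperplaneArrangement K (Fin d → K)} {X : Fin m → B.hyperplanes} {φ : B.Flat ≃o A.Flat}

theorem maxAbs_eq (L : B.IntegralForms) (hXs : Function.Surjective X)
    (hX : ∀ (y : B.Flat) i, y.space ≤ (X i).1 ↔ i ∈ support H (φ y).space)
    {o : Type*} [CommRing o] [IsDomain o] [IsDiscreteValuationRing o] [Algebra (𝓞 K) o]
    (x : B.PosFlat) (z : Fin d → o) : L.maxAbs x z =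
      (support H (posMap φ x).1.space).sup fun i => dvrAbs (L.eval (X i) z) := by
  classical
  refine le_antisymm (Finset.sup_le fun Y hY => ?_) (Finset.sup_le fun i hi => ?_)
  · obtain ⟨i, rfl⟩ := hXs Y
    exact Finset.le_sup (f := fun i => dvrAbs (L.eval (X i) z))
      ((hX _ _).1 (mem_filter.1 hY).2)
  · exact Finset.le_sup (f := fun Y => dvrAbs (L.eval Y z))
      (mem_filter.2 ⟨mem_univ _, (hX _ _).2 hi⟩)

theorem posMap_bijective : Function.Bijective (posMap φ) := by
  constructor
  · intro x y h
    exact Subtype.ext (φ.injective (congrArg Subtype.val h))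
  · intro y
    exact ⟨⟨φ.symm y.1, by simpa using y.2⟩, Subtype.ext (φ.apply_symm_apply y.1)⟩

/-- The isomorphism matches flats by their supports, so the integrand depends on the representation
only through the values of its forms. -/
theorem analyticZeta_eq [NumberField K] (hA : IsGenericCentral A H) (hn : 1 ≤ n) (hnm : n ≤ m)
    (L : B.IntegralForms) (hXs : Function.Surjective X)
    (hX : ∀ (y : B.Flat) i, y.space ≤ (X i).1 ↔ i ∈ support H (φ y).space)
    (o : Type*) [CommRing o] [IsDomain o] [IsDiscreteValuationRing o] [TopologicalSpace o]
    [IsTopologicalRing o] [CompactSpace o] [Algebra (𝓞 K) o] [hM : MeasurableSpace o]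
    [hb : BorelSpace o] (s : A.PosFlat → ℂ) :
    L.analyticZeta o (fun x => s (posMap φ x)) =
      ∫ z, maxProd (flatSupports n m) (fun J => s (hA.posFlat hn hnm J)) univ
        (fun i => L.eval (X i) z) ∂haarPi o (Fin d) := by
  -- The definition of the integral fixes the Borel structure internally.
  obtain rfl : hM = borel o := hb.measurable_eq
  rw [HyperplaneArrangement.IntegralForms.analyticZeta, haarPi]
  congr 1
  ext z
  let w : A.PosFlat → ℂ := fun y =>
    ((((support H y.1.space).sup fun i => dvrAbs (L.eval (X i) z) : NNReal) : ℝ) : ℂ) ^ s y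
  have h1 : ∀ x : B.PosFlat, (((L.maxAbs x z : NNReal) : ℝ) : ℂ) ^ s (posMap φ x) =
      w (posMap φ x) := by
    intro x
    rw [maxAbs_eq L hXs hX]
  rw [prod_congr rfl fun x _ => h1 x, posMap_bijective.prod_comp w, hA.prod_posFlat hn hnm, maxProd,
    filter_true_of_mem fun _ _ => subset_univ _]
  exact prod_congr rfl fun J hJ => by simp only [w, hA.support_posFlat hn hnm hJ]

end Representation

/-- The bracket in the recursion is the full integral for `U`, and restricting to nonunit values
multiplies it by the monomial. -/
theorem isRecursionSolution_integral (v : Finset (Fin m) → A.PosFlat) {o Ω : Type*} [CommRing o]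
    [IsDomain o] [IsDiscreteValuationRing o] [TopologicalSpace o] [IsTopologicalRing o]
    [CompactSpace o] [T2Space o] [MeasurableSpace o] [BorelSpace o] [MeasurableSpace Ω]
    {μ : Measure Ω} [IsProbabilityMeasure μ] {ℓ : Ω → Fin m → o} (h : GenericForms μ n ℓ)
    {s : A.PosFlat → ℂ} (hs : ∀ x, 0 < (s x).re) :
    A.IsRecursionSolution n (flatSupports n m) v (Nat.card (ResidueField o)) s (fun U =>
      ∫ z, residueInd U (ℓ z) * maxProd (flatSupports n m) (fun J => s (v J)) U (ℓ z) ∂μ) := by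
  refine ⟨?_, fun U => ?_⟩
  · have h1 : (flatSupports n m).filter (· = ∅) = ∅ :=
      filter_eq_empty_iff.2 fun J hJ => (mem_flatSupports.1 hJ).1
    simp [residueInd, maxProd, h1]
  · simp only [evalAtHom_recursionPoly, evalAtHom_zetaMonomial]
    rw [← h.integral_maxProd (fun J _ => hs _)]
    exact h.integral_residueInd_mul_maxProd U

/-- The topological zeta function of a generic central arrangement. -/
theorem exists_isTopologicalZeta (hA : IsGenericCentral A H) (hn : 1 ≤ n) (hnm : n ≤ m) :
    ∃ Z : A.RatFun, A.IsTopologicalZeta Z ∧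
      Z = ((n : A.RatFun) + ∑ J ∈ flatSupports n m, A.var (hA.posFlat hn hnm J))⁻¹ *
        ∑ I ∈ univ.filter (fun I : Finset (Fin m) => I.card < n),
          (∑ j ∈ range (n - I.card),
            (-1 : A.RatFun) ^ j * ((m - I.card - 1).choose j : A.RatFun)) *
          completeChainSum (A.topWeight (flatSupports n m) (hA.posFlat hn hnm)) I := by
  -- The rational function `P / D` comes from the recursion alone, before any representation or
  -- valuation ring is chosen.
  obtain ⟨g, z, ⟨P, D, hD, hz, hg⟩, hz0, hrec⟩ := A.exists_hasExpansion_top n (flatSupports n m)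
    (hA.posFlat hn hnm) hn (by simpa using hnm)
  rw [Fintype.card_fin] at hz0
  refine ⟨_, ?_, hz0⟩
  intro K _ _ d B hB φ L
  obtain ⟨X, hXs, hX⟩ := hA.exists_hyperplanes hn φ
  obtain ⟨δ, hδ, hgen⟩ := hA.exists_genericForms hnm hB L hX
  -- Away from the primes dividing the norm of `δ` the forms are generic.
  refine ⟨(Ideal.absNorm (Ideal.span {δ})).primeFactors, fun o => ?_⟩
  intro _ _ _ _ _ _ _ _ hchar
  refine ⟨P, D, fun f hf o' => ?_, hD, z, hz, rfl⟩
  intro _ _ _ _ _ _ _ _ _ _ hunr s hs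
  have hfin : Finite (ResidueField o) := inferInstance
  let hM : MeasurableSpace o' := borel o'
  have hb : BorelSpace o' := ⟨rfl⟩
  have hu : IsUnit (algebraMap (𝓞 K) o' δ) := by
    rw [IsScalarTower.algebraMap_apply (𝓞 K) o o']
    exact (isUnit_algebraMap_of_ringChar_notMem hδ hchar).map _
  have hforms := hgen o' hu
  have hq : 2 ≤ Nat.card (ResidueField o) ^ f := by
    have h1 : 1 < Nat.card (ResidueField o) := Finite.one_lt_card
    exact h1.trans_le (Nat.le_self_pow (by omega) _)
  have hZ : L.analyticZeta o' (fun x => s (posMap φ x)) =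
      g (Nat.card (ResidueField o) ^ f) s := by
    rw [hA.analyticZeta_eq hn hnm L hXs hX]
    rw [← hunr.natCard_residueField] at hq ⊢
    refine hrec _ s hq hs _ _ (isRecursionSolution_integral (hA.posFlat hn hnm) hforms hs) ?_ ?_
    · simp only [evalAtHom_recursionPoly]
      exact hforms.integral_maxProd (fun J _ => hs _) univ
    · simp only [evalAtHom_zetaMonomial]
      exact hforms.integral_residueInd_mul_maxProd univ
  rw [hZ]
  exact hg _ s hq hs

end IsGenericCentral

end

/-! ### The explicit formula for the topological zeta function -/

section

open Finset HyperplaneArrangement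

theorem sum_filter_card_lt {α M : Type*} [Fintype α] [DecidableEq α] [AddCommMonoid M] (n : ℕ)
    (f : Finset α → M) :
    ∑ J ∈ univ.filter (fun J : Finset α => J ≠ ∅ ∧ J.card < n), f J =
      ∑ r ∈ Icc 1 (n - 1), ∑ J ∈ powersetCard r univ, f J := by
  rw [← sum_biUnion fun r _ r' _ h => pairwise_disjoint_powersetCard _ h]
  refine sum_congr ?_ fun _ _ => rfl
  ext J
  simp only [mem_filter, mem_univ, true_and, mem_biUnion, mem_Icc, mem_powersetCard, subset_univ,
    exists_eq_right', ← nonempty_iff_ne_empty, ← card_pos]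
  omega

namespace IsGenericCentral

theorem sum_flatSupports {M : Type*} [AddCommMonoid M] {n m : ℕ} (hn : 1 ≤ n) (hnm : n ≤ m)
    (f : Finset (Fin m) → M) : ∑ J ∈ flatSupports n m, f J =
      f univ + ∑ r ∈ Icc 1 (n - 1), ∑ J ∈ powersetCard r univ, f J := by
  have h : flatSupports n m =
      insert univ (univ.filter fun J : Finset (Fin m) => J ≠ ∅ ∧ J.card < n) := by
    ext J
    simp only [mem_flatSupports, mem_insert, mem_filter, mem_univ, true_and]
    have := univ_ne_empty hn hnm
    grind
  rw [h, sum_insert, sum_filter_card_lt]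
  simp [hnm]

variable {F : Type*} [Field F] {n m : ℕ} {A : HyperplaneArrangement F (Fin n → F)}
  {H : Fin m → AffineSubspace F (Fin n → F)}

/-- Below rank `n` every nonempty subset of `J` is the support of a flat, so no variable is missing.
-/
theorem topWeight_posFlat (hA : IsGenericCentral A H) (hn : 1 ≤ n) (hnm : n ≤ m)
    {t : Finset (Fin m) → A.RatFun} (ht : ∀ I, t I = A.varOf (I.inf H)) {J : Finset (Fin m)}
    (hJ : J.card < n) : A.topWeight (flatSupports n m) (hA.posFlat hn hnm) J =
      ((J.card : A.RatFun) + ∑ M ∈ J.powerset.erase ∅, t M)⁻¹ := by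
  have h : (flatSupports n m).filter (· ⊆ J) = J.powerset.erase ∅ := by
    ext M
    simp only [mem_filter, mem_flatSupports, mem_erase, mem_powerset]
    exact ⟨fun h => ⟨h.1.1, h.2⟩, fun h => ⟨⟨h.1, Or.inl ((card_le_card h.2).trans_lt hJ)⟩, h.2⟩⟩
  rw [topWeight, h]
  congr 2
  refine sum_congr rfl fun M hM => ?_
  rw [ht, hA.varOf_inf hn hnm (mem_erase.1 hM).1]

/-- The extra factor cancels the weight of the full set. The empty support, whose only complete
chain is empty, gives the first sum. -/
theorem exists_isTopologicalZeta_mul_eq (hA : IsGenericCentral A H) (hn : 1 ≤ n) (hnm : n ≤ m)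
    (t : Finset (Fin m) → A.RatFun) (ht : ∀ I, t I = A.varOf (I.inf H))
    (t₁ : A.RatFun) (ht₁ : t₁ = A.varOf (univ.inf H)) :
    ∃ Z : A.RatFun, A.IsTopologicalZeta Z ∧
      Z * ((n : A.RatFun) + t₁ + ∑ r ∈ Icc 1 (n - 1),
          ∑ J ∈ powersetCard r (univ : Finset (Fin m)), t J) =
        ∑ k ∈ range n, (-1 : A.RatFun) ^ k * ((m - 1).choose k : A.RatFun) +
          ∑ ℓ ∈ Icc 1 (n - 1), ∑ I ∈ powersetCard ℓ (univ : Finset (Fin m)),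
            ∑ C ∈ (weakOrderChains I).filter (fun C => C.card = ℓ),
              (∑ k ∈ range (n - ℓ), (-1 : A.RatFun) ^ k * ((m - ℓ - 1).choose k : A.RatFun)) /
                ∏ J ∈ C, ((J.card : A.RatFun) + ∑ M ∈ J.powerset.erase ∅, t M) := by
  obtain ⟨Z, hZ, hZe⟩ := hA.exists_isTopologicalZeta hn hnm
  refine ⟨Z, hZ, ?_⟩
  have ht' : ∀ J ≠ ∅, t J = A.var (hA.posFlat hn hnm J) := fun J hJ => by
    rw [ht, hA.varOf_inf hn hnm hJ]
  have h1 : (n : A.RatFun) + t₁ + ∑ r ∈ Icc 1 (n - 1),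
      ∑ J ∈ powersetCard r (univ : Finset (Fin m)), t J =
      (n : A.RatFun) + ∑ J ∈ flatSupports n m, A.var (hA.posFlat hn hnm J) := by
    rw [← sum_congr rfl fun J hJ => ht' J (mem_flatSupports.1 hJ).1, sum_flatSupports hn hnm,
      ht₁, ← ht, add_assoc]
  have h2 : (univ.filter fun I : Finset (Fin m) => I.card < n) =
      insert ∅ (univ.filter fun J : Finset (Fin m) => J ≠ ∅ ∧ J.card < n) := by
    ext J
    simp only [mem_insert, mem_filter, mem_univ, true_and]
    rcases eq_or_ne J ∅ with rfl | h
    · simp [Nat.lt_of_succ_le hn]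
    · simp [h]
  rw [h1, hZe, mul_comm _⁻¹, mul_assoc,
    inv_mul_cancel₀ (A.natCast_add_sum_var_ne_zero _ _ _ hn), mul_one, h2, sum_insert (by simp),
    sum_filter_card_lt, completeChainSum_empty, card_empty, Nat.sub_zero, Nat.sub_zero, mul_one]
  congr 1
  refine sum_congr rfl fun ℓ hℓ => sum_congr rfl fun I hI => ?_
  have hIc := (mem_powersetCard.1 hI).2
  have hℓn := mem_Icc.1 hℓ
  rw [completeChainSum, hIc, mul_sum]
  refine sum_congr rfl fun C hC => ?_
  rw [div_eq_mul_inv, ← prod_inv_distrib]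
  congr 1
  refine prod_congr rfl fun J hJ => hA.topWeight_posFlat hn hnm ht ?_
  have h3 := card_le_card ((mem_weakOrderChains.1 (mem_filter.1 hC).1).1 J hJ).2
  omega

end IsGenericCentral

end

theorem mainTheorem11 {F : Type*} [Field F] {n m : ℕ} (hn : 1 ≤ n) (hnm : n ≤ m)
    (A : HyperplaneArrangement F (Fin n → F)) (H : Fin m → AffineSubspace F (Fin n → F))
    (hA : IsGenericCentral A H)
    (t : Finset (Fin m) → A.RatFun) (ht : ∀ I, t I = A.varOf (I.inf H))
    (t₁ : A.RatFun) (ht₁ : t₁ = A.varOf (Finset.univ.inf H)) :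
    A.fHP =
        Polynomial.C (1 / (1 - t₁)) * (1 + Polynomial.X) *
            ∑ k ∈ Finset.range n, ((m - 1).choose k : Polynomial A.RatFun) * Polynomial.X ^ k +
          ∑ ℓ ∈ Finset.Icc 1 (n - 1), ∑ k ∈ Finset.range (n - ℓ),
            Polynomial.C (1 / (1 - t₁)) * (1 + Polynomial.X) ^ (ℓ + 1) *
              ((m - ℓ - 1).choose k : Polynomial A.RatFun) * Polynomial.X ^ k *
              ∑ I ∈ Finset.powersetCard ℓ (Finset.univ : Finset (Fin m)),
                Polynomial.C (t I * weakOrderZeta I t) ∧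
      (CharZero F →
        ∃ Z : A.RatFun, A.IsTopologicalZeta Z ∧
          Z * ((n : A.RatFun) + t₁ + ∑ r ∈ Finset.Icc 1 (n - 1),
              ∑ J ∈ Finset.powersetCard r (Finset.univ : Finset (Fin m)), t J) =
            ∑ k ∈ Finset.range n, (-1 : A.RatFun) ^ k * ((m - 1).choose k : A.RatFun) +
              ∑ ℓ ∈ Finset.Icc 1 (n - 1),
                ∑ I ∈ Finset.powersetCard ℓ (Finset.univ : Finset (Fin m)),
                  ∑ C ∈ (weakOrderChains I).filter (fun C => C.card = ℓ),
                    (∑ k ∈ Finset.range (n - ℓ),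
                        (-1 : A.RatFun) ^ k * ((m - ℓ - 1).choose k : A.RatFun)) /
                      ∏ J ∈ C, ((J.card : A.RatFun) + ∑ M ∈ J.powerset.erase ∅, t M)) := by
  exact ⟨hA.fHP_eq hn hnm t ht t₁ ht₁, fun _ =>
    hA.exists_isTopologicalZeta_mul_eq hn hnm t ht t₁ ht₁⟩
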